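/- Let $(\mathcal C,\otimes,I,C)$ be a braided tensor category (written as a strict one), and let $H$ be a Hopf algebra in $\mathcal C$ with $C_{H,H}=C_{H,H}^{-1}$ which is finite, i.e. has a left dual $H^*$ with evaluation $d=d_H:H^*\otimes H\to I$ and coevaluation $b=b_H:I\to H\otimes H^*$. Give $H^*$ the multiplication, unit, comultiplication and counit that are the transposes of the comultiplication, counit, multiplication and unit of $H$, where $(H\otimes H)^*=H^*\otimes H^*$ through the evaluation $d(\mathrm{id}\otimes d\otimes \mathrm{id})$ and the coevaluation $(\mathrm{id}\otimes b\otimes\mathrm{id})b$. Let $A=(H^*)^{op}$, i.e. $H^*$ with the multiplication $m_{H^*}C_{H^*,H^*}$ instead of $m_{H^*}$, and let $\tau=d_H C_{H,A}:H\otimes A\to I$. Then: 1. $A$ is a Hopf algebra in $\mathcal C$. 2. $\tau$ is a skew pairing on $H\otimes A$, that is, $\tau(m\otimes \mathrm{id})=\tau(\mathrm{id}\otimes\tau\otimes \mathrm{id})(\mathrm{id}\otimes \mathrm{id}\otimes\Delta)$, $\tau(\mathrm{id}\otimes m)=(\tau\otimes\tau)(\mathrm{id}\otimes C_{H,A}\otimes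 \mathrm{id})(\Delta\otimes \mathrm{id}\otimes \mathrm{id})$, $\tau(\mathrm{id}\otimes\eta)=\epsilon_H$ and $\tau(\eta\otimes \mathrm{id})=\epsilon_A$. It is symmetric with respect to the braiding, that is, $(\mathrm{id}_U\otimes\tau)(C_{H,U}\otimes \mathrm{id}_A)=(\tau\otimes \mathrm{id}_U)(\mathrm{id}_H\otimes C_{U,A})$ for $U=H,A$, and it has a convolution inverse $\bar\tau:H\otimes A\to I$. 3. Put $\Delta_{H\otimes A}=(\mathrm{id}\otimes C_{H,A}\otimes \mathrm{id})(\Delta_H\otimes\Delta_A)$, $$\alpha=(\tau\otimes \mathrm{id}\otimes\bar\tau)(\mathrm{id}\otimes \mathrm{id}\otimes C_{H,A}\otimes \mathrm{id})(\mathrm{id}\otimes C_{H,A}\otimes\Delta)(\Delta\otimes\Delta):H\otimes A\to A,$$ $$\beta=(\tau\otimes \mathrm{id}\otimes\bar\tau)(\mathrm{id}\otimes C_{H,A}\otimes \mathrm{id}\otimes \mathrm{id})(\Delta\otimes C_{H,A}\otimes \mathrm{id})(\Delta\otimes\Delta):H\otimes A\to H.$$ Let the Drinfeld double $D=D(H)=A\bowtie_\tau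 H$ be the object $A\otimes H$ with multiplication $(m_A\otimes m_H)(\mathrm{id}\otimes\alpha\otimes\beta\otimes \mathrm{id})(\mathrm{id}\otimes\Delta_{H\otimes A}\otimes \mathrm{id})$, unit $\eta_A\otimes\eta_H$, comultiplication $(\mathrm{id}\otimes C_{A,H}\otimes \mathrm{id})(\Delta_A\otimes\Delta_H)$ and counit $\epsilon_A\otimes\epsilon_H$. Then $D$ is a Hopf algebra in $\mathcal C$ (in particular it has an antipode). 4. With $R=[b]=\eta_A\otimes b\otimes\eta_H:I\to D\otimes D$, the pair $(D,R)$ is quasi-triangular. That is, $R$ is convolution invertible in $\mathrm{Hom}_{\mathcal C}(I,D\otimes D)$, and, with $\bar\Delta=\Delta^{cop}=C_{D,D}\Delta$, $(D,\bar\Delta,\epsilon)$ is a coalgebra and $$(\bar\Delta\otimes \mathrm{id})R=(\mathrm{id}\otimes \mathrm{id}\otimes m)(\mathrm{id}\otimes R\otimes \mathrm{id})R,$$ $$(\mathrm{id}\otimes\Delta)R=(m\otimes \mathrm{id}\otimes \mathrm{id})(\mathrm{id}\otimes R\otimes \mathrm{id})R,$$ $$(m\otimes m)(\mathrm{id}\otimes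 C_{D,D}\otimes \mathrm{id})(\bar\Delta\otimes R)=(m\otimes m)(\mathrm{id}\otimes C_{D,D}\otimes \mathrm{id})(R\otimes\Delta).$$ -/

import Mathlib

open CategoryTheory MonoidalCategory
open scoped MonObj ComonObj

/-!
Hopf algebras in a braided tensor category `C` are Mathlib's `HopfObj`, and a left dual
`(U, d : U ⊗ V ⟶ 𝟙_ C, b : 𝟙_ C ⟶ V ⊗ U)` of `V` is `ExactPairing V U`.
Associators and unitors are inserted by the monoidal composition `⊗≫`.
-/

universe v u

namespace BraidedDouble

noncomputable section

section Dual

variable {C : Type u} [Category.{v} C] [MonoidalCategory C]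

/-- The transpose `f^* = (d ⊗ id) (id ⊗ f ⊗ id) (id ⊗ b) : V^* ⟶ U^*` of `f : U ⟶ V`, where
`U' = U^*` and `V' = V^*` are left duals. -/
def transpose {U U' V V' : C} [ExactPairing U U'] [ExactPairing V V'] (f : U ⟶ V) : V' ⟶ U' :=
  𝟙 V' ⊗≫ V' ◁ (η_ U U') ⊗≫ V' ◁ f ▷ U' ⊗≫ (ε_ V V') ▷ U' ⊗≫ 𝟙 U'

variable (H K : C) [ExactPairing H K]

/-- The multiplication of the dual `K = H^*`: the transpose of the comultiplication of `H`, where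
`(H ⊗ H)^* = H^* ⊗ H^*` has the (nested) evaluation `d (id ⊗ d ⊗ id)`. -/
def dualMul [ComonObj H] : K ⊗ K ⟶ K := transpose (Δ[H] : H ⟶ H ⊗ H)

/-- The unit of the dual `K = H^*`: the transpose of the counit of `H`. -/
def dualOne [ComonObj H] : 𝟙_ C ⟶ K := transpose (ε[H] : H ⟶ 𝟙_ C)

/-- The comultiplication of the dual `K = H^*`: the transpose of the multiplication of `H`. -/
def dualComul [MonObj H] : K ⟶ K ⊗ K := transpose (μ[H] : H ⊗ H ⟶ H)

/-- The counit of the dual `K = H^*`: the transpose of the unit of `H`. -/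
def dualCounit [MonObj H] : K ⟶ 𝟙_ C := transpose (η[H] : 𝟙_ C ⟶ H)

end Dual

variable {C : Type u} [Category.{v} C] [MonoidalCategory C] [BraidedCategory C]

/-- The opposite multiplication `m^op = m C_{A,A}`. -/
def opMul {A : C} (m : A ⊗ A ⟶ A) : A ⊗ A ⟶ A := (β_ A A).hom ≫ m

/-- The co-opposite comultiplication `Δ^cop = C_{A,A} Δ`. -/
def copComul {A : C} (δ : A ⟶ A ⊗ A) : A ⟶ A ⊗ A := δ ≫ (β_ A A).hom

/-- The Hopf algebra structure of `A = (H^*)^op`: the opposite multiplication of `H^*`, with the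
unit, comultiplication and counit of `H^*`. -/
structure IsDualOp (H A : C) [HopfObj H] [ExactPairing H A] [HopfObj A] : Prop where
  mul_eq : μ[A] = opMul (dualMul H A)
  one_eq : η[A] = dualOne H A
  comul_eq : Δ[A] = dualComul H A
  counit_eq : ε[A] = dualCounit H A

section Pairing

variable {H A : C}

/-- Skew pairings `τ : H ⊗ A ⟶ 𝟙_ C` of bialgebras. -/
structure IsSkewPairing [BimonObj H] [BimonObj A] (τ : H ⊗ A ⟶ 𝟙_ C) : Prop where
  /-- `τ (m ⊗ id) = τ (id ⊗ τ ⊗ id) (id ⊗ id ⊗ Δ)` -/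
  mul_left : μ[H] ▷ A ≫ τ = (H ⊗ H) ◁ Δ[A] ⊗≫ H ◁ τ ▷ A ⊗≫ τ
  /-- `τ (id ⊗ m) = (τ ⊗ τ) (id ⊗ C_{H,A} ⊗ id) (Δ ⊗ id ⊗ id)` -/
  mul_right : H ◁ μ[A] ≫ τ =
    Δ[H] ▷ (A ⊗ A) ⊗≫ H ◁ (β_ H A).hom ▷ A ⊗≫ (τ ⊗ₘ τ) ⊗≫ 𝟙 (𝟙_ C)
  /-- `τ (id ⊗ η) = ε_H` -/
  one_right : (ρ_ H).inv ≫ H ◁ η[A] ≫ τ = ε[H]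
  /-- `τ (η ⊗ id) = ε_A` -/
  one_left : (λ_ A).inv ≫ η[H] ▷ A ≫ τ = ε[A]

/-- `(id_U ⊗ τ) (C_{V,U} ⊗ id_W) = (τ ⊗ id_U) (id_V ⊗ C_{U,W})` for `τ : V ⊗ W ⟶ 𝟙_ C`. -/
def IsSymmetricAt {V W : C} (τ : V ⊗ W ⟶ 𝟙_ C) (U : C) : Prop :=
  (β_ V U).hom ▷ W ⊗≫ U ◁ τ ⊗≫ 𝟙 U = 𝟙 ((V ⊗ U) ⊗ W) ⊗≫ V ◁ (β_ U W).hom ⊗≫ τ ▷ U ⊗≫ 𝟙 U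

/-- `τ : V ⊗ W ⟶ 𝟙_ C` is symmetric with respect to the braiding. -/
def IsSymmetricPairing {V W : C} (τ : V ⊗ W ⟶ 𝟙_ C) : Prop :=
  IsSymmetricAt τ V ∧ IsSymmetricAt τ W

/-- `f` and `g` are inverse to each other in the convolution monoid of morphisms `X ⟶ Y`, from a
coalgebra `X` to an algebra `Y`. -/
def IsConvInverse {X Y : C} [ComonObj X] [MonObj Y] (f g : X ⟶ Y) : Prop :=
  (show Conv X Y from f) * (show Conv X Y from g) = 1 ∧
    (show Conv X Y from g) * (show Conv X Y from f) = 1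

end Pairing

section DoubleCross

variable {A H : C}

/-- `α = (τ ⊗ id ⊗ τ') (id ⊗ id ⊗ C_{H,A} ⊗ id) (id ⊗ C_{H,A} ⊗ Δ) (Δ ⊗ Δ) : H ⊗ A ⟶ A`. -/
def leftAct [ComonObj A] [ComonObj H] (τ τ' : H ⊗ A ⟶ 𝟙_ C) : H ⊗ A ⟶ A :=
  (Δ[H] ⊗ₘ Δ[A]) ⊗≫ H ◁ ((β_ H A).hom ⊗ₘ Δ[A]) ⊗≫ (H ⊗ A) ◁ ((β_ H A).hom ▷ A) ⊗≫
    (τ ⊗ₘ (A ◁ τ')) ⊗≫ 𝟙 A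

/-- `β = (τ ⊗ id ⊗ τ') (id ⊗ C_{H,A} ⊗ id ⊗ id) (Δ ⊗ C_{H,A} ⊗ id) (Δ ⊗ Δ) : H ⊗ A ⟶ H`. -/
def rightAct [ComonObj A] [ComonObj H] (τ τ' : H ⊗ A ⟶ 𝟙_ C) : H ⊗ A ⟶ H :=
  (Δ[H] ⊗ₘ Δ[A]) ⊗≫ (Δ[H] ⊗ₘ ((β_ H A).hom ▷ A)) ⊗≫ H ◁ ((β_ H A).hom ▷ (H ⊗ A)) ⊗≫
    (τ ⊗ₘ (H ◁ τ')) ⊗≫ 𝟙 H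

/-- The multiplication `(m_A ⊗ m_H) (id ⊗ α ⊗ β ⊗ id) (id ⊗ Δ_{H ⊗ A} ⊗ id)` of the double cross
product `A ⋈_τ H`, where `τ'` is the convolution inverse of `τ` and
`Δ_{H ⊗ A} = (id ⊗ C_{H,A} ⊗ id) (Δ_H ⊗ Δ_A)`. -/
def doubleCrossMul [MonObj A] [ComonObj A] [MonObj H] [ComonObj H] (τ τ' : H ⊗ A ⟶ 𝟙_ C) :
    (A ⊗ H) ⊗ (A ⊗ H) ⟶ A ⊗ H :=
  𝟙 ((A ⊗ H) ⊗ (A ⊗ H)) ⊗≫ A ◁ (Δ[H ⊗ A] ▷ H) ⊗≫ A ◁ ((leftAct τ τ' ⊗ₘ rightAct τ τ') ▷ H) ⊗≫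
    (μ[A] ⊗ₘ μ[H])

end DoubleCross

section Quasitriangular

variable (D : C)

attribute [local instance] ComonObj.instTensorUnit in
/-- `(D, R, δ)` is a quasi-triangular bialgebra. -/
structure IsQuasitriangularWith [BimonObj D] (R : 𝟙_ C ⟶ D ⊗ D) (δ : D ⟶ D ⊗ D) : Prop where
  /-- `R` is convolution invertible. -/
  invertible : ∃ R' : 𝟙_ C ⟶ D ⊗ D, IsConvInverse R R'
  /-- `(D, δ, ε)` is a coalgebra. -/
  coassoc : δ ≫ D ◁ δ = δ ≫ δ ▷ D ≫ (α_ D D D).hom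
  counit_left : δ ≫ ε[D] ▷ D = (λ_ D).inv
  counit_right : δ ≫ D ◁ ε[D] = (ρ_ D).inv
  /-- `(δ ⊗ id) R = (id ⊗ id ⊗ m) (id ⊗ R ⊗ id) R` -/
  qt1 : R ≫ δ ▷ D = R ⊗≫ D ◁ R ▷ D ⊗≫ (D ⊗ D) ◁ μ[D]
  /-- `(id ⊗ Δ) R = (m ⊗ id ⊗ id) (id ⊗ R ⊗ id) R` -/
  qt2 : R ≫ D ◁ Δ[D] = R ⊗≫ D ◁ R ▷ D ⊗≫ μ[D] ▷ (D ⊗ D)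
  /-- `(m ⊗ m) (id ⊗ C ⊗ id) (δ ⊗ R) = (m ⊗ m) (id ⊗ C ⊗ id) (R ⊗ Δ)` -/
  qt3 : 𝟙 D ⊗≫ (δ ⊗ₘ R) ⊗≫ D ◁ (β_ D D).hom ▷ D ⊗≫ (μ[D] ⊗ₘ μ[D]) =
    𝟙 D ⊗≫ (R ⊗ₘ Δ[D]) ⊗≫ D ◁ (β_ D D).hom ▷ D ⊗≫ (μ[D] ⊗ₘ μ[D])

/-- `(D, R)` is quasi-triangular if `(D, R, Δ^cop)` is. -/
def IsQuasitriangular [BimonObj D] (R : 𝟙_ C ⟶ D ⊗ D) : Prop :=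
  IsQuasitriangularWith D R (copComul Δ[D])

variable {D}

/-- The object `D` with multiplication `m`, unit `e`, comultiplication `δ` and counit `c` is a Hopf
algebra (there is an antipode, and it is unique), quasi-triangular with R-matrix `R`. -/
def IsQuasitriangularHopf (m : D ⊗ D ⟶ D) (e : 𝟙_ C ⟶ D) (δ : D ⟶ D ⊗ D) (c : D ⟶ 𝟙_ C)
    (R : 𝟙_ C ⟶ D ⊗ D) : Prop :=
  ∃ _ : HopfObj D, μ[D] = m ∧ η[D] = e ∧ Δ[D] = δ ∧ ε[D] = c ∧ IsQuasitriangular D R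

end Quasitriangular

section Drinfeld

variable (H A : C) [ExactPairing H A]

/-- `τ = d_H C_{H,A} : H ⊗ A ⟶ 𝟙_ C`. -/
def evalPairing : H ⊗ A ⟶ 𝟙_ C := (β_ H A).hom ≫ (ε_ H A)

/-- `[b] = η_A ⊗ b ⊗ η_H : 𝟙_ C ⟶ (A ⊗ H) ⊗ (A ⊗ H)`. -/
def coevalMatrix [MonObj H] [MonObj A] : 𝟙_ C ⟶ (A ⊗ H) ⊗ (A ⊗ H) :=
  𝟙 (𝟙_ C) ⊗≫ (η[A] ⊗ₘ ((η_ H A) ⊗ₘ η[H])) ⊗≫ 𝟙 ((A ⊗ H) ⊗ (A ⊗ H))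

end Drinfeld

end

end BraidedDouble

/-! The hypothesis says that the double braiding of `H` with itself is trivial. Triviality of double
braidings passes to tensor products and to duals (`Centralizes.tensor`, `Centralizes.dual`), so the
full subcategory on the iterated tensor products of `H`, `A` and the unit is symmetric. It contains
all the data, so the theorem is proved in a symmetric category (`exists_drinfeldDouble`) and then
read off in `C`.

In a symmetric category `A` is equally the dual of the co-opposite of `H` (`IsDualCop`). Its
antipode is the transpose of the inverse of the antipode `S` of `H`, so `S` must be shown
invertible. The dual of `H` is a Hopf module over `H`, and the fundamental theorem of Hopf modules
allows `x` to be recovered from `S(x)` (`exists_antipode_comp_eq_id`); the same argument for the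
dual gives the inverse on the other side (`isIso_antipode`).

For a skew pairing `τ`, the map `f ↦ τ(id ⊗ f)` is a homomorphism of convolution monoids, so `τ` is
a unit `t` with inverse `τ(id ⊗ S_A)`. The straightening map of the double, `ψ : H ⊗ A ⟶ A ⊗ H`, is
conjugation `x ↦ t(x₁) x₂ t⁻¹(x₃)` followed by the braiding (`exchange`). Conjugation by a unit `u`
on any comonoid is a comonoid map, multiplicative in `u` and natural in the comonoid
(`isComonHom_conj`, `conj_mul`, `comp_conj`). The pairing axioms factor the pullbacks of `t` along
the two multiplications, so `ψ` is a distributive law (`IsSkewPairing.isDistributiveLaw`).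
Associativity of the double is then formal, and its bimonoid axioms hold because its multiplication
and unit are built from comonoid maps. The identity of the double is a convolution product of two
invertible maps, which yields the antipode.

The R-matrix is the image of the coevaluation. The two coproduct axioms are transposition written
with coevaluations. Bending a leg is a homomorphism of convolution monoids sending `id_H` to the
coevaluation, so `R` is invertible. The relation `Δ^cop R = R Δ` is multiplicative in the element of
the double, hence need only be checked on `H` and on `A`; there, bending the coevaluation reduces it
to `ract_conj`, the statement that conjugation by `t` carries the right action of `t` to its left
action. -/

namespace BraidedDouble

/-! ### Comonoid morphisms: structural maps, multiplications and units. -/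

section ComonHom

variable {C : Type u} [Category.{v} C] [MonoidalCategory C] [BraidedCategory C]

attribute [local instance] ComonObj.instTensorUnit

instance isComonHom_tensorHom {X X' Y Y' : C} [ComonObj X] [ComonObj X'] [ComonObj Y]
    [ComonObj Y'] (f : X ⟶ X') (g : Y ⟶ Y') [IsComonHom f] [IsComonHom g] :
    IsComonHom (f ⊗ₘ g) where
  hom_counit := by
    simp only [Comon.tensorObj_counit, tensorHom_comp_tensorHom_assoc, IsComonHom.hom_counit]
  hom_comul := by
    simp only [Comon.tensorObj_comul, tensorHom_comp_tensorHom_assoc, IsComonHom.hom_comul,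
      Category.assoc, ← tensorμ_natural]

instance isComonHom_whiskerRight {X X' : C} (Y : C) [ComonObj X] [ComonObj X'] [ComonObj Y]
    (f : X ⟶ X') [IsComonHom f] : IsComonHom (f ▷ Y) := by
  rw [← tensorHom_id]; infer_instance

instance isComonHom_whiskerLeft (X : C) {Y Y' : C} [ComonObj X] [ComonObj Y] [ComonObj Y']
    (f : Y ⟶ Y') [IsComonHom f] : IsComonHom (X ◁ f) := by
  rw [← id_tensorHom]; infer_instance

instance isComonHom_associator (X Y Z : C) [ComonObj X] [ComonObj Y] [ComonObj Z] :
    IsComonHom (α_ X Y Z).hom := by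
  have h := (α_ (Comon.mk X) (Comon.mk Y) (Comon.mk Z)).hom.isComonHom_hom
  rw [Comon.monoidal_associator_hom_hom] at h
  have e : (α_ X Y Z).hom = 𝟙 (X ⊗ Y) ▷ Z ≫ (α_ X Y Z).hom ≫ X ◁ 𝟙 (Y ⊗ Z) := by simp
  rw [e]
  exact h

instance isComonHom_associator_inv (X Y Z : C) [ComonObj X] [ComonObj Y] [ComonObj Z] :
    IsComonHom (α_ X Y Z).inv := inferInstance

instance isComonHom_leftUnitor (X : C) [ComonObj X] : IsComonHom (λ_ X).hom := by
  have h := (λ_ (Comon.mk X)).hom.isComonHom_hom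
  rw [Comon.monoidal_leftUnitor_hom_hom] at h
  have e : (λ_ X).hom = 𝟙 (𝟙_ C) ▷ X ≫ (λ_ X).hom := by simp
  rw [e]
  exact h

instance isComonHom_rightUnitor (X : C) [ComonObj X] : IsComonHom (ρ_ X).hom := by
  have h := (ρ_ (Comon.mk X)).hom.isComonHom_hom
  rw [Comon.monoidal_rightUnitor_hom_hom] at h
  have e : (ρ_ X).hom = X ◁ 𝟙 (𝟙_ C) ≫ (ρ_ X).hom := by simp
  rw [e]
  exact h

instance isComonHom_counit (X : C) [ComonObj X] : IsComonHom ε[X] where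
  hom_counit := by simp
  hom_comul := by
    rw [MonoidalCategory.tensorHom_def, ComonObj.counit_comul_assoc, ComonObj.instTensorUnit_comul,
      leftUnitor_inv_naturality]

instance isComonHom_mul (X : C) [BimonObj X] : IsComonHom μ[X] where
  hom_counit := by simp
  hom_comul := by simp

instance isComonHom_one (X : C) [BimonObj X] : IsComonHom η[X] where
  hom_counit := by simp
  hom_comul := by simp [MonObj.tensorObj.one_def, ComonObj.instTensorUnit_comul]

end ComonHom

section Symm

variable {C : Type u} [Category.{v} C] [MonoidalCategory C] [SymmetricCategory C]

lemma counit_braiding (X Y : C) [ComonObj X] [ComonObj Y] :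
    (β_ X Y).hom ≫ ε[Y ⊗ X] = ε[X ⊗ Y] := by
  rw [Comon.tensorObj_counit, Comon.tensorObj_counit, ← BraidedCategory.braiding_naturality_assoc,
    braiding_leftUnitor, unitors_equal]

/-- The two diagrams differ by a double crossing of `X` and `Y`, which cancels by symmetry. This is
what makes the braiding a comonoid map. -/
lemma tensorμ_braiding (X Y : C) :
    tensorμ X X Y Y ≫ ((β_ X Y).hom ⊗ₘ (β_ X Y).hom) =
      (β_ (X ⊗ X) (Y ⊗ Y)).hom ≫ tensorμ Y Y X X := by
  have h : Y ◁ (β_ X Y).hom ▷ X ≫ Y ◁ (β_ Y X).hom ▷ X = 𝟙 _ := by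
    rw [← whiskerLeft_comp, ← comp_whiskerRight, SymmetricCategory.symmetry]
    simp
  calc
    _ = 𝟙 _ ⊗≫ X ◁ (β_ X Y).hom ▷ Y ⊗≫ ((β_ X Y).hom ▷ (X ⊗ Y) ≫ (Y ⊗ X) ◁ (β_ X Y).hom) ⊗≫
        𝟙 _ := by
      simp only [tensorμ, MonoidalCategory.tensorHom_def]; monoidal
    _ = 𝟙 _ ⊗≫ X ◁ (β_ X Y).hom ▷ Y ⊗≫ (β_ X Y).hom ▷ (X ⊗ Y) ⊗≫ Y ◁ X ◁ (β_ X Y).hom ⊗≫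
        (Y ◁ (β_ X Y).hom ▷ X ≫ Y ◁ (β_ Y X).hom ▷ X) ⊗≫ 𝟙 _ := by
      rw [h]; monoidal
    _ = _ := by
      simp only [tensorμ, BraidedCategory.braiding_tensor_right_hom,
        BraidedCategory.braiding_tensor_left_hom]
      monoidal

instance isComonHom_braiding (X Y : C) [ComonObj X] [ComonObj Y] :
    IsComonHom (β_ X Y).hom where
  hom_counit := counit_braiding X Y
  hom_comul := by
    rw [Comon.tensorObj_comul, Comon.tensorObj_comul, Category.assoc, tensorμ_braiding,
      BraidedCategory.braiding_naturality_assoc]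

end Symm

/-! ### Convolution monoids and conjugation by convolution units. -/

section ConvFunctoriality

variable {C : Type u} [Category.{v} C] [MonoidalCategory C]

/-- The morphism underlying an element of a convolution monoid. -/
def convHom {X N : C} (u : Conv X N) : X ⟶ N := u

lemma convHom_mul {X N : C} [ComonObj X] [MonObj N] (u v : Conv X N) :
    convHom (u * v) = Δ[X] ≫ convHom u ▷ X ≫ N ◁ convHom v ≫ μ[N] := rfl

lemma convHom_one {X N : C} [ComonObj X] [MonObj N] :
    convHom (1 : Conv X N) = ε[X] ≫ η[N] := rfl

/-- Precomposition with a morphism of comonoids is a homomorphism of convolution monoids. -/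
def convComap {X Y : C} [ComonObj X] [ComonObj Y] (N : C) [MonObj N] (f : X ⟶ Y) [IsComonHom f] :
    Conv Y N →* Conv X N where
  toFun u := f ≫ convHom u
  map_one' := by
    change f ≫ ε[Y] ≫ η[N] = ε[X] ≫ η[N]
    simp
  map_mul' u v := by
    change f ≫ Δ[Y] ≫ convHom u ▷ Y ≫ N ◁ convHom v ≫ μ[N] =
      Δ[X] ≫ (f ≫ convHom u) ▷ X ≫ N ◁ (f ≫ convHom v) ≫ μ[N]
    rw [IsComonHom.hom_comul_assoc, MonoidalCategory.tensorHom_def']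
    simp only [comp_whiskerRight, whiskerLeft_comp, Category.assoc]
    rw [whisker_exchange_assoc, whisker_exchange_assoc]

lemma convHom_convComap {X Y : C} [ComonObj X] [ComonObj Y] {N : C} [MonObj N] (f : X ⟶ Y)
    [IsComonHom f] (u : Conv Y N) : convHom (convComap N f u) = f ≫ convHom u := rfl

/-- Postcomposition with a morphism of monoids is a homomorphism of convolution monoids. -/
def convMap (X : C) [ComonObj X] {N N' : C} [MonObj N] [MonObj N'] (f : N ⟶ N') [IsMonHom f] :
    Conv X N →* Conv X N' where
  toFun u := convHom u ≫ f
  map_one' := by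
    change (ε[X] ≫ η[N]) ≫ f = ε[X] ≫ η[N']
    simp
  map_mul' u v := by
    change (Δ[X] ≫ convHom u ▷ X ≫ N ◁ convHom v ≫ μ[N]) ≫ f =
      Δ[X] ≫ (convHom u ≫ f) ▷ X ≫ N' ◁ (convHom v ≫ f) ≫ μ[N']
    simp only [comp_whiskerRight, whiskerLeft_comp, Category.assoc, IsMonHom.mul_hom,
      MonoidalCategory.tensorHom_def]
    rw [whisker_exchange_assoc]

end ConvFunctoriality

section Actions

variable {C : Type u} [Category.{v} C] [MonoidalCategory C] {X Y : C} [ComonObj X] [ComonObj Y]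

/-- The left action `x ↦ u(x₁) x₂`. -/
def lact (u : Conv X (𝟙_ C)) : X ⟶ X := Δ[X] ≫ convHom u ▷ X ≫ (λ_ X).hom

/-- The right action `x ↦ x₁ u(x₂)`. -/
def ract (u : Conv X (𝟙_ C)) : X ⟶ X := Δ[X] ≫ X ◁ convHom u ≫ (ρ_ X).hom

lemma lact_comul (u : Conv X (𝟙_ C)) : lact u ≫ Δ[X] = Δ[X] ≫ lact u ▷ X := by
  simp only [lact]
  generalize convHom u = f
  calc
    _ = Δ[X] ≫ (f ▷ X ≫ 𝟙_ C ◁ Δ[X]) ⊗≫ 𝟙 _ := by monoidal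
    _ = (Δ[X] ≫ X ◁ Δ[X]) ⊗≫ f ▷ X ▷ X ⊗≫ 𝟙 _ := by rw [← whisker_exchange]; monoidal
    _ = _ := by rw [ComonObj.comul_assoc]; monoidal

lemma ract_comul (u : Conv X (𝟙_ C)) : ract u ≫ Δ[X] = Δ[X] ≫ X ◁ ract u := by
  simp only [ract]
  generalize convHom u = f
  calc
    _ = Δ[X] ≫ (X ◁ f ≫ Δ[X] ▷ 𝟙_ C) ⊗≫ 𝟙 _ := by monoidal
    _ = (Δ[X] ≫ Δ[X] ▷ X ≫ (α_ X X X).hom) ⊗≫ X ◁ X ◁ f ⊗≫ 𝟙 _ := by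
      rw [whisker_exchange]; monoidal
    _ = _ := by rw [← ComonObj.comul_assoc]; monoidal

/-- By coassociativity both sides are `x₁ u(x₂) ⊗ x₃`. -/
lemma comul_ract_whiskerRight (u : Conv X (𝟙_ C)) :
    Δ[X] ≫ ract u ▷ X = Δ[X] ≫ X ◁ lact u := by
  simp only [lact, ract]
  generalize convHom u = f
  calc
    _ = (Δ[X] ≫ Δ[X] ▷ X ≫ (α_ X X X).hom) ⊗≫ X ◁ f ▷ X ⊗≫ 𝟙 _ := by monoidal
    _ = _ := by rw [← ComonObj.comul_assoc]; monoidal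

lemma lact_mul (u v : Conv X (𝟙_ C)) : lact (u * v) = lact u ≫ lact v := by
  have h : lact u ≫ lact v = (lact u ≫ Δ[X]) ≫ convHom v ▷ X ≫ (λ_ X).hom := by
    simp [lact]
  rw [h, lact_comul]
  simp only [lact, convHom_mul]
  generalize convHom u = f
  generalize convHom v = g
  change Δ[X] ≫ (Δ[X] ≫ f ▷ X ≫ (𝟙_ C) ◁ g ≫ (λ_ _).hom) ▷ X ≫ (λ_ X).hom = _
  monoidal

lemma ract_mul (u v : Conv X (𝟙_ C)) : ract (u * v) = ract v ≫ ract u := by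
  have h : ract v ≫ ract u = (ract v ≫ Δ[X]) ≫ X ◁ convHom u ≫ (ρ_ X).hom := by
    simp [ract]
  rw [h, ract_comul]
  simp only [ract, convHom_mul]
  generalize convHom u = f
  generalize convHom v = g
  change Δ[X] ≫ X ◁ (Δ[X] ≫ f ▷ X ≫ (𝟙_ C) ◁ g ≫ (λ_ _).hom) ≫ (ρ_ X).hom = _
  rw [← whisker_exchange_assoc]
  monoidal

lemma lact_one : lact (1 : Conv X (𝟙_ C)) = 𝟙 X := by
  simp [lact, convHom_one]

lemma ract_one : ract (1 : Conv X (𝟙_ C)) = 𝟙 X := by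
  simp [ract, convHom_one]

lemma lact_ract (u v : Conv X (𝟙_ C)) : lact u ≫ ract v = ract v ≫ lact u := by
  have h : lact u ≫ ract v = (lact u ≫ Δ[X]) ≫ X ◁ convHom v ≫ (ρ_ X).hom := by
    simp [ract]
  rw [h, lact_comul, Category.assoc, ← whisker_exchange_assoc]
  simp [ract]

lemma comp_lact (f : X ⟶ Y) [IsComonHom f] (u : Conv Y (𝟙_ C)) :
    f ≫ lact u = lact (convComap _ f u) ≫ f := by
  simp only [lact, convHom_convComap, IsComonHom.hom_comul_assoc, Category.assoc,
    comp_whiskerRight, MonoidalCategory.tensorHom_def']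
  rw [← leftUnitor_naturality, whisker_exchange_assoc, whisker_exchange_assoc]

lemma comp_ract (f : X ⟶ Y) [IsComonHom f] (u : Conv Y (𝟙_ C)) :
    f ≫ ract u = ract (convComap _ f u) ≫ f := by
  simp only [ract, convHom_convComap, IsComonHom.hom_comul_assoc, Category.assoc,
    whiskerLeft_comp, MonoidalCategory.tensorHom_def]
  rw [← rightUnitor_naturality, ← whisker_exchange_assoc, ← whisker_exchange_assoc]

lemma ract_counit (u : Conv X (𝟙_ C)) : ract u ≫ ε[X] = convHom u := by
  rw [ract, Category.assoc, Category.assoc, ← rightUnitor_naturality, whisker_exchange_assoc,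
    ComonObj.counit_comul_assoc]
  simp [← unitors_equal]

lemma lact_comp (u v : Conv X (𝟙_ C)) : lact u ≫ convHom v = convHom (u * v) := by
  simp [lact, convHom_mul]

/-- The conjugation `x ↦ u(x₁) x₂ u⁻¹(x₃)`. -/
def conj (u : (Conv X (𝟙_ C))ˣ) : X ⟶ X := lact u.1 ≫ ract (u⁻¹).1

/-- Left and right actions commute, and inversion undoes the order reversal in `ract_mul`. A
factorization of a unit thus becomes a factorization of its conjugation. -/
lemma conj_mul (u v : (Conv X (𝟙_ C))ˣ) : conj (u * v) = conj u ≫ conj v := by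
  simp only [conj, Units.val_mul, mul_inv_rev, lact_mul, ract_mul, Category.assoc]
  rw [← Category.assoc (lact v.1), lact_ract]
  simp only [Category.assoc]

lemma conj_one : conj (1 : (Conv X (𝟙_ C))ˣ) = 𝟙 X := by
  simp [conj, lact_one, ract_one]

/-- This moves multiplications and units, which are comonoid maps, past a conjugation at the price
of pulling the unit back. -/
lemma comp_conj (f : X ⟶ Y) [IsComonHom f] (u : (Conv Y (𝟙_ C))ˣ) :
    f ≫ conj u = conj (Units.map (convComap _ f) u) ≫ f := by
  rw [conj, ← Category.assoc, comp_lact, Category.assoc, comp_ract, conj, Category.assoc]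
  rfl

/-- The relation `Δ^cop R = R Δ` of the double comes down to this identity. -/
lemma ract_conj (u : (Conv X (𝟙_ C))ˣ) : ract u.1 ≫ conj u = lact u.1 := by
  rw [conj, lact_ract, ← Category.assoc, ← ract_mul, Units.inv_mul, ract_one, Category.id_comp]

/-- The coproduct of `u(x₁) x₂ u⁻¹(x₃)` is `u(x₁) x₂ ⊗ x₃ u⁻¹(x₄)`; inserting `u⁻¹ * u = 1` between
the two legs makes each of them a conjugate. -/
instance isComonHom_conj (u : (Conv X (𝟙_ C))ˣ) : IsComonHom (conj u) where
  hom_counit := by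
    rw [conj, Category.assoc, ract_counit, lact_comp, Units.mul_inv, convHom_one]
    simp
  hom_comul := by
    have h : X ◁ lact (u⁻¹).1 ≫ X ◁ lact u.1 = 𝟙 _ := by
      rw [← whiskerLeft_comp, ← lact_mul, Units.inv_mul, lact_one, whiskerLeft_id]
    calc
      _ = Δ[X] ≫ X ◁ ract (u⁻¹).1 ≫ lact u.1 ▷ X := by
        rw [conj, Category.assoc, ract_comul, ← Category.assoc, lact_comul, Category.assoc,
          whisker_exchange]
      _ = Δ[X] ≫ X ◁ lact (u⁻¹).1 ≫ X ◁ lact u.1 ≫ X ◁ ract (u⁻¹).1 ≫ lact u.1 ▷ X := by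
        rw [reassoc_of% h]
      _ = Δ[X] ≫ ract (u⁻¹).1 ▷ X ≫ X ◁ lact u.1 ≫ X ◁ ract (u⁻¹).1 ≫ lact u.1 ▷ X := by
        rw [← Category.assoc (Δ[X]), ← comul_ract_whiskerRight, Category.assoc]
      _ = _ := by
        have h' : conj u ⊗ₘ conj u =
            (ract (u⁻¹).1 ▷ X ≫ lact u.1 ▷ X) ≫ X ◁ lact u.1 ≫ X ◁ ract (u⁻¹).1 := by
          rw [MonoidalCategory.tensorHom_def, ← comp_whiskerRight, ← whiskerLeft_comp, ← lact_ract]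
          rfl
        simp only [h', Category.assoc, whisker_exchange, whisker_exchange_assoc]

end Actions

section Tensor

variable {C : Type u} [Category.{v} C] [MonoidalCategory C] [BraidedCategory C] (X Y : C)
    [ComonObj X] [ComonObj Y]

attribute [local instance] ComonObj.instTensorUnit

/-- A functional on one tensor factor, extended by the counit of the other, acts on its own factor
alone. With the three variants below, conjugations on different factors become conjugations by
elements of a single convolution monoid. -/
lemma whiskerLeft_lact (u : Conv Y (𝟙_ C)) :
    X ◁ lact u = lact (convComap _ (ε[X] ▷ Y ≫ (λ_ Y).hom) u) := by
  simp only [lact, convHom_convComap, Comon.tensorObj_comul]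
  generalize convHom u = f
  have h : ((ε[X] ▷ Y ≫ (λ_ Y).hom) ≫ f) ▷ (X ⊗ Y) =
      ((ε[X] ⊗ₘ f) ⊗ₘ (𝟙 X ⊗ₘ 𝟙 Y)) ≫ (λ_ (𝟙_ C)).hom ▷ (X ⊗ Y) := by
    simp [MonoidalCategory.tensorHom_def]
  rw [h, Category.assoc, Category.assoc, ← tensorμ_natural_assoc, ← leftUnitor_monoidal]
  simp only [tensorHom_comp_tensorHom, tensorHom_id,
    ComonObj.counit_comul_assoc, Iso.inv_hom_id]
  simp

lemma whiskerLeft_ract (u : Conv Y (𝟙_ C)) :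
    X ◁ ract u = ract (convComap _ (ε[X] ▷ Y ≫ (λ_ Y).hom) u) := by
  simp only [ract, convHom_convComap, Comon.tensorObj_comul]
  generalize convHom u = f
  have h : (X ⊗ Y) ◁ ((ε[X] ▷ Y ≫ (λ_ Y).hom) ≫ f) =
      ((𝟙 X ⊗ₘ 𝟙 Y) ⊗ₘ (ε[X] ⊗ₘ f)) ≫ (X ⊗ Y) ◁ (λ_ (𝟙_ C)).hom := by
    simp [MonoidalCategory.tensorHom_def]
  rw [h, Category.assoc, Category.assoc, ← tensorμ_natural_assoc, ← rightUnitor_monoidal]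
  simp only [tensorHom_comp_tensorHom, id_tensorHom,
    ComonObj.comul_counit_assoc, Iso.inv_hom_id]

lemma lact_whiskerRight (u : Conv X (𝟙_ C)) :
    lact u ▷ Y = lact (convComap _ (X ◁ ε[Y] ≫ (ρ_ X).hom) u) := by
  simp only [lact, convHom_convComap, Comon.tensorObj_comul]
  generalize convHom u = f
  have h : ((X ◁ ε[Y] ≫ (ρ_ X).hom) ≫ f) ▷ (X ⊗ Y) =
      ((f ⊗ₘ ε[Y]) ⊗ₘ (𝟙 X ⊗ₘ 𝟙 Y)) ≫ (λ_ (𝟙_ C)).hom ▷ (X ⊗ Y) := by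
    simp [MonoidalCategory.tensorHom_def', unitors_equal]
  rw [h, Category.assoc, Category.assoc, ← tensorμ_natural_assoc, ← leftUnitor_monoidal]
  simp only [tensorHom_comp_tensorHom, tensorHom_id,
    ComonObj.counit_comul_assoc, Iso.inv_hom_id]

lemma ract_whiskerRight (u : Conv X (𝟙_ C)) :
    ract u ▷ Y = ract (convComap _ (X ◁ ε[Y] ≫ (ρ_ X).hom) u) := by
  simp only [ract, convHom_convComap, Comon.tensorObj_comul]
  generalize convHom u = f
  have h : (X ⊗ Y) ◁ ((X ◁ ε[Y] ≫ (ρ_ X).hom) ≫ f) =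
      ((𝟙 X ⊗ₘ 𝟙 Y) ⊗ₘ (f ⊗ₘ ε[Y])) ≫ (X ⊗ Y) ◁ (λ_ (𝟙_ C)).hom := by
    simp [MonoidalCategory.tensorHom_def', unitors_equal]
  rw [h, Category.assoc, Category.assoc, ← tensorμ_natural_assoc, ← rightUnitor_monoidal]
  simp only [tensorHom_comp_tensorHom, id_tensorHom,
    ComonObj.comul_counit_assoc, Iso.inv_hom_id]
  simp

lemma whiskerLeft_conj (u : (Conv Y (𝟙_ C))ˣ) :
    X ◁ conj u = conj (Units.map (convComap _ (ε[X] ▷ Y ≫ (λ_ Y).hom)) u) := by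
  rw [conj, whiskerLeft_comp, whiskerLeft_lact, whiskerLeft_ract]
  rfl

lemma conj_whiskerRight (u : (Conv X (𝟙_ C))ˣ) :
    conj u ▷ Y = conj (Units.map (convComap _ (X ◁ ε[Y] ≫ (ρ_ X).hom)) u) := by
  rw [conj, comp_whiskerRight, lact_whiskerRight, ract_whiskerRight]
  rfl

end Tensor

/-! ### Distributive laws and the multiplication they define. -/

section Distributive

variable {C : Type u} [Category.{v} C] [MonoidalCategory C] {A H : C} [MonObj A] [MonObj H]

/-- A distributive law `H ⊗ A ⟶ A ⊗ H` between monoids. -/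
structure IsDistributiveLaw (ψ : H ⊗ A ⟶ A ⊗ H) : Prop where
  mul_left : μ[H] ▷ A ≫ ψ =
    (α_ H H A).hom ≫ H ◁ ψ ≫ (α_ H A H).inv ≫ ψ ▷ H ≫ (α_ A H H).hom ≫ A ◁ μ[H]
  mul_right : H ◁ μ[A] ≫ ψ =
    (α_ H A A).inv ≫ ψ ▷ A ≫ (α_ A H A).hom ≫ A ◁ ψ ≫ (α_ A A H).inv ≫ μ[A] ▷ H
  one_left : η[H] ▷ A ≫ ψ = (λ_ A).hom ≫ (ρ_ A).inv ≫ A ◁ η[H]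
  one_right : H ◁ η[A] ≫ ψ = (ρ_ H).hom ≫ (λ_ H).inv ≫ η[A] ▷ H

/-- The multiplication on `A ⊗ H` defined by `ψ : H ⊗ A ⟶ A ⊗ H`. -/
def crossMul (ψ : H ⊗ A ⟶ A ⊗ H) : (A ⊗ H) ⊗ (A ⊗ H) ⟶ A ⊗ H :=
  𝟙 _ ⊗≫ A ◁ ψ ▷ H ⊗≫ (μ[A] ⊗ₘ μ[H])

variable {ψ : H ⊗ A ⟶ A ⊗ H}

lemma IsDistributiveLaw.one_crossMul (h : IsDistributiveLaw ψ) :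
    ((λ_ (𝟙_ C)).inv ≫ (η[A] ⊗ₘ η[H])) ▷ (A ⊗ H) ≫ crossMul ψ = (λ_ (A ⊗ H)).hom := by
  calc
    _ = 𝟙 _ ⊗≫ η[A] ▷ (A ⊗ H) ⊗≫ A ◁ (η[H] ▷ A ≫ ψ) ▷ H ⊗≫ (μ[A] ⊗ₘ μ[H]) := by
      simp only [MonoidalCategory.tensorHom_def, crossMul]; monoidal
    _ = 𝟙 _ ⊗≫ η[A] ▷ (A ⊗ H) ⊗≫ ((A ⊗ A) ◁ η[H] ▷ H ≫ (μ[A] ▷ _)) ⊗≫ A ◁ μ[H] := by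
      rw [h.one_left, MonoidalCategory.tensorHom_def]; monoidal
    _ = 𝟙 _ ⊗≫ (η[A] ▷ A ≫ μ[A]) ▷ H ⊗≫ A ◁ (η[H] ▷ H ≫ μ[H]) := by
      rw [whisker_exchange]; monoidal
    _ = _ := by rw [MonObj.one_mul, MonObj.one_mul]; monoidal

lemma IsDistributiveLaw.crossMul_one (h : IsDistributiveLaw ψ) :
    (A ⊗ H) ◁ ((λ_ (𝟙_ C)).inv ≫ (η[A] ⊗ₘ η[H])) ≫ crossMul ψ = (ρ_ (A ⊗ H)).hom := by
  calc
    _ = 𝟙 _ ⊗≫ (A ⊗ H) ◁ η[H] ⊗≫ A ◁ (H ◁ η[A] ≫ ψ) ▷ H ⊗≫ (μ[A] ⊗ₘ μ[H]) := by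
      simp only [MonoidalCategory.tensorHom_def', crossMul]; monoidal
    _ = 𝟙 _ ⊗≫ (A ⊗ H) ◁ η[H] ⊗≫ ((A ◁ η[A]) ▷ (H ⊗ H) ≫ (A ⊗ A) ◁ μ[H]) ⊗≫ μ[A] ▷ H := by
      rw [h.one_right, MonoidalCategory.tensorHom_def']; monoidal
    _ = 𝟙 _ ⊗≫ A ◁ (H ◁ η[H] ≫ μ[H]) ⊗≫ (A ◁ η[A] ≫ μ[A]) ▷ H := by
      rw [← whisker_exchange]; monoidal
    _ = _ := by rw [MonObj.mul_one, MonObj.mul_one]; monoidal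

/-- Both bracketings become three applications of `ψ` followed by triple products: `mul_left`
expands the left one and `mul_right` the right one. The resulting diagrams differ by exchanging two
copies of `ψ` on disjoint strands. -/
lemma IsDistributiveLaw.crossMul_assoc (h : IsDistributiveLaw ψ) :
    crossMul ψ ▷ (A ⊗ H) ≫ crossMul ψ =
      (α_ (A ⊗ H) (A ⊗ H) (A ⊗ H)).hom ≫ (A ⊗ H) ◁ crossMul ψ ≫ crossMul ψ := by
  calc
    _ = 𝟙 _ ⊗≫ A ◁ ψ ▷ (H ⊗ A ⊗ H) ⊗≫ μ[A] ▷ (H ⊗ H ⊗ A ⊗ H) ⊗≫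
        A ◁ (μ[H] ▷ A ≫ ψ) ▷ H ⊗≫ (μ[A] ⊗ₘ μ[H]) := by
      simp only [MonoidalCategory.tensorHom_def, crossMul]; monoidal
    _ = 𝟙 _ ⊗≫ A ◁ ψ ▷ (H ⊗ A ⊗ H) ⊗≫ (μ[A] ▷ _ ≫ _ ◁ (H ◁ ψ ▷ H)) ⊗≫
        A ◁ ψ ▷ (H ⊗ H) ⊗≫ A ◁ A ◁ μ[H] ▷ H ⊗≫ (μ[A] ⊗ₘ μ[H]) := by
      rw [h.mul_left]; monoidal
    _ = 𝟙 _ ⊗≫ A ◁ ψ ▷ (H ⊗ A ⊗ H) ⊗≫ (A ⊗ A) ◁ H ◁ ψ ▷ H ⊗≫ (μ[A] ▷ _ ≫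
        _ ◁ (ψ ▷ (H ⊗ H))) ⊗≫ A ◁ A ◁ μ[H] ▷ H ⊗≫ (μ[A] ⊗ₘ μ[H]) := by
      rw [← whisker_exchange]; monoidal
    _ = 𝟙 _ ⊗≫ A ◁ ψ ▷ (H ⊗ A ⊗ H) ⊗≫ (A ⊗ A) ◁ H ◁ ψ ▷ H ⊗≫ (A ⊗ A) ◁ ψ ▷ (H ⊗ H) ⊗≫
        (μ[A] ▷ A ≫ μ[A]) ▷ (H ⊗ H ⊗ H) ⊗≫ A ◁ (μ[H] ▷ H ≫ μ[H]) := by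
      have e : (A ⊗ A) ◁ (μ[H] ▷ H ≫ μ[H]) ≫ μ[A] ▷ H = μ[A] ▷ _ ≫ _ := whisker_exchange _ _
      rw [← whisker_exchange, MonoidalCategory.tensorHom_def']
      calc
        _ = 𝟙 _ ⊗≫ A ◁ ψ ▷ (H ⊗ A ⊗ H) ⊗≫ (A ⊗ A) ◁ H ◁ ψ ▷ H ⊗≫ (A ⊗ A) ◁ (ψ ▷ (H ⊗ H)) ⊗≫
            μ[A] ▷ (A ⊗ H ⊗ H ⊗ H) ⊗≫ ((A ⊗ A) ◁ (μ[H] ▷ H ≫ μ[H]) ≫ μ[A] ▷ H) := by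
          monoidal
        _ = _ := by
          rw [e]; monoidal
    _ = 𝟙 _ ⊗≫ A ◁ (ψ ▷ (H ⊗ A) ≫ (A ⊗ H) ◁ ψ) ▷ H ⊗≫ (A ⊗ A) ◁ ψ ▷ (H ⊗ H) ⊗≫
        (A ◁ μ[A] ≫ μ[A]) ▷ (H ⊗ H ⊗ H) ⊗≫ A ◁ (H ◁ μ[H] ≫ μ[H]) := by
      rw [MonObj.mul_assoc, MonObj.mul_assoc]
      monoidal
    _ = 𝟙 _ ⊗≫ (A ⊗ H ⊗ A) ◁ ψ ▷ H ⊗≫ A ◁ ψ ▷ (A ⊗ H ⊗ H) ⊗≫ (A ⊗ A) ◁ ψ ▷ (H ⊗ H) ⊗≫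
        (A ◁ μ[A] ≫ μ[A]) ▷ (H ⊗ H ⊗ H) ⊗≫ A ◁ (H ◁ μ[H] ≫ μ[H]) := by
      rw [← whisker_exchange]; monoidal
    _ = 𝟙 _ ⊗≫ (A ⊗ H ⊗ A) ◁ ψ ▷ H ⊗≫ A ◁ ψ ▷ (A ⊗ H ⊗ H) ⊗≫
        A ◁ (A ◁ ψ ⊗≫ μ[A] ▷ H) ▷ (H ⊗ H) ⊗≫ (μ[A] ▷ _ ≫ A ◁ (H ◁ μ[H] ≫ μ[H])) := by
      monoidal
    _ = 𝟙 _ ⊗≫ (A ⊗ H ⊗ A) ◁ ψ ▷ H ⊗≫ A ◁ ((H ◁ μ[A] ≫ ψ) ▷ (H ⊗ H) ≫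
        (A ⊗ H) ◁ μ[H]) ⊗≫ (μ[A] ⊗ₘ μ[H]) := by
      rw [← whisker_exchange, MonoidalCategory.tensorHom_def', h.mul_right]; monoidal
    _ = 𝟙 _ ⊗≫ (A ⊗ H ⊗ A) ◁ ψ ▷ H ⊗≫ (A ⊗ H) ◁ (A ⊗ A) ◁ μ[H] ⊗≫
        (A ⊗ H) ◁ μ[A] ▷ H ⊗≫ A ◁ ψ ▷ H ⊗≫ (μ[A] ⊗ₘ μ[H]) := by
      rw [← whisker_exchange]; monoidal
    _ = _ := by
      simp only [MonoidalCategory.tensorHom_def', crossMul]; monoidal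

end Distributive

/-! ### Conjugation on `H ⊗ A` and the exchange map of a skew pairing. -/

section Exchange

variable {C : Type u} [Category.{v} C] [MonoidalCategory C] [SymmetricCategory C] {H A : C}

section Comonoids

variable [ComonObj H] [ComonObj A]

/-- Discarding one factor by its counit collapses one of the two comultiplications. This and the
three variants below match the actions on `H ⊗ A` with the one-sided formulas in the pairing axioms
and in `leftAct`, `rightAct`. -/
lemma lact_fst (u : Conv (H ⊗ A) (𝟙_ C)) :
    lact u ≫ H ◁ ε[A] ≫ (ρ_ H).hom =
      Δ[H] ▷ A ⊗≫ H ◁ (β_ H A).hom ⊗≫ convHom u ▷ H ⊗≫ 𝟙 H := by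
  simp only [lact, Comon.tensorObj_comul]
  generalize convHom u = f
  calc
    _ = 𝟙 _ ⊗≫ (Δ[H] ⊗ₘ Δ[A]) ⊗≫ H ◁ (β_ H A).hom ▷ A ⊗≫ (f ▷ (H ⊗ A) ≫ _ ◁ (H ◁ ε[A])) ⊗≫
        𝟙 _ := by
      simp only [tensorμ]; monoidal
    _ = 𝟙 _ ⊗≫ (Δ[H] ⊗ₘ Δ[A]) ⊗≫ H ◁ ((β_ H A).hom ▷ A ≫ _ ◁ ε[A]) ⊗≫ f ▷ H ⊗≫ 𝟙 _ := by
      rw [← whisker_exchange]; monoidal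
    _ = 𝟙 _ ⊗≫ Δ[H] ▷ A ⊗≫ (H ⊗ H) ◁ (Δ[A] ≫ A ◁ ε[A]) ⊗≫ H ◁ (β_ H A).hom ⊗≫ f ▷ H ⊗≫ 𝟙 _ := by
      rw [← whisker_exchange, MonoidalCategory.tensorHom_def]; monoidal
    _ = _ := by rw [ComonObj.comul_counit]; monoidal

lemma lact_snd (u : Conv (H ⊗ A) (𝟙_ C)) :
    lact u ≫ ε[H] ▷ A ≫ (λ_ A).hom = H ◁ Δ[A] ⊗≫ convHom u ▷ A ⊗≫ 𝟙 A := by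
  simp only [lact, Comon.tensorObj_comul]
  generalize convHom u = f
  calc
    _ = 𝟙 _ ⊗≫ (Δ[H] ⊗ₘ Δ[A]) ⊗≫ H ◁ (β_ H A).hom ▷ A ⊗≫ (f ▷ (H ⊗ A) ≫ _ ◁ (ε[H] ▷ A)) ⊗≫
        𝟙 _ := by
      simp only [tensorμ]; monoidal
    _ = 𝟙 _ ⊗≫ (Δ[H] ⊗ₘ Δ[A]) ⊗≫ H ◁ ((β_ H A).hom ≫ A ◁ ε[H]) ▷ A ⊗≫ f ▷ A ⊗≫ 𝟙 _ := by
      rw [← whisker_exchange]; monoidal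
    _ = 𝟙 _ ⊗≫ (Δ[H] ▷ A ≫ _ ◁ Δ[A]) ⊗≫ H ◁ ε[H] ▷ (A ⊗ A) ⊗≫ f ▷ A ⊗≫ 𝟙 _ := by
      rw [← BraidedCategory.braiding_naturality_left, braiding_tensorUnit_left,
        MonoidalCategory.tensorHom_def]
      monoidal
    _ = 𝟙 _ ⊗≫ H ◁ Δ[A] ⊗≫ (Δ[H] ≫ H ◁ ε[H]) ▷ (A ⊗ A) ⊗≫ f ▷ A ⊗≫ 𝟙 _ := by
      rw [← whisker_exchange]; monoidal
    _ = _ := by rw [ComonObj.comul_counit]; monoidal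

lemma ract_fst (u : Conv (H ⊗ A) (𝟙_ C)) :
    ract u ≫ H ◁ ε[A] ≫ (ρ_ H).hom = Δ[H] ▷ A ⊗≫ H ◁ convHom u ⊗≫ 𝟙 H := by
  simp only [ract, Comon.tensorObj_comul]
  generalize convHom u = f
  calc
    _ = 𝟙 _ ⊗≫ (Δ[H] ⊗ₘ Δ[A]) ⊗≫ H ◁ (β_ H A).hom ▷ A ⊗≫ H ◁ (A ◁ f ≫ ε[A] ▷ _) ⊗≫
        𝟙 _ := by
      simp only [tensorμ]; monoidal
    _ = 𝟙 _ ⊗≫ (Δ[H] ⊗ₘ Δ[A]) ⊗≫ H ◁ ((β_ H A).hom ≫ ε[A] ▷ H) ▷ A ⊗≫ H ◁ f ⊗≫ 𝟙 _ := by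
      rw [whisker_exchange]; monoidal
    _ = 𝟙 _ ⊗≫ Δ[H] ▷ A ⊗≫ (H ⊗ H) ◁ (Δ[A] ≫ ε[A] ▷ A) ⊗≫ H ◁ f ⊗≫ 𝟙 _ := by
      rw [← BraidedCategory.braiding_naturality_right, braiding_tensorUnit_right,
        MonoidalCategory.tensorHom_def]
      monoidal
    _ = _ := by rw [ComonObj.counit_comul]; monoidal

lemma ract_snd (u : Conv (H ⊗ A) (𝟙_ C)) :
    ract u ≫ ε[H] ▷ A ≫ (λ_ A).hom =
      H ◁ Δ[A] ⊗≫ (β_ H A).hom ▷ A ⊗≫ A ◁ convHom u ⊗≫ 𝟙 A := by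
  simp only [ract, Comon.tensorObj_comul]
  generalize convHom u = f
  calc
    _ = 𝟙 _ ⊗≫ (Δ[H] ⊗ₘ Δ[A]) ⊗≫ H ◁ (β_ H A).hom ▷ A ⊗≫ ((H ⊗ A) ◁ f ≫ (ε[H] ▷ A) ▷ _) ⊗≫
        𝟙 _ := by
      simp only [tensorμ]; monoidal
    _ = 𝟙 _ ⊗≫ (Δ[H] ⊗ₘ Δ[A]) ⊗≫ (H ◁ (β_ H A).hom ≫ ε[H] ▷ _) ▷ A ⊗≫ A ◁ f ⊗≫ 𝟙 _ := by
      rw [whisker_exchange]; monoidal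
    _ = 𝟙 _ ⊗≫ (Δ[H] ≫ ε[H] ▷ H) ▷ A ⊗≫ H ◁ Δ[A] ⊗≫ (β_ H A).hom ▷ A ⊗≫ A ◁ f ⊗≫ 𝟙 _ := by
      rw [whisker_exchange, MonoidalCategory.tensorHom_def']
      calc
        _ = 𝟙 _ ⊗≫ H ◁ Δ[A] ⊗≫ (Δ[H] ≫ ε[H] ▷ H) ▷ (A ⊗ A) ⊗≫ (β_ H A).hom ▷ A ⊗≫ A ◁ f ⊗≫
            𝟙 _ := by monoidal
        _ = 𝟙 _ ⊗≫ (H ◁ Δ[A] ≫ (Δ[H] ≫ ε[H] ▷ H) ▷ (A ⊗ A)) ⊗≫ (β_ H A).hom ▷ A ⊗≫ A ◁ f ⊗≫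
            𝟙 _ := by monoidal
        _ = _ := by rw [whisker_exchange]; monoidal
    _ = _ := by rw [ComonObj.counit_comul]; monoidal

end Comonoids

end Exchange

section Iso

variable {C : Type u} [Category.{v} C] [MonoidalCategory C]

instance isComonHom_symm_hom {X Y : C} [ComonObj X] [ComonObj Y] (f : X ≅ Y)
    [IsComonHom f.hom] : IsComonHom f.symm.hom :=
  inferInstanceAs (IsComonHom f.inv)

lemma conj_unitsMap_iso {X Y : C} [ComonObj X] [ComonObj Y] (f : X ≅ Y) [IsComonHom f.hom]
    (u : (Conv Y (𝟙_ C))ˣ) :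
    conj (Units.map (convComap _ f.hom) u) = f.hom ≫ conj u ≫ f.inv := by
  rw [← Category.assoc, comp_conj, Category.assoc, Iso.hom_inv_id, Category.comp_id]

lemma lact_convComap_iso {X Y : C} [ComonObj X] [ComonObj Y] (f : X ≅ Y) [IsComonHom f.hom]
    (u : Conv Y (𝟙_ C)) :
    lact (convComap _ f.hom u) = f.hom ≫ lact u ≫ f.inv := by
  rw [← Category.assoc, comp_lact, Category.assoc, Iso.hom_inv_id, Category.comp_id]

end Iso

section Exchange

variable {C : Type u} [Category.{v} C] [MonoidalCategory C] [SymmetricCategory C] {H A : C}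

attribute [local instance] ComonObj.instTensorUnit

/-- The map `h ⊗ a ↦ τ(h₁, a₁) a₂ ⊗ h₂ τ⁻¹(h₃, a₃)`. -/
def exchange [ComonObj H] [ComonObj A] (t : (Conv (H ⊗ A) (𝟙_ C))ˣ) : H ⊗ A ⟶ A ⊗ H :=
  conj t ≫ (β_ H A).hom

instance isComonHom_exchange [ComonObj H] [ComonObj A] (t : (Conv (H ⊗ A) (𝟙_ C))ˣ) :
    IsComonHom (exchange t) := by
  unfold exchange; infer_instance

variable [BimonObj H] [BimonObj A] (t : (Conv (H ⊗ A) (𝟙_ C))ˣ)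

/-- The isomorphism exchanging the last two factors. -/
def swapRight (X Y Z : C) : (X ⊗ Y) ⊗ Z ≅ (X ⊗ Z) ⊗ Y :=
  α_ X Y Z ≪≫ whiskerLeftIso X (β_ Y Z) ≪≫ (α_ X Z Y).symm

/-- The isomorphism exchanging the first two factors. -/
def swapLeft (X Y Z : C) : X ⊗ (Y ⊗ Z) ≅ Y ⊗ (X ⊗ Z) :=
  (α_ X Y Z).symm ≪≫ whiskerRightIso (β_ X Y) Z ≪≫ α_ Y X Z

instance (X Y Z : C) [ComonObj X] [ComonObj Y] [ComonObj Z] :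
    IsComonHom (swapRight X Y Z).hom := by
  simp only [swapRight, Iso.trans_hom, Iso.symm_hom, whiskerLeftIso_hom]; infer_instance

instance (X Y Z : C) [ComonObj X] [ComonObj Y] [ComonObj Z] :
    IsComonHom (swapLeft X Y Z).hom := by
  simp only [swapLeft, Iso.trans_hom, Iso.symm_hom, whiskerRightIso_hom]; infer_instance

/-- The axiom `τ(hh', a) = τ(h', a₁) τ(h, a₂)` is a convolution product on `(H ⊗ H) ⊗ A`: the first
factor ignores `h` and the second ignores `h'`. -/
lemma IsSkewPairing.convComap_mul_left (h : IsSkewPairing (convHom t.1)) :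
    Units.map (convComap _ (μ[H] ▷ A)) t =
      Units.map (convComap _ (α_ H H A).hom)
          (Units.map (convComap _ (ε[H] ▷ (H ⊗ A) ≫ (λ_ (H ⊗ A)).hom)) t) *
        Units.map (convComap _ (swapRight H H A).hom)
          (Units.map (convComap _ ((H ⊗ A) ◁ ε[H] ≫ (ρ_ (H ⊗ A)).hom)) t) := by
  apply Units.ext
  change convHom _ = convHom _
  rw [Units.val_mul, ← lact_comp]
  simp only [Units.coe_map, lact_convComap_iso, ← whiskerLeft_lact,
    convHom_convComap, h.mul_left]
  have e := lact_snd (H := H) (A := A) t.1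
  generalize convHom t.1 = f at *
  generalize lact t.1 = g at *
  have e' : (β_ H A).hom ≫ A ◁ ε[H] = ε[H] ▷ A ≫ (λ_ A).hom ≫ (ρ_ A).inv := by
    rw [← BraidedCategory.braiding_naturality_left, braiding_tensorUnit_left]
  calc
    _ = 𝟙 _ ⊗≫ H ◁ (H ◁ Δ[A] ⊗≫ f ▷ A ⊗≫ 𝟙 A) ⊗≫ f := by monoidal
    _ = 𝟙 _ ⊗≫ H ◁ g ⊗≫ H ◁ ((β_ H A).hom ≫ A ◁ ε[H]) ⊗≫ f := by
      rw [← e, e']; monoidal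
    _ = _ := by simp only [swapRight, Iso.trans_hom, Iso.symm_hom, whiskerLeftIso_hom]; monoidal

/-- The same for `τ(h, aa') = τ(h₁, a) τ(h₂, a')`: the first factor ignores `a'` and the second
ignores `a`. -/
lemma IsSkewPairing.convComap_mul_right (h : IsSkewPairing (convHom t.1)) :
    Units.map (convComap _ (H ◁ μ[A])) t =
      Units.map (convComap _ (α_ H A A).symm.hom)
          (Units.map (convComap _ ((H ⊗ A) ◁ ε[A] ≫ (ρ_ (H ⊗ A)).hom)) t) *
        Units.map (convComap _ (swapLeft H A A).hom)
          (Units.map (convComap _ (ε[A] ▷ (H ⊗ A) ≫ (λ_ (H ⊗ A)).hom)) t) := by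
  apply Units.ext
  change convHom _ = convHom _
  rw [Units.val_mul, ← lact_comp]
  simp only [Units.coe_map, lact_convComap_iso, ← lact_whiskerRight,
    convHom_convComap, h.mul_right]
  have e := lact_fst (H := H) (A := A) t.1
  generalize convHom t.1 = f at *
  generalize lact t.1 = g at *
  have e' : (β_ H A).hom ≫ ε[A] ▷ H = H ◁ ε[A] ≫ (ρ_ H).hom ≫ (λ_ H).inv := by
    rw [← BraidedCategory.braiding_naturality_right, braiding_tensorUnit_right]
  calc
    _ = 𝟙 _ ⊗≫ (Δ[H] ▷ A ⊗≫ H ◁ (β_ H A).hom ⊗≫ f ▷ H ⊗≫ 𝟙 H) ▷ A ⊗≫ f := by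
      rw [MonoidalCategory.tensorHom_def]; monoidal
    _ = 𝟙 _ ⊗≫ g ▷ A ⊗≫ ((β_ H A).hom ≫ ε[A] ▷ H) ▷ A ⊗≫ f := by
      rw [← e, e']; monoidal
    _ = _ := by
      simp only [swapLeft, Iso.trans_hom, Iso.symm_hom, Iso.symm_inv, whiskerRightIso_hom]; monoidal

lemma IsSkewPairing.mul_whiskerRight_conj (h : IsSkewPairing (convHom t.1)) :
    μ[H] ▷ A ≫ conj t = (α_ H H A).hom ≫ H ◁ conj t ≫ (α_ H H A).inv ≫ (swapRight H H A).hom ≫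
      conj t ▷ H ≫ (swapRight H H A).inv ≫ μ[H] ▷ A := by
  rw [comp_conj, h.convComap_mul_left, conj_mul, conj_unitsMap_iso, conj_unitsMap_iso,
    ← whiskerLeft_conj, ← conj_whiskerRight]
  simp only [Category.assoc]

lemma IsSkewPairing.whiskerLeft_mul_conj (h : IsSkewPairing (convHom t.1)) :
    H ◁ μ[A] ≫ conj t = (α_ H A A).inv ≫ conj t ▷ A ≫ (α_ H A A).hom ≫ (swapLeft H A A).hom ≫
      A ◁ conj t ≫ (swapLeft H A A).inv ≫ H ◁ μ[A] := by
  rw [comp_conj, h.convComap_mul_right, conj_mul, conj_unitsMap_iso, conj_unitsMap_iso,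
    ← whiskerLeft_conj, ← conj_whiskerRight]
  simp only [Category.assoc]
  rfl

/-- Pulled back along a multiplication, `conj t` splits into two whiskered copies of itself, and the
final braiding splits by the hexagon. Pulled back along a unit, `t` is trivial, so only the braiding
remains. -/
lemma IsSkewPairing.isDistributiveLaw (h : IsSkewPairing (convHom t.1)) :
    IsDistributiveLaw (exchange t) where
  mul_left := by
    have e : (swapRight H H A).inv ≫ μ[H] ▷ A ≫ (β_ H A).hom =
        (β_ H A).hom ▷ H ≫ (α_ A H H).hom ≫ A ◁ μ[H] := by
      rw [Iso.inv_comp_eq, BraidedCategory.braiding_naturality_left,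
        BraidedCategory.braiding_tensor_left_hom]
      simp [swapRight]
    rw [exchange, ← Category.assoc, h.mul_whiskerRight_conj]
    simp only [Category.assoc, e, whiskerLeft_comp, comp_whiskerRight]
    simp [swapRight]
  mul_right := by
    have e : (swapLeft H A A).inv ≫ H ◁ μ[A] ≫ (β_ H A).hom =
        A ◁ (β_ H A).hom ≫ (α_ A A H).inv ≫ μ[A] ▷ H := by
      rw [Iso.inv_comp_eq, BraidedCategory.braiding_naturality_right,
        BraidedCategory.braiding_tensor_right_hom]
      simp [swapLeft]
    rw [exchange, ← Category.assoc, h.whiskerLeft_mul_conj]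
    simp only [Category.assoc, e, whiskerLeft_comp, comp_whiskerRight]
    simp [swapLeft]
  one_left := by
    have e : Units.map (convComap _ (η[H] ▷ A)) t = 1 := by
      apply Units.ext
      change η[H] ▷ A ≫ convHom t.1 = ε[𝟙_ C ⊗ A] ≫ 𝟙 _
      rw [← cancel_epi (λ_ A).inv, h.one_left, Category.comp_id, IsComonHom.hom_counit]
    rw [exchange, ← Category.assoc, comp_conj, e, conj_one, Category.id_comp,
      BraidedCategory.braiding_naturality_left, braiding_tensorUnit_left]
    simp only [Category.assoc]
  one_right := by
    have e : Units.map (convComap _ (H ◁ η[A])) t = 1 := by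
      apply Units.ext
      change H ◁ η[A] ≫ convHom t.1 = ε[H ⊗ 𝟙_ C] ≫ 𝟙 _
      rw [← cancel_epi (ρ_ H).inv, h.one_right, Category.comp_id, IsComonHom.hom_counit]
    rw [exchange, ← Category.assoc, comp_conj, e, conj_one, Category.id_comp,
      BraidedCategory.braiding_naturality_right, braiding_tensorUnit_right]
    simp only [Category.assoc]

end Exchange

/-! ### The maps `α` and `β` as components of a conjugation. -/

section Acts

variable {C : Type u} [Category.{v} C] [MonoidalCategory C] [SymmetricCategory C] {H A : C}
  [ComonObj H] [ComonObj A]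

/-- `α` is the `A`-component of `conj t`; likewise `β` is its `H`-component in `rightAct_eq`. This
connects the explicit formulas of the double with the conjugation calculus. -/
lemma leftAct_eq (t : (Conv (H ⊗ A) (𝟙_ C))ˣ) :
    leftAct (convHom t.1) (convHom (t⁻¹).1) = conj t ≫ ε[H] ▷ A ≫ (λ_ A).hom := by
  rw [conj, Category.assoc, ract_snd, leftAct]
  simp only [lact, Comon.tensorObj_comul, tensorμ]
  generalize convHom t.1 = f
  generalize convHom (t⁻¹).1 = g
  calc
    _ = (Δ[H] ⊗ₘ Δ[A]) ⊗≫ H ◁ (β_ H A).hom ▷ A ⊗≫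
        ((H ⊗ A) ◁ (H ◁ Δ[A] ⊗≫ (β_ H A).hom ▷ A ⊗≫ A ◁ g ⊗≫ 𝟙 A) ≫ f ▷ _) ⊗≫ 𝟙 A := by
      rw [MonoidalCategory.tensorHom_def (β_ H A).hom, MonoidalCategory.tensorHom_def' f]
      monoidal
    _ = _ := by
      rw [whisker_exchange]; monoidal

lemma rightAct_eq (t : (Conv (H ⊗ A) (𝟙_ C))ˣ) :
    rightAct (convHom t.1) (convHom (t⁻¹).1) = conj t ≫ H ◁ ε[A] ≫ (ρ_ H).hom := by
  rw [conj, Category.assoc, ract_fst, rightAct]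
  simp only [lact, Comon.tensorObj_comul, tensorμ]
  generalize convHom t.1 = f
  generalize convHom (t⁻¹).1 = g
  calc
    _ = 𝟙 _ ⊗≫ (Δ[H] ⊗ₘ Δ[A]) ⊗≫ (Δ[H] ▷ ((H ⊗ A) ⊗ A) ≫ (H ⊗ H) ◁ ((β_ H A).hom ▷ A)) ⊗≫
        H ◁ (β_ H A).hom ▷ (H ⊗ A) ⊗≫ ((H ⊗ A) ◁ H ◁ g ≫ f ▷ (H ⊗ 𝟙_ C)) ⊗≫ 𝟙 H := by
      have e : Δ[H] ⊗ₘ (β_ H A).hom ▷ A = Δ[H] ▷ ((H ⊗ A) ⊗ A) ≫ (H ⊗ H) ◁ (β_ H A).hom ▷ A :=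
        MonoidalCategory.tensorHom_def _ _
      rw [e, MonoidalCategory.tensorHom_def' f]
      monoidal
    _ = 𝟙 _ ⊗≫ (Δ[H] ⊗ₘ Δ[A]) ⊗≫ Δ[H] ▷ (H ⊗ A ⊗ A) ⊗≫ H ◁ (H ◁ (β_ H A).hom ⊗≫
        (β_ H A).hom ▷ H) ▷ A ⊗≫ ((H ⊗ A) ◁ H ◁ g ≫ f ▷ (H ⊗ 𝟙_ C)) ⊗≫ 𝟙 H := by
      monoidal
    _ = 𝟙 _ ⊗≫ (Δ[H] ⊗ₘ Δ[A]) ⊗≫ Δ[H] ▷ (H ⊗ A ⊗ A) ⊗≫ H ◁ (β_ (H ⊗ H) A).hom ▷ A ⊗≫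
        f ▷ (H ⊗ H ⊗ A) ⊗≫ H ◁ g ⊗≫ 𝟙 H := by
      rw [BraidedCategory.braiding_tensor_left_hom, whisker_exchange]
      monoidal
    _ = 𝟙 _ ⊗≫ (H ◁ Δ[A] ≫ (Δ[H] ≫ Δ[H] ▷ H ≫ (α_ H H H).hom) ▷ (A ⊗ A)) ⊗≫
        H ◁ (β_ (H ⊗ H) A).hom ▷ A ⊗≫ f ▷ (H ⊗ H ⊗ A) ⊗≫ H ◁ g ⊗≫ 𝟙 H := by
      rw [MonoidalCategory.tensorHom_def']
      monoidal
    _ = 𝟙 _ ⊗≫ (Δ[H] ⊗ₘ Δ[A]) ⊗≫ H ◁ (Δ[H] ▷ A ≫ (β_ (H ⊗ H) A).hom) ▷ A ⊗≫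
        f ▷ (H ⊗ H ⊗ A) ⊗≫ H ◁ g ⊗≫ 𝟙 H := by
      rw [← ComonObj.comul_assoc, MonoidalCategory.tensorHom_def']
      monoidal
    _ = 𝟙 _ ⊗≫ (Δ[H] ⊗ₘ Δ[A]) ⊗≫ H ◁ (β_ H A).hom ▷ A ⊗≫ ((H ⊗ A) ◁ (Δ[H] ▷ A) ≫ f ▷ _) ⊗≫
        H ◁ g ⊗≫ 𝟙 H := by
      rw [BraidedCategory.braiding_naturality_left]; monoidal
    _ = _ := by
      rw [whisker_exchange]; monoidal

end Acts

/-! ### The embeddings of `A` and `H` in the double, and projections of a tensor comonoid. -/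

section Distributive

variable {C : Type u} [Category.{v} C] [MonoidalCategory C] {A H : C} [MonObj A] [MonObj H]
  {ψ : H ⊗ A ⟶ A ⊗ H}

lemma IsDistributiveLaw.mul_inl (h : IsDistributiveLaw ψ) :
    (((ρ_ A).inv ≫ A ◁ η[H]) ⊗ₘ ((ρ_ A).inv ≫ A ◁ η[H])) ≫ crossMul ψ =
      μ[A] ≫ (ρ_ A).inv ≫ A ◁ η[H] := by
  calc
    _ = 𝟙 _ ⊗≫ (A ⊗ A) ◁ η[H] ⊗≫ A ◁ (η[H] ▷ A ≫ ψ) ▷ H ⊗≫ (μ[A] ⊗ₘ μ[H]) := by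
      simp only [MonoidalCategory.tensorHom_def', crossMul]; monoidal
    _ = 𝟙 _ ⊗≫ (A ⊗ A) ◁ η[H] ⊗≫ (A ⊗ A) ◁ (η[H] ▷ H ≫ μ[H]) ⊗≫ μ[A] ▷ H := by
      rw [h.one_left, MonoidalCategory.tensorHom_def']; monoidal
    _ = 𝟙 _ ⊗≫ ((A ⊗ A) ◁ η[H] ≫ μ[A] ▷ H) := by
      rw [MonObj.one_mul]; monoidal
    _ = _ := by rw [whisker_exchange]; monoidal

lemma IsDistributiveLaw.mul_inr (h : IsDistributiveLaw ψ) :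
    (((λ_ H).inv ≫ η[A] ▷ H) ⊗ₘ ((λ_ H).inv ≫ η[A] ▷ H)) ≫ crossMul ψ =
      μ[H] ≫ (λ_ H).inv ≫ η[A] ▷ H := by
  calc
    _ = 𝟙 _ ⊗≫ η[A] ▷ (H ⊗ H) ⊗≫ A ◁ (H ◁ η[A] ≫ ψ) ▷ H ⊗≫ (μ[A] ⊗ₘ μ[H]) := by
      simp only [MonoidalCategory.tensorHom_def, crossMul]; monoidal
    _ = 𝟙 _ ⊗≫ η[A] ▷ (H ⊗ H) ⊗≫ (A ◁ η[A] ≫ μ[A]) ▷ (H ⊗ H) ⊗≫ A ◁ μ[H] := by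
      rw [h.one_right, MonoidalCategory.tensorHom_def]; monoidal
    _ = 𝟙 _ ⊗≫ (η[A] ▷ (H ⊗ H) ≫ A ◁ μ[H]) := by
      rw [MonObj.mul_one]; monoidal
    _ = _ := by rw [← whisker_exchange]; monoidal

/-- Normal ordering: `a ⊗ h` is the product of `a` and `h` inside the double. Hence `A` and `H`
generate it, which is used both for the antipode and for the R-matrix. -/
lemma inl_inr_crossMul (h : IsDistributiveLaw ψ) :
    (((ρ_ A).inv ≫ A ◁ η[H]) ⊗ₘ ((λ_ H).inv ≫ η[A] ▷ H)) ≫ crossMul ψ = 𝟙 (A ⊗ H) := by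
  calc
    _ = 𝟙 _ ⊗≫ A ◁ (η[H] ▷ (𝟙_ C) ≫ H ◁ η[A]) ▷ H ⊗≫ A ◁ ψ ▷ H ⊗≫
        (μ[A] ⊗ₘ μ[H]) := by
      simp only [MonoidalCategory.tensorHom_def, crossMul]; monoidal
    _ = 𝟙 _ ⊗≫ A ◁ η[A] ▷ H ⊗≫ A ◁ (η[H] ▷ A ≫ ψ) ▷ H ⊗≫ (μ[A] ⊗ₘ μ[H]) := by
      rw [← whisker_exchange]; monoidal
    _ = 𝟙 _ ⊗≫ (A ◁ η[A]) ▷ H ⊗≫ ((A ⊗ A) ◁ (η[H] ▷ H) ≫ μ[A] ▷ _) ⊗≫ A ◁ μ[H] := by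
      rw [h.one_left, MonoidalCategory.tensorHom_def]; monoidal
    _ = 𝟙 _ ⊗≫ (A ◁ η[A] ≫ μ[A]) ▷ H ⊗≫ A ◁ (η[H] ▷ H ≫ μ[H]) := by
      rw [whisker_exchange]; monoidal
    _ = _ := by rw [MonObj.mul_one, MonObj.one_mul]; monoidal

/-- The cross relation: a product in the wrong order is straightened by `ψ`. -/
lemma inr_inl_crossMul (ψ : H ⊗ A ⟶ A ⊗ H) :
    (((λ_ H).inv ≫ η[A] ▷ H) ⊗ₘ ((ρ_ A).inv ≫ A ◁ η[H])) ≫ crossMul ψ = ψ := by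
  calc
    _ = 𝟙 _ ⊗≫ η[A] ▷ (H ⊗ A) ⊗≫ (A ⊗ H ⊗ A) ◁ η[H] ⊗≫ A ◁ ψ ▷ H ⊗≫ (μ[A] ⊗ₘ μ[H]) := by
      simp only [MonoidalCategory.tensorHom_def, crossMul]; monoidal
    _ = 𝟙 _ ⊗≫ η[A] ▷ (H ⊗ A) ⊗≫ A ◁ ((H ⊗ A) ◁ η[H] ≫ ψ ▷ H) ⊗≫ (μ[A] ⊗ₘ μ[H]) := by
      monoidal
    _ = 𝟙 _ ⊗≫ (η[A] ▷ (H ⊗ A) ≫ A ◁ ψ) ⊗≫ (A ⊗ A ⊗ H) ◁ η[H] ⊗≫ (μ[A] ⊗ₘ μ[H]) := by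
      rw [whisker_exchange]; monoidal
    _ = ψ ⊗≫ η[A] ▷ (A ⊗ H) ⊗≫ (A ⊗ A) ◁ (H ◁ η[H] ≫ μ[H]) ⊗≫ μ[A] ▷ H := by
      rw [← whisker_exchange, MonoidalCategory.tensorHom_def']; monoidal
    _ = ψ ⊗≫ (η[A] ▷ A ≫ μ[A]) ▷ H ⊗≫ 𝟙 _ := by
      rw [MonObj.mul_one]; monoidal
    _ = _ := by rw [MonObj.one_mul]; monoidal

end Distributive

section Projections

variable {C : Type u} [Category.{v} C] [MonoidalCategory C] [BraidedCategory C] (X Y : C)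
  [ComonObj X] [ComonObj Y]

lemma comul_fst_snd :
    Δ[X ⊗ Y] ≫ ((X ◁ ε[Y] ≫ (ρ_ X).hom) ⊗ₘ (ε[X] ▷ Y ≫ (λ_ Y).hom)) = 𝟙 (X ⊗ Y) := by
  have h : (X ◁ ε[Y] ≫ (ρ_ X).hom) ⊗ₘ (ε[X] ▷ Y ≫ (λ_ Y).hom) =
      ((𝟙 X ⊗ₘ ε[Y]) ⊗ₘ (ε[X] ⊗ₘ 𝟙 Y)) ≫ ((ρ_ X).hom ⊗ₘ (λ_ Y).hom) := by
    simp
  rw [h, Comon.tensorObj_comul, Category.assoc, ← tensorμ_natural_assoc]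
  simp only [tensorHom_comp_tensorHom_assoc, id_tensorHom, tensorHom_id,
    ComonObj.comul_counit, ComonObj.counit_comul, tensorμ, braiding_tensorUnit_left]
  monoidal

lemma comul_snd_fst :
    Δ[X ⊗ Y] ≫ ((ε[X] ▷ Y ≫ (λ_ Y).hom) ⊗ₘ (X ◁ ε[Y] ≫ (ρ_ X).hom)) = (β_ X Y).hom := by
  have h : (ε[X] ▷ Y ≫ (λ_ Y).hom) ⊗ₘ (X ◁ ε[Y] ≫ (ρ_ X).hom) =
      ((ε[X] ⊗ₘ 𝟙 Y) ⊗ₘ (𝟙 X ⊗ₘ ε[Y])) ≫ ((λ_ Y).hom ⊗ₘ (ρ_ X).hom) := by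
    simp
  rw [h, Comon.tensorObj_comul, Category.assoc, ← tensorμ_natural_assoc]
  simp only [tensorHom_comp_tensorHom_assoc, id_tensorHom, tensorHom_id,
    ComonObj.comul_counit, ComonObj.counit_comul, tensorμ]
  monoidal

end Projections

/-! ### The bimonoid structure of the double cross product. -/

section Double

variable {C : Type u} [Category.{v} C] [MonoidalCategory C] [SymmetricCategory C]

attribute [local instance] ComonObj.instTensorUnit

/-- Since `conj t` is a comonoid map, the coproduct may be taken after it. The coproduct followed by
the two projections in swapped order is the braiding, which leaves `exchange t`. -/
lemma doubleCrossMul_eq {H A : C} [BimonObj H] [BimonObj A] (t : (Conv (H ⊗ A) (𝟙_ C))ˣ) :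
    doubleCrossMul (convHom t.1) (convHom (t⁻¹).1) = crossMul (exchange t) := by
  have h : Δ[H ⊗ A] ≫ (leftAct (convHom t.1) (convHom (t⁻¹).1) ⊗ₘ
      rightAct (convHom t.1) (convHom (t⁻¹).1)) = exchange t := by
    rw [leftAct_eq, rightAct_eq, ← tensorHom_comp_tensorHom, ← IsComonHom.hom_comul_assoc,
      comul_snd_fst, exchange]
  rw [crossMul, ← h, doubleCrossMul]
  monoidal

instance isComonHom_crossMul {H A : C} [BimonObj H] [BimonObj A] (ψ : H ⊗ A ⟶ A ⊗ H)
    [IsComonHom ψ] : IsComonHom (crossMul ψ) := by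
  have h : crossMul ψ = (α_ A H (A ⊗ H)).hom ≫
      A ◁ ((α_ H A H).inv ≫ ψ ▷ H ≫ (α_ A H H).hom) ≫ (α_ A A (H ⊗ H)).inv ≫
        (μ[A] ⊗ₘ μ[H]) := by
    rw [crossMul]; monoidal
  rw [h]; infer_instance

/-- The object `A ⊗ H` underlying the double cross product. -/
def double (H A : C) : C := A ⊗ H

variable {H A : C} [BimonObj H] [BimonObj A] {t : (Conv (H ⊗ A) (𝟙_ C))ˣ}

/-- The double cross product `A ⋈_τ H`. -/
@[reducible]
def doubleBimon (h : IsSkewPairing (convHom t.1)) : BimonObj (double H A) where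
  one := (λ_ (𝟙_ C)).inv ≫ (η[A] ⊗ₘ η[H])
  mul := crossMul (exchange t)
  one_mul := h.isDistributiveLaw.one_crossMul
  mul_one := h.isDistributiveLaw.crossMul_one
  mul_assoc := h.isDistributiveLaw.crossMul_assoc
  counit := ε[A ⊗ H]
  comul := Δ[A ⊗ H]
  counit_comul := ComonObj.counit_comul (A ⊗ H)
  comul_counit := ComonObj.comul_counit (A ⊗ H)
  comul_assoc := ComonObj.comul_assoc (A ⊗ H)
  -- The compatibility axioms say that the multiplication and the unit are comonoid maps, which
  -- instance search finds from their factorizations.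
  mul_comul := by
    have e := IsComonHom.hom_comul (crossMul (exchange t))
    rw [Comon.tensorObj_comul (A ⊗ H) (A ⊗ H), Category.assoc] at e
    exact e
  one_comul := by
    have e := IsComonHom.hom_comul ((λ_ (𝟙_ C)).inv ≫ (η[A] ⊗ₘ η[H]))
    exact e
  mul_counit := IsComonHom.hom_counit (crossMul (exchange t))
  one_counit := IsComonHom.hom_counit ((λ_ (𝟙_ C)).inv ≫ (η[A] ⊗ₘ η[H]))

end Double

/-! ### Transposes, and uniqueness of maps with a given transpose. -/

section Mates

variable {C : Type u} [Category.{v} C] [MonoidalCategory C]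

/-- `f' : V^* ⟶ U^*` is the transpose of `f : U ⟶ V`. -/
def IsMate {U U' V V' : C} [ExactPairing U U'] [ExactPairing V V'] (f : U ⟶ V) (f' : V' ⟶ U') :
    Prop :=
  f' ▷ U ≫ ε_ U U' = V' ◁ f ≫ ε_ V V'

section

variable {U U' V V' W W' X X' : C} [ExactPairing U U'] [ExactPairing V V'] [ExactPairing W W']
  [ExactPairing X X']

lemma ext_evaluation {Z : C} {f g : Z ⟶ U'} (h : f ▷ U ≫ ε_ U U' = g ▷ U ≫ ε_ U U') : f = g := by
  have key (k : Z ⟶ U') : k = 𝟙 _ ⊗≫ Z ◁ η_ U U' ⊗≫ (k ▷ U ≫ ε_ U U') ▷ U' ⊗≫ 𝟙 _ := by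
    calc
      k = 𝟙 _ ⊗≫ k ⊗≫ (U' ◁ η_ U U' ⊗≫ ε_ U U' ▷ U') ⊗≫ 𝟙 _ := by
        rw [ExactPairing.coevaluation_evaluation'']; monoidal
      _ = 𝟙 _ ⊗≫ (k ▷ 𝟙_ C ≫ U' ◁ η_ U U') ⊗≫ ε_ U U' ▷ U' ⊗≫ 𝟙 _ := by monoidal
      _ = _ := by rw [← whisker_exchange]; monoidal
  rw [key f, key g, h]

lemma isMate_transpose (f : U ⟶ V) : IsMate f (transpose f : V' ⟶ U') := by
  unfold IsMate transpose
  calc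
    _ = 𝟙 _ ⊗≫ V' ◁ η_ U U' ▷ U ⊗≫ V' ◁ f ▷ (U' ⊗ U) ⊗≫ (ε_ V V' ▷ (U' ⊗ U) ≫ _ ◁ ε_ U U') ⊗≫
        𝟙 _ := by monoidal
    _ = 𝟙 _ ⊗≫ V' ◁ η_ U U' ▷ U ⊗≫ V' ◁ (f ▷ (U' ⊗ U) ≫ V ◁ ε_ U U') ⊗≫ ε_ V V' := by
      rw [← whisker_exchange]; monoidal
    _ = 𝟙 _ ⊗≫ V' ◁ (η_ U U' ▷ U ⊗≫ U ◁ ε_ U U') ⊗≫ V' ◁ f ⊗≫ ε_ V V' := by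
      rw [← whisker_exchange]; monoidal
    _ = _ := by rw [ExactPairing.evaluation_coevaluation'']; monoidal

lemma IsMate.unique {f : U ⟶ V} {f₁ f₂ : V' ⟶ U'} (h₁ : IsMate f f₁) (h₂ : IsMate f f₂) :
    f₁ = f₂ :=
  ext_evaluation (h₁.trans h₂.symm)

lemma IsMate.eq_transpose {f : U ⟶ V} {f' : V' ⟶ U'} (h : IsMate f f') : f' = transpose f :=
  h.unique (isMate_transpose f)

lemma isMate_id : IsMate (𝟙 U) (𝟙 U') := by simp [IsMate]

lemma IsMate.comp {f : U ⟶ V} {f' : V' ⟶ U'} {g : V ⟶ W} {g' : W' ⟶ V'} (hf : IsMate f f')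
    (hg : IsMate g g') : IsMate (f ≫ g) (g' ≫ f') := by
  unfold IsMate at *
  rw [comp_whiskerRight, Category.assoc, hf, ← whisker_exchange_assoc, hg]
  simp

/-- Duals of tensor products are nested, with reversed factors, so no braiding is needed: `f'`
slides across the inner evaluation and `g'` across the outer one. -/
lemma IsMate.tensor {f : U ⟶ V} {f' : V' ⟶ U'} {g : W ⟶ X} {g' : X' ⟶ W'} (hf : IsMate f f')
    (hg : IsMate g g') : IsMate (f ⊗ₘ g) (g' ⊗ₘ f') := by
  unfold IsMate at *
  simp only [ExactPairing.tensor_evaluation]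
  calc
    _ = 𝟙 _ ⊗≫ g' ▷ (V' ⊗ U ⊗ W) ⊗≫ W' ◁ (f' ▷ U ≫ ε_ U U') ▷ W ⊗≫ ε_ W W' := by
      rw [MonoidalCategory.tensorHom_def]; monoidal
    _ = 𝟙 _ ⊗≫ X' ◁ V' ◁ f ▷ W ⊗≫ (g' ▷ _ ≫ W' ◁ (ε_ V V')) ▷ W ⊗≫ ε_ W W' := by
      rw [hf]
      calc
        _ = 𝟙 _ ⊗≫ (g' ▷ (V' ⊗ U) ≫ W' ◁ (V' ◁ f)) ▷ W ⊗≫ W' ◁ ε_ V V' ▷ W ⊗≫ ε_ W W' := by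
          monoidal
        _ = _ := by rw [← whisker_exchange]; monoidal
    _ = 𝟙 _ ⊗≫ X' ◁ V' ◁ f ▷ W ⊗≫ X' ◁ ε_ V V' ▷ W ⊗≫ (g' ▷ W ≫ ε_ W W') := by
      rw [← whisker_exchange]; monoidal
    _ = 𝟙 _ ⊗≫ X' ◁ V' ◁ f ▷ W ⊗≫ X' ◁ (ε_ V V' ▷ W ≫ _ ◁ g) ⊗≫ ε_ X X' := by
      rw [hg]; monoidal
    _ = _ := by
      rw [← whisker_exchange, MonoidalCategory.tensorHom_def]; monoidal

lemma IsMate.whiskerRight {f : U ⟶ V} {f' : V' ⟶ U'} (hf : IsMate f f') :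
    IsMate (f ▷ W) (W' ◁ f') := by
  simpa using hf.tensor (isMate_id (U := W) (U' := W'))

lemma IsMate.whiskerLeft {f : U ⟶ V} {f' : V' ⟶ U'} (hf : IsMate f f') :
    IsMate (W ◁ f) (f' ▷ W') := by
  simpa using (isMate_id (U := W) (U' := W')).tensor hf

lemma isMate_associator : IsMate (α_ U V W).hom (α_ W' V' U').hom := by
  simp only [IsMate, ExactPairing.tensor_evaluation]; monoidal

lemma isMate_associator_inv : IsMate (α_ U V W).inv (α_ W' V' U').inv := by
  simp only [IsMate, ExactPairing.tensor_evaluation]; monoidal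

lemma evaluation_unit : ε_ (𝟙_ C) (𝟙_ C) = (ρ_ (𝟙_ C)).hom := rfl

lemma isMate_leftUnitor : IsMate (λ_ U).hom (ρ_ U').inv := by
  simp only [IsMate, ExactPairing.tensor_evaluation, evaluation_unit]; monoidal

lemma isMate_leftUnitor_inv : IsMate (λ_ U).inv (ρ_ U').hom := by
  simp only [IsMate, ExactPairing.tensor_evaluation, evaluation_unit]; monoidal

lemma isMate_rightUnitor : IsMate (ρ_ U).hom (λ_ U').inv := by
  simp only [IsMate, ExactPairing.tensor_evaluation, evaluation_unit]; monoidal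

lemma isMate_rightUnitor_inv : IsMate (ρ_ U).inv (λ_ U').hom := by
  simp only [IsMate, ExactPairing.tensor_evaluation, evaluation_unit]; monoidal

lemma exists_isMate (f' : V' ⟶ U') :
    ∃ f : U ⟶ V, IsMate f f' := by
  refine ⟨𝟙 U ⊗≫ η_ V V' ▷ U ⊗≫ V ◁ (f' ▷ U ≫ ε_ U U') ⊗≫ 𝟙 V, ?_⟩
  unfold IsMate
  symm
  calc
    _ = 𝟙 _ ⊗≫ V' ◁ η_ V V' ▷ U ⊗≫ (_ ◁ (f' ▷ U ≫ ε_ U U') ≫ ε_ V V' ▷ (𝟙_ C)) ⊗≫ 𝟙 _ := by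
      monoidal
    _ = 𝟙 _ ⊗≫ (V' ◁ η_ V V' ⊗≫ ε_ V V' ▷ V') ▷ U ⊗≫ (f' ▷ U ≫ ε_ U U') := by
      rw [whisker_exchange]; monoidal
    _ = _ := by
      rw [ExactPairing.coevaluation_evaluation'']; monoidal

lemma IsMate.unique_left {f g : U ⟶ V}
    {f' : V' ⟶ U'} (hf : IsMate f f') (hg : IsMate g f') : f = g := by
  have h : V' ◁ f ≫ ε_ V V' = V' ◁ g ≫ ε_ V V' := hf.symm.trans hg
  have key (k : U ⟶ V) : k = 𝟙 U ⊗≫ η_ V V' ▷ U ⊗≫ V ◁ (V' ◁ k ≫ ε_ V V') ⊗≫ 𝟙 V := by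
    symm
    calc
      _ = 𝟙 U ⊗≫ (η_ V V' ▷ U ≫ _ ◁ k) ⊗≫ V ◁ ε_ V V' ⊗≫ 𝟙 V := by monoidal
      _ = k ⊗≫ (η_ V V' ▷ V ⊗≫ V ◁ ε_ V V') ⊗≫ 𝟙 V := by
        rw [← whisker_exchange]; monoidal
      _ = _ := by rw [ExactPairing.evaluation_coevaluation'']; monoidal
  rw [key f, key g, h]

lemma IsMate.coevaluation {f : U ⟶ V} {f' : V' ⟶ U'} (h : IsMate f f') :
    η_ U U' ≫ f ▷ U' = η_ V V' ≫ V ◁ f' := by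
  symm
  rw [h.eq_transpose, transpose]
  calc
    _ = 𝟙 _ ⊗≫ (η_ V V' ▷ (𝟙_ C) ≫ _ ◁ η_ U U') ⊗≫ V ◁ V' ◁ f ▷ U' ⊗≫ V ◁ ε_ V V' ▷ U' ⊗≫
        𝟙 _ := by monoidal
    _ = η_ U U' ⊗≫ (η_ V V' ▷ U ≫ _ ◁ f) ▷ U' ⊗≫ V ◁ ε_ V V' ▷ U' ⊗≫ 𝟙 _ := by
      rw [← whisker_exchange]; monoidal
    _ = η_ U U' ⊗≫ f ▷ U' ⊗≫ (η_ V V' ▷ V ⊗≫ V ◁ ε_ V V') ▷ U' ⊗≫ 𝟙 _ := by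
      rw [← whisker_exchange]; monoidal
    _ = _ := by
      rw [ExactPairing.evaluation_coevaluation'']; monoidal

end

end Mates

/-! ### Pairings and the braiding in a symmetric category. -/

section BraidedMates

variable {C : Type u} [Category.{v} C] [MonoidalCategory C] [SymmetricCategory C]

/-- By naturality, `X` passes across `V ⊗ W` freely once this pair is evaluated to the unit object;
symmetry cancels the crossing with `W`. -/
lemma isSymmetricAt {V W : C} (p : V ⊗ W ⟶ 𝟙_ C) (X : C) : IsSymmetricAt p X := by
  have h : V ◁ (β_ X W).hom ≫ V ◁ (β_ W X).hom = 𝟙 _ := by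
    rw [← whiskerLeft_comp, SymmetricCategory.symmetry, whiskerLeft_id]
  unfold IsSymmetricAt
  calc
    _ = 𝟙 _ ⊗≫ (V ◁ (β_ X W).hom ≫ V ◁ (β_ W X).hom) ⊗≫ (β_ V X).hom ▷ W ⊗≫ X ◁ p ⊗≫ 𝟙 X := by
      rw [h]; monoidal
    _ = 𝟙 _ ⊗≫ V ◁ (β_ X W).hom ⊗≫ ((β_ (V ⊗ W) X).hom ≫ X ◁ p) ⊗≫ 𝟙 X := by
      rw [BraidedCategory.braiding_tensor_left_hom]; monoidal
    _ = _ := by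
      rw [← BraidedCategory.braiding_naturality_left, braiding_tensorUnit_left]; monoidal

variable {U U' V V' : C} [ExactPairing U U'] [ExactPairing V V']

lemma isMate_braiding : IsMate (β_ U V).hom (β_ U' V').hom := by
  simp only [IsMate, ExactPairing.tensor_evaluation]
  have h₁ := isSymmetricAt (ε_ U U') V'
  have h₂ := isSymmetricAt (ε_ V V') U
  unfold IsSymmetricAt at h₁ h₂
  calc
    _ = 𝟙 _ ⊗≫ ((β_ U' V').hom ▷ U ⊗≫ V' ◁ ε_ U U' ⊗≫ 𝟙 V') ▷ V ⊗≫ ε_ V V' := by monoidal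
    _ = 𝟙 _ ⊗≫ U' ◁ (β_ V' U).hom ▷ V ⊗≫ (ε_ U U' ▷ (V' ⊗ V) ≫ _ ◁ ε_ V V') ⊗≫ 𝟙 _ := by
      rw [h₁]; monoidal
    _ = 𝟙 _ ⊗≫ U' ◁ ((β_ V' U).hom ▷ V ⊗≫ U ◁ ε_ V V' ⊗≫ 𝟙 U) ⊗≫ ε_ U U' := by
      rw [← whisker_exchange]; monoidal
    _ = _ := by
      rw [h₂]; monoidal

end BraidedMates

section Coevaluation

variable {C : Type u} [Category.{v} C] [MonoidalCategory C] {H A : C} [ExactPairing H A]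

lemma ext_coevaluation_left {X Z : C} {f g : X ⟶ H ⊗ Z}
    (h : A ◁ f ⊗≫ ε_ H A ▷ Z ⊗≫ 𝟙 Z = A ◁ g ⊗≫ ε_ H A ▷ Z ⊗≫ 𝟙 Z) : f = g := by
  apply (tensorLeftHomEquiv X H A Z).symm.injective
  simpa [tensorLeftHomEquiv, monoidalComp] using h

lemma ext_coevaluation_right {X Z : C} {f g : X ⟶ Z ⊗ A}
    (h : f ▷ H ⊗≫ Z ◁ ε_ H A ⊗≫ 𝟙 Z = g ▷ H ⊗≫ Z ◁ ε_ H A ⊗≫ 𝟙 Z) : f = g := by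
  apply (tensorRightHomEquiv X H A Z).symm.injective
  simpa [tensorRightHomEquiv, monoidalComp] using h

end Coevaluation

/-! ### The dual of the co-opposite and its skew pairing. -/

variable {C : Type u} [Category.{v} C] [MonoidalCategory C] [SymmetricCategory C]

/-- `A` is the dual of the co-opposite of `H`. -/
structure IsDualCop (H A : C) [MonObj H] [ComonObj H] [MonObj A] [ComonObj A]
    [ExactPairing H A] : Prop where
  mul : IsMate (copComul Δ[H]) μ[A]
  one : IsMate ε[H] η[A]
  comul : IsMate μ[H] Δ[A]
  counit : IsMate η[H] ε[A]

section Pairing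

variable {H A : C} [ExactPairing H A]

/-- The braiding of `A` is the transpose of the braiding of `H`, so the opposite product on the dual
is the transpose of the co-opposite coproduct. -/
lemma IsDualCop.isDualOp [HopfObj H] [HopfObj A] (h : IsDualCop H A) : IsDualOp H A where
  mul_eq := by
    rw [h.mul.eq_transpose, opMul, dualMul]
    exact ((isMate_transpose _).comp isMate_braiding).eq_transpose.symm
  one_eq := h.one.eq_transpose
  comul_eq := h.comul.eq_transpose
  counit_eq := h.counit.eq_transpose

lemma isSymmetricPairing_evalPairing : IsSymmetricPairing (evalPairing H A) :=
  ⟨isSymmetricAt _ _, isSymmetricAt _ _⟩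

variable (H A) in
-- Converts statements about transposes, which use the nested evaluation, into statements about `τ`.
-- The extra crossings disappear by symmetry.
lemma braiding_nested_evaluation :
    (β_ (H ⊗ H) (A ⊗ A)).hom ≫ ε_ (H ⊗ H) (A ⊗ A) =
      𝟙 _ ⊗≫ H ◁ evalPairing H A ▷ A ⊗≫ evalPairing H A := by
  have h₁ := isSymmetricAt (evalPairing H A) A
  have h₂ := isSymmetricAt (ε_ H A) A
  unfold IsSymmetricAt at h₁ h₂
  have e : H ◁ A ◁ (β_ H A).hom ≫ H ◁ A ◁ (β_ A H).hom = 𝟙 _ := by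
    simp only [← whiskerLeft_comp, SymmetricCategory.symmetry, whiskerLeft_id]
  simp only [ExactPairing.tensor_evaluation]
  calc
    _ = 𝟙 _ ⊗≫ H ◁ (β_ H A).hom ▷ A ⊗≫ ((β_ H A).hom ▷ (H ⊗ A) ≫ _ ◁ (β_ H A).hom) ⊗≫
        A ◁ evalPairing H A ▷ H ⊗≫ ε_ H A := by
      simp only [BraidedCategory.braiding_tensor_right_hom,
        BraidedCategory.braiding_tensor_left_hom, evalPairing]
      monoidal
    _ = 𝟙 _ ⊗≫ H ◁ (β_ H A).hom ▷ A ⊗≫ H ◁ A ◁ (β_ H A).hom ⊗≫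
        ((β_ H A).hom ▷ A ⊗≫ A ◁ evalPairing H A ⊗≫ 𝟙 A) ▷ H ⊗≫ ε_ H A := by
      rw [← whisker_exchange]; monoidal
    _ = 𝟙 _ ⊗≫ H ◁ (β_ H A).hom ▷ A ⊗≫ H ◁ A ◁ (β_ H A).hom ⊗≫
        H ◁ (β_ A A).hom ▷ H ⊗≫ (evalPairing H A ▷ (A ⊗ H) ≫ _ ◁ ε_ H A) ⊗≫ 𝟙 _ := by
      rw [h₁]; monoidal
    _ = 𝟙 _ ⊗≫ H ◁ (β_ H A).hom ▷ A ⊗≫ H ◁ A ◁ (β_ H A).hom ⊗≫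
        H ◁ ((β_ A A).hom ▷ H ⊗≫ A ◁ ε_ H A ⊗≫ 𝟙 A) ⊗≫ evalPairing H A := by
      rw [← whisker_exchange]; monoidal
    _ = 𝟙 _ ⊗≫ H ◁ (β_ H A).hom ▷ A ⊗≫ (H ◁ A ◁ (β_ H A).hom ≫
        H ◁ A ◁ (β_ A H).hom) ⊗≫ H ◁ ε_ H A ▷ A ⊗≫ evalPairing H A := by
      rw [h₂]; monoidal
    _ = _ := by
      rw [e]; simp only [evalPairing]; monoidal

lemma IsDualCop.isSkewPairing [BimonObj H] [BimonObj A] (h : IsDualCop H A) :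
    IsSkewPairing (evalPairing H A) where
  mul_left := by
    have e : A ◁ μ[H] ≫ ε_ H A = Δ[A] ▷ _ ≫ _ := h.comul.symm
    rw [evalPairing, BraidedCategory.braiding_naturality_left_assoc, e,
      ← BraidedCategory.braiding_naturality_right_assoc, braiding_nested_evaluation, evalPairing]
    monoidal
  mul_right := by
    have e : μ[A] ▷ H ≫ ε_ H A = _ ◁ copComul Δ[H] ≫ _ := h.mul
    have hs := isSymmetricAt (evalPairing H A) H
    unfold IsSymmetricAt at hs
    calc
      _ = Δ[H] ▷ (A ⊗ A) ≫ (β_ H H).hom ▷ (A ⊗ A) ≫ (β_ (H ⊗ H) (A ⊗ A)).hom ≫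
          ε_ (H ⊗ H) (A ⊗ A) := by
        rw [evalPairing, BraidedCategory.braiding_naturality_right_assoc, e,
          ← BraidedCategory.braiding_naturality_left_assoc, copComul, comp_whiskerRight,
          Category.assoc]
      _ = Δ[H] ▷ (A ⊗ A) ⊗≫ ((β_ H H).hom ▷ A ⊗≫ H ◁ evalPairing H A ⊗≫ 𝟙 H) ▷ A ⊗≫
          evalPairing H A := by
        rw [braiding_nested_evaluation]; monoidal
      _ = _ := by
        rw [hs, MonoidalCategory.tensorHom_def]; monoidal
  one_right := by
    have e : η[A] ▷ H ≫ ε_ H A = _ ◁ ε[H] ≫ _ := h.one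
    rw [evalPairing, BraidedCategory.braiding_naturality_right_assoc, e,
      braiding_tensorUnit_right, evaluation_unit]
    simp [← unitors_equal]
  one_left := by
    have e : A ◁ η[H] ≫ ε_ H A = _ ▷ _ ≫ _ := h.counit.symm
    rw [evalPairing, BraidedCategory.braiding_naturality_left_assoc, e,
      braiding_tensorUnit_left, evaluation_unit]
    simp

end Pairing

/-! ### Bending the coevaluation against the evaluation. -/

section Bend

variable {H A : C} [ExactPairing H A]

variable [BimonObj H] [BimonObj A]

variable (H A) in
/-- The evaluation `A ⊗ H ⟶ 𝟙_ C`. -/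
def evalConv : Conv (A ⊗ H) (𝟙_ C) := ε_ H A

lemma lact_evalConv : lact (evalConv H A) =
    (Δ[A] ⊗ₘ Δ[H]) ⊗≫ A ◁ (β_ A H).hom ▷ H ⊗≫ ε_ H A ▷ (A ⊗ H) ⊗≫ 𝟙 _ := by
  change Δ[A ⊗ H] ≫ ε_ H A ▷ (A ⊗ H) ≫ _ = _
  rw [Comon.tensorObj_comul, tensorμ]
  monoidal

lemma lact_evalConv' : lact (evalConv H A) =
    (copComul Δ[A] ⊗ₘ copComul Δ[H]) ⊗≫ A ◁ (β_ A H).hom ▷ H ⊗≫ (A ⊗ H) ◁ ε_ H A ⊗≫ 𝟙 _ := by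
  change Δ[A ⊗ H] ≫ ε_ H A ▷ (A ⊗ H) ≫ _ = _
  rw [Comon.tensorObj_comul, copComul, copComul, ← tensorHom_comp_tensorHom]
  have e : ((β_ A A).hom ⊗ₘ (β_ H H).hom) ⊗≫ A ◁ (β_ A H).hom ▷ H ⊗≫ (A ⊗ H) ◁ ε_ H A ⊗≫
      𝟙 _ = tensorμ A A H H ≫ ε_ H A ▷ (A ⊗ H) ≫ (λ_ _).hom := by
    calc
      _ = (((β_ A A).hom ⊗ₘ (β_ H H).hom) ≫ tensorμ A A H H) ≫ (A ⊗ H) ◁ ε_ H A ≫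
          (ρ_ _).hom := by
        rw [tensorμ]; monoidal
      _ = _ := by
        rw [← SymmetricCategory.tensorμ_braid_swap, Category.assoc,
          ← BraidedCategory.braiding_naturality_left_assoc, braiding_tensorUnit_left]
        simp
  rw [Category.assoc, ← e]
  monoidal

lemma ract_evalConv : ract (evalConv H A) =
    (Δ[A] ⊗ₘ copComul Δ[H]) ⊗≫ A ◁ ε_ H A ▷ H ⊗≫ 𝟙 _ := by
  change Δ[A ⊗ H] ≫ (A ⊗ H) ◁ ε_ H A ≫ _ = _
  have h := isSymmetricAt (ε_ H A) H
  unfold IsSymmetricAt at h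
  rw [Comon.tensorObj_comul, tensorμ]
  calc
    _ = (Δ[A] ⊗ₘ Δ[H]) ⊗≫ A ◁ ((β_ A H).hom ▷ H ⊗≫ H ◁ ε_ H A ⊗≫ 𝟙 H) := by monoidal
    _ = (Δ[A] ▷ H ≫ (A ⊗ A) ◁ Δ[H] ≫ (A ⊗ A) ◁ (β_ H H).hom) ⊗≫ A ◁ ε_ H A ▷ H ⊗≫ 𝟙 _ := by
      rw [h, MonoidalCategory.tensorHom_def]; monoidal
    _ = _ := by
      rw [copComul, MonoidalCategory.tensorHom_def]; monoidal

/-- Write the coevaluation as `∑ eᵢ ⊗ eⁱ`. Since `a(xy) = a₁(y) a₂(x)`, the sum `∑ a(eᵢ h₁) eⁱ ⊗ h₂`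
contracts to `a₁(h₁) a₂ ⊗ h₂` by a zigzag. -/
lemma IsDualCop.bend_coev_comul (h : IsDualCop H A) :
    A ◁ ((λ_ H).inv ≫ (η_ H A ⊗ₘ Δ[H]) ≫ tensorμ H A H H ≫ μ[H] ▷ (A ⊗ H)) ⊗≫
      ε_ H A ▷ (A ⊗ H) ⊗≫ 𝟙 (A ⊗ H) = lact (evalConv H A) := by
  have e : A ◁ μ[H] ≫ ε_ H A = Δ[A] ▷ _ ≫ _ := h.comul.symm
  rw [ExactPairing.tensor_evaluation] at e
  rw [lact_evalConv, tensorμ]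
  calc
    _ = 𝟙 _ ⊗≫ A ◁ (η_ H A ⊗ₘ Δ[H]) ⊗≫ A ◁ H ◁ (β_ A H).hom ▷ H ⊗≫
        (A ◁ μ[H] ≫ ε_ H A) ▷ (A ⊗ H) ⊗≫ 𝟙 (A ⊗ H) := by monoidal
    _ = 𝟙 _ ⊗≫ A ◁ (η_ H A ⊗ₘ Δ[H]) ⊗≫ (A ◁ (H ◁ (β_ A H).hom ▷ H) ≫ Δ[A] ▷ _) ⊗≫
        A ◁ ε_ H A ▷ (H ⊗ A ⊗ H) ⊗≫ ε_ H A ▷ (A ⊗ H) ⊗≫ 𝟙 (A ⊗ H) := by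
      rw [e]; monoidal
    _ = 𝟙 _ ⊗≫ A ◁ (𝟙_ C ◁ Δ[H] ≫ η_ H A ▷ (H ⊗ H)) ⊗≫ Δ[A] ▷ (H ⊗ A ⊗ H ⊗ H) ⊗≫
        A ◁ ((A ⊗ H) ◁ (β_ A H).hom ≫ ε_ H A ▷ _) ▷ H ⊗≫ ε_ H A ▷ (A ⊗ H) ⊗≫ 𝟙 (A ⊗ H) := by
      rw [whisker_exchange, MonoidalCategory.tensorHom_def']; monoidal
    _ = 𝟙 _ ⊗≫ A ◁ Δ[H] ⊗≫ (A ◁ (η_ H A ▷ (H ⊗ H)) ≫ Δ[A] ▷ _) ⊗≫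
        A ◁ ε_ H A ▷ (A ⊗ H ⊗ H) ⊗≫ A ◁ (β_ A H).hom ▷ H ⊗≫ ε_ H A ▷ (A ⊗ H) ⊗≫ 𝟙 (A ⊗ H) := by
      rw [whisker_exchange (ε_ H A)]; monoidal
    _ = 𝟙 _ ⊗≫ A ◁ Δ[H] ⊗≫ Δ[A] ▷ (H ⊗ H) ⊗≫ A ◁ (A ◁ η_ H A ⊗≫ ε_ H A ▷ A) ▷ (H ⊗ H) ⊗≫
        A ◁ (β_ A H).hom ▷ H ⊗≫ ε_ H A ▷ (A ⊗ H) ⊗≫ 𝟙 (A ⊗ H) := by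
      rw [whisker_exchange]; monoidal
    _ = _ := by
      rw [ExactPairing.coevaluation_evaluation'', MonoidalCategory.tensorHom_def']; monoidal

/-- Similarly `∑ a(h₂ eᵢ) h₁ ⊗ eⁱ` contracts to `h₁ ⊗ a₁`, weighted by `a₂(h₂)`. -/
lemma IsDualCop.bend_comul_coev (h : IsDualCop H A) :
    A ◁ ((ρ_ H).inv ≫ (copComul Δ[H] ⊗ₘ η_ H A) ≫ tensorμ H H H A ≫ μ[H] ▷ (H ⊗ A)) ⊗≫
      ε_ H A ▷ (H ⊗ A) ⊗≫ 𝟙 (H ⊗ A) = ract (evalConv H A) ≫ (β_ A H).hom := by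
  have e : A ◁ μ[H] ≫ ε_ H A = Δ[A] ▷ _ ≫ _ := h.comul.symm
  rw [ExactPairing.tensor_evaluation] at e
  have hs := isSymmetricAt (ε_ H A) H
  unfold IsSymmetricAt at hs
  rw [ract_evalConv, tensorμ]
  set k : A ⊗ H ⟶ H ⊗ A :=
    (Δ[A] ⊗ₘ copComul Δ[H]) ⊗≫ A ◁ ε_ H A ▷ H ⊗≫ (β_ A H).hom with hk
  calc
    _ = 𝟙 _ ⊗≫ A ◁ (copComul Δ[H] ⊗ₘ η_ H A) ⊗≫ A ◁ H ◁ (β_ H H).hom ▷ A ⊗≫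
        (A ◁ μ[H] ≫ ε_ H A) ▷ (H ⊗ A) ⊗≫ 𝟙 (H ⊗ A) := by monoidal
    _ = 𝟙 _ ⊗≫ A ◁ (copComul Δ[H] ⊗ₘ η_ H A) ⊗≫ (A ◁ (H ◁ (β_ H H).hom ▷ A) ≫ Δ[A] ▷ _) ⊗≫
        A ◁ ε_ H A ▷ (H ⊗ H ⊗ A) ⊗≫ ε_ H A ▷ (H ⊗ A) ⊗≫ 𝟙 (H ⊗ A) := by
      rw [e]; monoidal
    _ = 𝟙 _ ⊗≫ A ◁ (copComul Δ[H] ⊗ₘ η_ H A) ⊗≫ Δ[A] ▷ (H ⊗ H ⊗ H ⊗ A) ⊗≫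
        A ◁ ((A ⊗ H) ◁ (β_ H H).hom ≫ ε_ H A ▷ _) ▷ A ⊗≫ ε_ H A ▷ (H ⊗ A) ⊗≫ 𝟙 (H ⊗ A) := by
      rw [whisker_exchange]; monoidal
    _ = 𝟙 _ ⊗≫ A ◁ (copComul Δ[H] ⊗ₘ η_ H A) ⊗≫ Δ[A] ▷ (H ⊗ H ⊗ H ⊗ A) ⊗≫
        A ◁ ε_ H A ▷ (H ⊗ H ⊗ A) ⊗≫ (𝟙 ((A ⊗ H) ⊗ H) ⊗≫ A ◁ (β_ H H).hom ⊗≫ ε_ H A ▷ H ⊗≫ 𝟙 H) ▷ A ⊗≫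
        𝟙 (H ⊗ A) := by
      rw [whisker_exchange]; monoidal
    _ = 𝟙 _ ⊗≫ ((A ⊗ H) ◁ η_ H A ≫ k ▷ (H ⊗ A)) ⊗≫ H ◁ ε_ H A ▷ A ⊗≫ 𝟙 (H ⊗ A) := by
      rw [← hs, hk, MonoidalCategory.tensorHom_def', MonoidalCategory.tensorHom_def']; monoidal
    _ = k ⊗≫ H ◁ (A ◁ η_ H A ⊗≫ ε_ H A ▷ A) ⊗≫ 𝟙 (H ⊗ A) := by
      rw [whisker_exchange]; monoidal
    _ = _ := by
      rw [ExactPairing.coevaluation_evaluation'', hk]; monoidal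

/-- The counterpart for a leg in `A`, paired with `h` through `(ab)(h) = a(h₁) b(h₂)`. -/
lemma IsDualCop.bend_coev_comul' (h : IsDualCop H A) :
    ((λ_ A).inv ≫ (η_ H A ⊗ₘ Δ[A]) ≫ tensorμ H A A A ≫ (H ⊗ A) ◁ μ[A]) ▷ H ⊗≫
      (H ⊗ A) ◁ ε_ H A ⊗≫ 𝟙 (H ⊗ A) = ract (evalConv H A) ≫ (β_ A H).hom := by
  have e : μ[A] ▷ H ≫ ε_ H A = _ ◁ copComul Δ[H] ≫ _ := h.mul
  rw [ExactPairing.tensor_evaluation] at e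
  have hs := isSymmetricAt (ε_ H A) A
  unfold IsSymmetricAt at hs
  rw [ract_evalConv, tensorμ]
  set k : A ⊗ H ⟶ H ⊗ A :=
    (Δ[A] ⊗ₘ copComul Δ[H]) ⊗≫ A ◁ ε_ H A ▷ H ⊗≫ (β_ A H).hom with hk
  calc
    _ = 𝟙 _ ⊗≫ (η_ H A ⊗ₘ Δ[A]) ▷ H ⊗≫ (H ◁ (β_ A A).hom ▷ A) ▷ H ⊗≫
        (H ⊗ A) ◁ (μ[A] ▷ H ≫ ε_ H A) ⊗≫ 𝟙 (H ⊗ A) := by monoidal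
    _ = 𝟙 _ ⊗≫ (η_ H A ⊗ₘ Δ[A]) ▷ H ⊗≫ ((H ◁ (β_ A A).hom ▷ A) ▷ H ≫
        _ ◁ copComul Δ[H]) ⊗≫ (H ⊗ A) ◁ A ◁ ε_ H A ▷ H ⊗≫ (H ⊗ A) ◁ ε_ H A ⊗≫ 𝟙 (H ⊗ A) := by
      rw [e]; monoidal
    _ = 𝟙 _ ⊗≫ (η_ H A ⊗ₘ Δ[A]) ▷ H ⊗≫ (H ⊗ A ⊗ A ⊗ A) ◁ copComul Δ[H] ⊗≫
        H ◁ ((β_ A A).hom ▷ (A ⊗ H) ≫ (A ⊗ A) ◁ ε_ H A) ▷ H ⊗≫ (H ⊗ A) ◁ ε_ H A ⊗≫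
        𝟙 (H ⊗ A) := by
      rw [← whisker_exchange]; monoidal
    _ = 𝟙 _ ⊗≫ (η_ H A ⊗ₘ Δ[A]) ▷ H ⊗≫ (H ⊗ A ⊗ A ⊗ A) ◁ copComul Δ[H] ⊗≫
        H ◁ (A ⊗ A) ◁ ε_ H A ▷ H ⊗≫ H ◁ ((β_ A A).hom ▷ H ⊗≫ A ◁ ε_ H A ⊗≫ 𝟙 A) ⊗≫
        𝟙 (H ⊗ A) := by
      rw [← whisker_exchange]; monoidal
    _ = 𝟙 _ ⊗≫ (η_ H A ▷ (A ⊗ H) ≫ (H ⊗ A) ◁ k) ⊗≫ H ◁ ε_ H A ▷ A ⊗≫ 𝟙 (H ⊗ A) := by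
      rw [hs, hk, MonoidalCategory.tensorHom_def, MonoidalCategory.tensorHom_def]; monoidal
    _ = k ⊗≫ (η_ H A ▷ H ⊗≫ H ◁ ε_ H A) ▷ A ⊗≫ 𝟙 (H ⊗ A) := by
      rw [← whisker_exchange]; monoidal
    _ = _ := by
      rw [ExactPairing.evaluation_coevaluation'', hk]; monoidal

lemma IsDualCop.bend_comul_coev' (h : IsDualCop H A) :
    ((ρ_ A).inv ≫ (copComul Δ[A] ⊗ₘ η_ H A) ≫ tensorμ A A H A ≫ (A ⊗ H) ◁ μ[A]) ▷ H ⊗≫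
      (A ⊗ H) ◁ ε_ H A ⊗≫ 𝟙 (A ⊗ H) = lact (evalConv H A) := by
  have e : μ[A] ▷ H ≫ ε_ H A = _ ◁ copComul Δ[H] ≫ _ := h.mul
  rw [ExactPairing.tensor_evaluation] at e
  rw [lact_evalConv', tensorμ]
  calc
    _ = 𝟙 _ ⊗≫ (copComul Δ[A] ⊗ₘ η_ H A) ▷ H ⊗≫ (A ◁ (β_ A H).hom ▷ A) ▷ H ⊗≫
        (A ⊗ H) ◁ (μ[A] ▷ H ≫ ε_ H A) ⊗≫ 𝟙 (A ⊗ H) := by monoidal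
    _ = 𝟙 _ ⊗≫ (copComul Δ[A] ⊗ₘ η_ H A) ▷ H ⊗≫ ((A ◁ (β_ A H).hom ▷ A) ▷ H ≫
        _ ◁ copComul Δ[H]) ⊗≫ (A ⊗ H) ◁ A ◁ ε_ H A ▷ H ⊗≫ (A ⊗ H) ◁ ε_ H A ⊗≫ 𝟙 (A ⊗ H) := by
      rw [e]; monoidal
    _ = 𝟙 _ ⊗≫ copComul Δ[A] ▷ H ⊗≫ (A ⊗ A) ◁ (η_ H A ▷ H ≫ (H ⊗ A) ◁ copComul Δ[H]) ⊗≫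
        A ◁ ((β_ A H).hom ▷ (A ⊗ H) ≫ (H ⊗ A) ◁ ε_ H A) ▷ H ⊗≫ (A ⊗ H) ◁ ε_ H A ⊗≫
        𝟙 (A ⊗ H) := by
      rw [← whisker_exchange, MonoidalCategory.tensorHom_def]; monoidal
    _ = 𝟙 _ ⊗≫ copComul Δ[A] ▷ H ⊗≫ (A ⊗ A) ◁ copComul Δ[H] ⊗≫
        (A ⊗ A) ◁ (η_ H A ▷ H ⊗≫ H ◁ ε_ H A) ▷ H ⊗≫ A ◁ (β_ A H).hom ▷ H ⊗≫
        (A ⊗ H) ◁ ε_ H A ⊗≫ 𝟙 (A ⊗ H) := by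
      rw [← whisker_exchange, ← whisker_exchange]; monoidal
    _ = _ := by
      rw [ExactPairing.evaluation_coevaluation'', MonoidalCategory.tensorHom_def]; monoidal

end Bend

/-! ### Convolution units built from antipodes, and the coevaluation as a convolution map. -/

section Bimonoids

variable {C : Type u} [Category.{v} C] [MonoidalCategory C] [BraidedCategory C]

attribute [local instance] ComonObj.instTensorUnit

instance isMonHom_comul (X : C) [BimonObj X] : IsMonHom Δ[X] where
  one_hom := BimonObj.one_comul X
  mul_hom := by rw [BimonObj.mul_comul, MonObj.tensorObj.mul_def]

instance isMonHom_copComul {C : Type u} [Category.{v} C] [MonoidalCategory C]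
    [SymmetricCategory C] (X : C) [BimonObj X] : IsMonHom (copComul Δ[X]) := by
  unfold copComul; infer_instance

/-- The identity of a Hopf monoid is invertible under convolution. -/
def idUnit (H : C) [HopfObj H] : (Conv H H)ˣ where
  val := 𝟙 H
  inv := HopfObj.antipode (X := H)
  val_inv := by
    change Δ[H] ≫ 𝟙 H ▷ H ≫ H ◁ HopfObj.antipode (X := H) ≫ μ[H] = ε[H] ≫ η[H]
    rw [id_whiskerRight, Category.id_comp, HopfObj.antipode_right]
  inv_val := by
    change Δ[H] ≫ HopfObj.antipode (X := H) ▷ H ≫ H ◁ 𝟙 H ≫ μ[H] = ε[H] ≫ η[H]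
    rw [whiskerLeft_id, Category.id_comp, HopfObj.antipode_left]

/-- A bimonoid whose identity is invertible under convolution is a Hopf monoid. -/
@[reducible]
def hopfOfUnit {D : C} [BimonObj D] (u : (Conv D D)ˣ) (hu : convHom u.1 = 𝟙 D) : HopfObj D where
  antipode := convHom (u⁻¹).1
  antipode_left := by
    have h : convHom ((u⁻¹).1 * u.1) = ε[D] ≫ η[D] := by
      rw [← Units.val_mul, inv_mul_cancel, Units.val_one, convHom_one]
    rwa [convHom_mul, hu, whiskerLeft_id, Category.id_comp] at h
  antipode_right := by
    have h : convHom (u.1 * (u⁻¹).1) = ε[D] ≫ η[D] := by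
      rw [← Units.val_mul, mul_inv_cancel, Units.val_one, convHom_one]
    rwa [convHom_mul, hu, id_whiskerRight, Category.id_comp] at h

instance isComonHom_fst (X Y : C) [ComonObj X] [ComonObj Y] :
    IsComonHom (X ◁ ε[Y] ≫ (ρ_ X).hom) := inferInstance

instance isComonHom_snd (X Y : C) [ComonObj X] [ComonObj Y] :
    IsComonHom (ε[X] ▷ Y ≫ (λ_ Y).hom) := inferInstance

/-- The product of two convolution invertible morphisms is convolution invertible. -/
def tensorUnit {X Y D : C} [ComonObj X] [ComonObj Y] [MonObj D] (u : (Conv X D)ˣ)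
    (v : (Conv Y D)ˣ) : (Conv (X ⊗ Y) D)ˣ :=
  Units.map (convComap D (X ◁ ε[Y] ≫ (ρ_ X).hom)) u *
    Units.map (convComap D (ε[X] ▷ Y ≫ (λ_ Y).hom)) v

lemma convHom_tensorUnit {X Y D : C} [ComonObj X] [ComonObj Y] [MonObj D] (u : (Conv X D)ˣ)
    (v : (Conv Y D)ˣ) :
    convHom (tensorUnit u v).1 = (convHom u.1 ⊗ₘ convHom v.1) ≫ μ[D] := by
  have h : Δ[X ⊗ Y] ≫ (((X ◁ ε[Y] ≫ (ρ_ X).hom) ≫ convHom u.1) ⊗ₘ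
      ((ε[X] ▷ Y ≫ (λ_ Y).hom) ≫ convHom v.1)) = convHom u.1 ⊗ₘ convHom v.1 := by
    rw [← tensorHom_comp_tensorHom, ← Category.assoc, comul_fst_snd, Category.id_comp]
  rw [← h, Category.assoc, MonoidalCategory.tensorHom_def, Category.assoc]
  rfl

end Bimonoids

section Coevaluation

variable {C : Type u} [Category.{v} C] [MonoidalCategory C] [SymmetricCategory C]
  {H A : C} [ExactPairing H A]

lemma nested_coevaluation_braiding :
    η_ (H ⊗ H) (A ⊗ A) ≫ (β_ H H).hom ▷ (A ⊗ A) =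
      (ρ_ (𝟙_ C)).inv ≫ (η_ H A ⊗ₘ η_ H A) ≫ tensorμ H A H A := by
  rw [ExactPairing.tensor_coevaluation, tensorμ]
  have h : (ρ_ H).inv ≫ H ◁ η_ H A ≫ (β_ H (H ⊗ A)).hom = (λ_ H).inv ≫ η_ H A ▷ H := by
    rw [BraidedCategory.braiding_naturality_right, braiding_tensorUnit_right]
    simp
  have h' : 𝟙 H ⊗≫ H ◁ η_ H A ⊗≫ (β_ H H).hom ▷ A ⊗≫ 𝟙 ((H ⊗ H) ⊗ A) =
      𝟙 H ⊗≫ η_ H A ▷ H ⊗≫ H ◁ (β_ A H).hom ⊗≫ 𝟙 ((H ⊗ H) ⊗ A) := by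
    have e : H ◁ (β_ H A).hom ≫ H ◁ (β_ A H).hom = 𝟙 _ := by
      rw [← whiskerLeft_comp, SymmetricCategory.symmetry, whiskerLeft_id]
    calc
      _ = 𝟙 H ⊗≫ H ◁ η_ H A ⊗≫ (β_ H H).hom ▷ A ⊗≫ (H ◁ (β_ H A).hom ≫
          H ◁ (β_ A H).hom) ⊗≫ 𝟙 ((H ⊗ H) ⊗ A) := by rw [e]; monoidal
      _ = ((ρ_ H).inv ≫ H ◁ η_ H A ≫ (β_ H (H ⊗ A)).hom) ⊗≫
          H ◁ (β_ A H).hom ⊗≫ 𝟙 ((H ⊗ H) ⊗ A) := by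
        rw [BraidedCategory.braiding_tensor_right_hom]; monoidal
      _ = _ := by rw [h]; monoidal
  calc
    _ = η_ H A ⊗≫ (𝟙 H ⊗≫ H ◁ η_ H A ⊗≫ (β_ H H).hom ▷ A ⊗≫ 𝟙 ((H ⊗ H) ⊗ A)) ▷ A ⊗≫
        𝟙 _ := by monoidal
    _ = 𝟙 _ ⊗≫ ((𝟙_ C) ◁ η_ H A ≫ η_ H A ▷ (H ⊗ A)) ⊗≫ H ◁ (β_ A H).hom ▷ A ⊗≫
        𝟙 _ := by
      rw [h']; monoidal
    _ = _ := by
      rw [MonoidalCategory.tensorHom_def']; monoidal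

variable [MonObj H] [ComonObj H] [MonObj A] [ComonObj A]

/-- In dual bases, `∑ Δ(eᵢ) ⊗ eⁱ = ∑ eᵢ ⊗ eⱼ ⊗ eⁱeʲ`. This makes `IsDualCop.coevConv`
multiplicative. -/
lemma IsDualCop.coevaluation_comul (h : IsDualCop H A) :
    η_ H A ≫ Δ[H] ▷ A =
      (ρ_ (𝟙_ C)).inv ≫ (η_ H A ⊗ₘ η_ H A) ≫ tensorμ H A H A ≫ (H ⊗ H) ◁ μ[A] := by
  have e := h.mul.coevaluation
  have e' : (β_ H H).hom ▷ A ≫ (β_ H H).hom ▷ A = 𝟙 _ := by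
    rw [← comp_whiskerRight, SymmetricCategory.symmetry, id_whiskerRight]
  calc
    _ = (η_ H A ≫ copComul Δ[H] ▷ A) ≫ (β_ H H).hom ▷ A := by
      rw [copComul, comp_whiskerRight, Category.assoc, Category.assoc, e', Category.comp_id]
    _ = (η_ (H ⊗ H) (A ⊗ A) ≫ (β_ H H).hom ▷ (A ⊗ A)) ≫ (H ⊗ H) ◁ μ[A] := by
      rw [e, Category.assoc, whisker_exchange, Category.assoc]
    _ = _ := by rw [nested_coevaluation_braiding]; simp only [Category.assoc]

attribute [local instance] ComonObj.instTensorUnit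

/-- Bending `H` around is a homomorphism of convolution monoids. -/
def IsDualCop.coevConv (h : IsDualCop H A) (N : C) [MonObj N] :
    Conv H N →* Conv (𝟙_ C) (N ⊗ A) where
  toFun f := η_ H A ≫ convHom f ▷ A
  map_one' := by
    have e : η_ H A ≫ ε[H] ▷ A = _ ≫ _ ◁ η[A] := h.one.coevaluation
    change η_ H A ≫ (ε[H] ≫ η[N]) ▷ A = 𝟙 (𝟙_ C) ≫ (λ_ (𝟙_ C)).inv ≫ (η[N] ⊗ₘ η[A])
    have e' : η_ (𝟙_ C) (𝟙_ C) = (λ_ (𝟙_ C)).inv := unitors_inv_equal.symm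
    rw [comp_whiskerRight, reassoc_of% e, MonoidalCategory.tensorHom_def', Category.id_comp, e']
  map_mul' f g := by
    change η_ H A ≫ (Δ[H] ≫ convHom f ▷ H ≫ N ◁ convHom g ≫ μ[N]) ▷ A =
      (λ_ (𝟙_ C)).inv ≫ (η_ H A ≫ convHom f ▷ A) ▷ (𝟙_ C) ≫
        (N ⊗ A) ◁ (η_ H A ≫ convHom g ▷ A) ≫ tensorμ N A N A ≫ (μ[N] ⊗ₘ μ[A])
    have e := tensorμ_natural (convHom f) (𝟙 A) (convHom g) (𝟙 A)
    have e' : (λ_ (𝟙_ C)).inv ≫ (η_ H A ≫ convHom f ▷ A) ▷ (𝟙_ C) ≫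
        (N ⊗ A) ◁ (η_ H A ≫ convHom g ▷ A) = (ρ_ (𝟙_ C)).inv ≫ (η_ H A ⊗ₘ η_ H A) ≫
          ((convHom f ⊗ₘ 𝟙 A) ⊗ₘ (convHom g ⊗ₘ 𝟙 A)) := by
      rw [tensorHom_comp_tensorHom, MonoidalCategory.tensorHom_def, tensorHom_id, tensorHom_id,
        unitors_inv_equal]
    rw [reassoc_of% e', reassoc_of% e]
    calc
      _ = (η_ H A ≫ Δ[H] ▷ A) ≫ (convHom f ⊗ₘ convHom g) ▷ A ≫ μ[N] ▷ A := by
        rw [MonoidalCategory.tensorHom_def]; simp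
      _ = (ρ_ (𝟙_ C)).inv ≫ (η_ H A ⊗ₘ η_ H A) ≫ tensorμ H A H A ≫
          (convHom f ⊗ₘ convHom g) ▷ (A ⊗ A) ≫ (N ⊗ N) ◁ μ[A] ≫ μ[N] ▷ A := by
        rw [h.coevaluation_comul]
        simp only [Category.assoc]
        rw [whisker_exchange_assoc]
      _ = _ := by
        rw [id_tensorHom_id, tensorHom_id, MonoidalCategory.tensorHom_def' μ[N]]

end Coevaluation

/-! ### Intertwining relations, and the co-opposite coproduct. -/

section Intertwining

variable {C : Type u} [Category.{v} C] [MonoidalCategory C] {M : C} [MonObj M]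

/-- `p r = r q` for `r : 𝟙_ C ⟶ M`. -/
def Intertwines (r : 𝟙_ C ⟶ M) {X : C} (p q : X ⟶ M) : Prop :=
  (ρ_ X).inv ≫ (p ⊗ₘ r) ≫ μ[M] = (λ_ X).inv ≫ (r ⊗ₘ q) ≫ μ[M]

/-- `p p' r = p r q' = r q q'`. Consequently an intertwining relation between monoid maps may be
checked on generators. -/
lemma Intertwines.mul {r : 𝟙_ C ⟶ M} {X Y : C} {p q : X ⟶ M} {p' q' : Y ⟶ M}
    (h : Intertwines r p q) (h' : Intertwines r p' q') :
    Intertwines r ((p ⊗ₘ p') ≫ μ[M]) ((q ⊗ₘ q') ≫ μ[M]) := by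
  unfold Intertwines at *
  calc
    _ = 𝟙 _ ⊗≫ p ▷ Y ⊗≫ M ◁ p' ⊗≫ ((M ⊗ M) ◁ r ≫ μ[M] ▷ M) ≫ μ[M] := by
      simp only [MonoidalCategory.tensorHom_def]
      rw [whisker_exchange]; monoidal
    _ = 𝟙 _ ⊗≫ p ▷ Y ⊗≫ M ◁ p' ⊗≫ M ◁ M ◁ r ⊗≫ (μ[M] ▷ M ≫ μ[M]) := by monoidal
    _ = 𝟙 _ ⊗≫ p ▷ Y ⊗≫ M ◁ ((ρ_ Y).inv ≫ (p' ⊗ₘ r) ≫ μ[M]) ≫ μ[M] := by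
      rw [MonObj.mul_assoc, MonoidalCategory.tensorHom_def]; monoidal
    _ = 𝟙 _ ⊗≫ p ▷ Y ⊗≫ M ◁ r ▷ Y ⊗≫ (M ◁ M ◁ q' ≫ M ◁ μ[M]) ≫ μ[M] := by
      rw [h', MonoidalCategory.tensorHom_def]; monoidal
    _ = 𝟙 _ ⊗≫ p ▷ Y ⊗≫ M ◁ r ▷ Y ⊗≫ (M ⊗ M) ◁ q' ⊗≫
        ((α_ M M M).hom ≫ M ◁ μ[M] ≫ μ[M]) := by monoidal
    _ = 𝟙 _ ⊗≫ p ▷ Y ⊗≫ M ◁ r ▷ Y ⊗≫ ((M ⊗ M) ◁ q' ≫ μ[M] ▷ M) ≫ μ[M] := by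
      rw [← MonObj.mul_assoc]; monoidal
    _ = ((ρ_ X).inv ≫ (p ⊗ₘ r) ≫ μ[M]) ▷ Y ⊗≫ M ◁ q' ≫ μ[M] := by
      rw [whisker_exchange, MonoidalCategory.tensorHom_def]; monoidal
    _ = 𝟙 _ ⊗≫ r ▷ (X ⊗ Y) ⊗≫ M ◁ q ▷ Y ⊗≫ (μ[M] ▷ Y ≫ M ◁ q') ≫ μ[M] := by
      rw [h, MonoidalCategory.tensorHom_def]; monoidal
    _ = 𝟙 _ ⊗≫ r ▷ (X ⊗ Y) ⊗≫ M ◁ q ▷ Y ⊗≫ M ◁ M ◁ q' ⊗≫ (μ[M] ▷ M ≫ μ[M]) := by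
      rw [← whisker_exchange]; monoidal
    _ = _ := by
      rw [MonObj.mul_assoc]
      simp only [MonoidalCategory.tensorHom_def]
      monoidal

lemma Intertwines.of_epi {r : 𝟙_ C ⟶ M} {X Y : C} {p q : X ⟶ M} (e : Y ⟶ X) [Epi e]
    (h : Intertwines r (e ≫ p) (e ≫ q)) : Intertwines r p q := by
  unfold Intertwines at *
  rw [← cancel_epi e]
  have h₁ : e ≫ (ρ_ X).inv ≫ (p ⊗ₘ r) ≫ μ[M] = (ρ_ Y).inv ≫ ((e ≫ p) ⊗ₘ r) ≫ μ[M] := by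
    simp [MonoidalCategory.tensorHom_def]
  have h₂ : e ≫ (λ_ X).inv ≫ (r ⊗ₘ q) ≫ μ[M] = (λ_ Y).inv ≫ (r ⊗ₘ (e ≫ q)) ≫ μ[M] := by
    simp [MonoidalCategory.tensorHom_def']
  rw [h₁, h₂, h]

end Intertwining

section CopComul

variable {C : Type u} [Category.{v} C] [MonoidalCategory C] [SymmetricCategory C] (D : C)
  [ComonObj D]

lemma copComul_counit_left : copComul Δ[D] ≫ ε[D] ▷ D = (λ_ D).inv := by
  rw [copComul, Category.assoc, ← BraidedCategory.braiding_naturality_right,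
    braiding_tensorUnit_right, ComonObj.comul_counit_assoc]
  simp

lemma copComul_counit_right : copComul Δ[D] ≫ D ◁ ε[D] = (ρ_ D).inv := by
  rw [copComul, Category.assoc, ← BraidedCategory.braiding_naturality_left,
    braiding_tensorUnit_left, ComonObj.counit_comul_assoc]
  simp

lemma copComul_coassoc : copComul Δ[D] ≫ D ◁ copComul Δ[D] =
    copComul Δ[D] ≫ copComul Δ[D] ▷ D ≫ (α_ D D D).hom := by
  simp only [copComul, whiskerLeft_comp, comp_whiskerRight, Category.assoc]
  rw [← BraidedCategory.braiding_naturality_left_assoc,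
    ← BraidedCategory.braiding_naturality_right_assoc, ComonObj.comul_assoc_assoc]
  have e : (α_ D D D).hom ≫ (β_ D (D ⊗ D)).hom ≫ (β_ D D).hom ▷ D ≫ (α_ D D D).hom =
      (β_ (D ⊗ D) D).hom ≫ D ◁ (β_ D D).hom := by
    rw [← BraidedCategory.braiding_naturality_right_assoc]
    simp only [BraidedCategory.braiding_tensor_right_hom, BraidedCategory.braiding_tensor_left_hom]
    simp
  rw [← e]

end CopComul

/-! ### The quasi-triangularity axioms. -/

section Nested

variable {C : Type u} [Category.{v} C] [MonoidalCategory C]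

lemma nested_comp {X Y X' Y' Z W : C} (r : 𝟙_ C ⟶ X ⊗ Y) (s : 𝟙_ C ⟶ Z ⊗ W) (f : X ⟶ X')
    (g : Y ⟶ Y') :
    (r ≫ (f ⊗ₘ g)) ⊗≫ X' ◁ s ▷ Y' =
      r ⊗≫ X ◁ s ▷ Y ≫ (f ⊗ₘ ((Z ⊗ W) ◁ g)) := by
  calc
    _ = r ⊗≫ X ◁ g ⊗≫ (f ▷ _ ≫ X' ◁ s) ▷ Y' ⊗≫ 𝟙 _ := by
      rw [MonoidalCategory.tensorHom_def']; monoidal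
    _ = r ⊗≫ X ◁ (_ ◁ g ≫ s ▷ Y') ⊗≫ f ▷ (Z ⊗ W) ▷ Y' ⊗≫ 𝟙 _ := by
      rw [← whisker_exchange]; monoidal
    _ = _ := by
      rw [whisker_exchange, MonoidalCategory.tensorHom_def']; monoidal

lemma tensorHom_reassoc {X X' Y Y' Z Z' W W' : C} (f : X ⟶ X') (g : Y ⟶ Y') (h : Z ⟶ Z')
    (k : W ⟶ W') : (f ⊗ₘ g) ⊗ₘ (h ⊗ₘ k) = 𝟙 ((X ⊗ Y) ⊗ (Z ⊗ W)) ⊗≫ (f ⊗ₘ ((g ⊗ₘ h) ⊗ₘ k)) ⊗≫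
      𝟙 ((X' ⊗ Y') ⊗ (Z' ⊗ W')) := by
  have e : (f ⊗ₘ g) ⊗ₘ (h ⊗ₘ k) = (α_ X Y (Z ⊗ W)).hom ≫ X ◁ (α_ Y Z W).inv ≫
      (f ⊗ₘ ((g ⊗ₘ h) ⊗ₘ k)) ≫ X' ◁ (α_ Y' Z' W').hom ≫ (α_ X' Y' (Z' ⊗ W')).inv := by
    simp only [← id_tensorHom, tensorHom_comp_tensorHom_assoc, associator_naturality,
      Iso.inv_hom_id_assoc, Category.id_comp, Category.comp_id, associator_inv_naturality,
      Iso.hom_inv_id_assoc]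
  rw [e]
  generalize f ⊗ₘ ((g ⊗ₘ h) ⊗ₘ k) = m
  monoidal

end Nested

section RMatrix

variable {C : Type u} [Category.{v} C] [MonoidalCategory C] [SymmetricCategory C]
  {H A : C} [ExactPairing H A]

variable [BimonObj H] [BimonObj A] {D : C} [BimonObj D] (iH : H ⟶ D) (iA : A ⟶ D)

/-- The product of `A` is the transpose of `Δ^cop`. Written with coevaluations, this is the axiom
with values in `H` and `A`; `iH` carries the coproduct and `iA` the product into `D`. -/
lemma IsDualCop.qt_left (h : IsDualCop H A) [IsComonHom iH] [IsMonHom iA] :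
    (η_ H A ≫ (iH ⊗ₘ iA)) ≫ copComul Δ[D] ▷ D =
      (η_ H A ≫ (iH ⊗ₘ iA)) ⊗≫ D ◁ (η_ H A ≫ (iH ⊗ₘ iA)) ▷ D ⊗≫ (D ⊗ D) ◁ μ[D] := by
  have e := h.mul.coevaluation
  have e₁ : iH ≫ copComul Δ[D] = copComul Δ[H] ≫ (iH ⊗ₘ iH) := by
    simp only [copComul, Category.assoc, IsComonHom.hom_comul_assoc,
      BraidedCategory.braiding_naturality]
  have e₂ : (iH ⊗ₘ ((H ⊗ A) ◁ iA)) ≫ D ◁ ((iH ⊗ₘ iA) ▷ D) = iH ⊗ₘ ((iH ⊗ₘ iA) ⊗ₘ iA) := by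
    simp only [← id_tensorHom, ← tensorHom_id, tensorHom_comp_tensorHom, Category.id_comp,
      Category.comp_id]
  calc
    _ = (η_ H A ≫ copComul Δ[H] ▷ A) ≫ ((iH ⊗ₘ iH) ⊗ₘ iA) := by
      simp only [Category.assoc, ← tensorHom_id, tensorHom_comp_tensorHom, e₁, Category.id_comp,
        Category.comp_id]
    _ = η_ (H ⊗ H) (A ⊗ A) ≫ ((iH ⊗ₘ iH) ⊗ₘ (iA ⊗ₘ iA)) ≫ (D ⊗ D) ◁ μ[D] := by
      rw [e]
      simp only [Category.assoc, ← id_tensorHom, tensorHom_comp_tensorHom, IsMonHom.mul_hom,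
        Category.id_comp, Category.comp_id]
    _ = η_ H A ⊗≫ H ◁ η_ H A ▷ A ⊗≫ (iH ⊗ₘ ((iH ⊗ₘ iA) ⊗ₘ iA)) ⊗≫ (D ⊗ D) ◁ μ[D] := by
      rw [ExactPairing.tensor_coevaluation, tensorHom_reassoc]
      generalize iH ⊗ₘ ((iH ⊗ₘ iA) ⊗ₘ iA) = m
      monoidal
    _ = (η_ H A ⊗≫ H ◁ η_ H A ▷ A ≫ (iH ⊗ₘ ((H ⊗ A) ◁ iA))) ⊗≫ (D ◁ ((iH ⊗ₘ iA) ▷ D)) ⊗≫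
        (D ⊗ D) ◁ μ[D] := by
      rw [← e₂]
      generalize iH ⊗ₘ ((H ⊗ A) ◁ iA) = k, iH ⊗ₘ iA = l
      monoidal
    _ = _ := by
      rw [← nested_comp]
      generalize iH ⊗ₘ iA = l
      monoidal

lemma IsDualCop.qt_right (h : IsDualCop H A) [IsMonHom iH] [IsComonHom iA] :
    (η_ H A ≫ (iH ⊗ₘ iA)) ≫ D ◁ Δ[D] =
      (η_ H A ≫ (iH ⊗ₘ iA)) ⊗≫ D ◁ (η_ H A ≫ (iH ⊗ₘ iA)) ▷ D ⊗≫ μ[D] ▷ (D ⊗ D) := by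
  have e := h.comul.coevaluation
  have e₂ : (iH ⊗ₘ ((H ⊗ A) ◁ iA)) ≫ D ◁ ((iH ⊗ₘ iA) ▷ D) = iH ⊗ₘ ((iH ⊗ₘ iA) ⊗ₘ iA) := by
    simp only [← id_tensorHom, ← tensorHom_id, tensorHom_comp_tensorHom, Category.id_comp,
      Category.comp_id]
  calc
    _ = (η_ H A ≫ H ◁ Δ[A]) ≫ (iH ⊗ₘ (iA ⊗ₘ iA)) := by
      simp only [Category.assoc, ← id_tensorHom, tensorHom_comp_tensorHom, IsComonHom.hom_comul,
        Category.id_comp, Category.comp_id]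
    _ = η_ (H ⊗ H) (A ⊗ A) ≫ ((iH ⊗ₘ iH) ⊗ₘ (iA ⊗ₘ iA)) ≫ μ[D] ▷ (D ⊗ D) := by
      rw [← e]
      simp only [Category.assoc, ← tensorHom_id, tensorHom_comp_tensorHom, IsMonHom.mul_hom,
        Category.id_comp, Category.comp_id]
    _ = η_ H A ⊗≫ H ◁ η_ H A ▷ A ⊗≫ (iH ⊗ₘ ((iH ⊗ₘ iA) ⊗ₘ iA)) ⊗≫ μ[D] ▷ (D ⊗ D) := by
      rw [ExactPairing.tensor_coevaluation, tensorHom_reassoc]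
      generalize iH ⊗ₘ ((iH ⊗ₘ iA) ⊗ₘ iA) = m
      monoidal
    _ = (η_ H A ⊗≫ H ◁ η_ H A ▷ A ≫ (iH ⊗ₘ ((H ⊗ A) ◁ iA))) ⊗≫ (D ◁ ((iH ⊗ₘ iA) ▷ D)) ⊗≫
        μ[D] ▷ (D ⊗ D) := by
      rw [← e₂]
      generalize iH ⊗ₘ ((H ⊗ A) ◁ iA) = k, iH ⊗ₘ iA = l
      monoidal
    _ = _ := by
      rw [← nested_comp]
      generalize iH ⊗ₘ iA = l
      monoidal

/-- The evaluation is `t` pulled back along the braiding, so this is `ract_conj` transported to `A ⊗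
H`. -/
lemma ract_evalConv_exchange (t : (Conv (H ⊗ A) (𝟙_ C))ˣ) (ht : convHom t.1 = evalPairing H A) :
    ract (evalConv H A) ≫ (β_ A H).hom ≫ exchange t = lact (evalConv H A) := by
  have e : convComap (𝟙_ C) (β_ A H).hom t.1 = evalConv H A := by
    change (β_ A H).hom ≫ convHom t.1 = ε_ H A
    rw [ht, evalPairing, SymmetricCategory.symmetry_assoc]
  rw [exchange, ← e, ← Category.assoc, ← comp_ract, Category.assoc, ← Category.assoc (ract t.1),
    ract_conj, ← Category.assoc, comp_lact, Category.assoc, SymmetricCategory.symmetry,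
    Category.comp_id]

/-- The relation `Δ^cop(h) R = R Δ(h)` before embedding in the double, with the one misordered
product straightened by `exchange`. After bending the first leg, both sides are `lact (evalConv H
A)`. -/
lemma IsDualCop.coevaluation_exchange (h : IsDualCop H A) (t : (Conv (H ⊗ A) (𝟙_ C))ˣ)
    (ht : convHom t.1 = evalPairing H A) :
    ((ρ_ H).inv ≫ (copComul Δ[H] ⊗ₘ η_ H A) ≫ tensorμ H H H A) ≫ (μ[H] ⊗ₘ exchange t) =
      ((λ_ H).inv ≫ (η_ H A ⊗ₘ Δ[H]) ≫ tensorμ H A H H) ≫ (μ[H] ▷ (A ⊗ H)) := by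
  apply ext_coevaluation_left (A := A)
  have e : (ρ_ H).inv ≫ (copComul Δ[H] ⊗ₘ η_ H A) ≫ tensorμ H H H A ≫ (μ[H] ⊗ₘ exchange t) =
      ((ρ_ H).inv ≫ (copComul Δ[H] ⊗ₘ η_ H A) ≫ tensorμ H H H A ≫ μ[H] ▷ (H ⊗ A)) ≫
        H ◁ exchange t := by
    rw [MonoidalCategory.tensorHom_def μ[H]]; simp only [Category.assoc]
  simp only [Category.assoc]
  rw [e]
  have b := h.bend_comul_coev
  generalize (ρ_ H).inv ≫ (copComul Δ[H] ⊗ₘ η_ H A) ≫ tensorμ H H H A ≫ μ[H] ▷ (H ⊗ A) = k at b ⊢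
  calc
    _ = A ◁ k ⊗≫ ((A ⊗ H) ◁ exchange t ≫ ε_ H A ▷ (A ⊗ H)) ⊗≫ 𝟙 (A ⊗ H) := by monoidal
    _ = (A ◁ k ⊗≫ ε_ H A ▷ (H ⊗ A) ⊗≫ 𝟙 (H ⊗ A)) ≫ exchange t := by
      rw [whisker_exchange]; monoidal
    _ = lact (evalConv H A) := by
      rw [b, Category.assoc, ract_evalConv_exchange t ht]
    _ = _ := by
      rw [← h.bend_coev_comul]; monoidal

lemma IsDualCop.exchange_coevaluation (h : IsDualCop H A) (t : (Conv (H ⊗ A) (𝟙_ C))ˣ)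
    (ht : convHom t.1 = evalPairing H A) :
    ((ρ_ A).inv ≫ (copComul Δ[A] ⊗ₘ η_ H A) ≫ tensorμ A A H A) ≫ ((A ⊗ H) ◁ μ[A]) =
      ((λ_ A).inv ≫ (η_ H A ⊗ₘ Δ[A]) ≫ tensorμ H A A A) ≫ (exchange t ⊗ₘ μ[A]) := by
  apply ext_coevaluation_right (H := H)
  have e : (λ_ A).inv ≫ (η_ H A ⊗ₘ Δ[A]) ≫ tensorμ H A A A ≫ (exchange t ⊗ₘ μ[A]) =
      ((λ_ A).inv ≫ (η_ H A ⊗ₘ Δ[A]) ≫ tensorμ H A A A ≫ (H ⊗ A) ◁ μ[A]) ≫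
        exchange t ▷ A := by
    rw [MonoidalCategory.tensorHom_def' (exchange t)]; simp only [Category.assoc]
  simp only [Category.assoc]
  rw [e]
  have b := h.bend_coev_comul'
  generalize (λ_ A).inv ≫ (η_ H A ⊗ₘ Δ[A]) ≫ tensorμ H A A A ≫ (H ⊗ A) ◁ μ[A] = k at b ⊢
  symm
  calc
    _ = k ▷ H ⊗≫ (exchange t ▷ (A ⊗ H) ≫ (A ⊗ H) ◁ ε_ H A) ⊗≫ 𝟙 (A ⊗ H) := by monoidal
    _ = (k ▷ H ⊗≫ (H ⊗ A) ◁ ε_ H A ⊗≫ 𝟙 (H ⊗ A)) ≫ exchange t := by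
      rw [← whisker_exchange]; monoidal
    _ = lact (evalConv H A) := by
      rw [b, Category.assoc, ract_evalConv_exchange t ht]
    _ = _ := by
      rw [← h.bend_comul_coev']; monoidal

lemma IsDualCop.intertwines_left [IsMonHom iH] [IsComonHom iH] (h : IsDualCop H A) (t : (Conv (H ⊗ A) (𝟙_ C))ˣ)
    (ht : convHom t.1 = evalPairing H A)
    (hx : (iH ⊗ₘ iA) ≫ μ[D] = exchange t ≫ (iA ⊗ₘ iH) ≫ μ[D]) :
    Intertwines (η_ H A ≫ (iH ⊗ₘ iA)) (iH ≫ copComul Δ[D]) (iH ≫ Δ[D]) := by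
  have e₁ : iH ≫ copComul Δ[D] = copComul Δ[H] ≫ (iH ⊗ₘ iH) := by
    simp only [copComul, Category.assoc, IsComonHom.hom_comul_assoc,
      BraidedCategory.braiding_naturality]
  have e := h.coevaluation_exchange t ht
  unfold Intertwines
  rw [e₁, IsComonHom.hom_comul]
  simp only [← tensorHom_comp_tensorHom, MonObj.tensorObj.mul_def, Category.assoc,
    tensorμ_natural_assoc]
  rw [tensorHom_comp_tensorHom, tensorHom_comp_tensorHom, ← IsMonHom.mul_hom, hx,
    ← tensorHom_comp_tensorHom]
  simp only [Category.assoc] at e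
  rw [reassoc_of% e, ← tensorHom_id, tensorHom_comp_tensorHom, Category.id_comp]

lemma IsDualCop.intertwines_right [IsMonHom iA] [IsComonHom iA] (h : IsDualCop H A) (t : (Conv (H ⊗ A) (𝟙_ C))ˣ)
    (ht : convHom t.1 = evalPairing H A)
    (hx : (iH ⊗ₘ iA) ≫ μ[D] = exchange t ≫ (iA ⊗ₘ iH) ≫ μ[D]) :
    Intertwines (η_ H A ≫ (iH ⊗ₘ iA)) (iA ≫ copComul Δ[D]) (iA ≫ Δ[D]) := by
  have e₁ : iA ≫ copComul Δ[D] = copComul Δ[A] ≫ (iA ⊗ₘ iA) := by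
    simp only [copComul, Category.assoc, IsComonHom.hom_comul_assoc,
      BraidedCategory.braiding_naturality]
  have e := h.exchange_coevaluation t ht
  have e₂ : (exchange t ≫ (iA ⊗ₘ iH) ≫ μ[D]) ⊗ₘ (μ[A] ≫ iA) =
      (exchange t ⊗ₘ μ[A]) ≫ (((iA ⊗ₘ iH) ≫ μ[D]) ⊗ₘ iA) := by
    rw [tensorHom_comp_tensorHom]
  unfold Intertwines
  rw [e₁, IsComonHom.hom_comul]
  simp only [← tensorHom_comp_tensorHom, MonObj.tensorObj.mul_def, Category.assoc,
    tensorμ_natural_assoc]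
  rw [tensorHom_comp_tensorHom, tensorHom_comp_tensorHom, ← IsMonHom.mul_hom, hx,
    e₂]
  simp only [Category.assoc] at e ⊢
  rw [← reassoc_of% e, ← id_tensorHom, tensorHom_comp_tensorHom, Category.id_comp]

/-- The relation holds on `A` and on `H`, hence on products of the two; the epimorphism hypothesis
says that these determine maps out of `D`. -/
lemma IsDualCop.intertwines [IsMonHom iH] [IsComonHom iH] [IsMonHom iA] [IsComonHom iA]
    (h : IsDualCop H A) (t : (Conv (H ⊗ A) (𝟙_ C))ˣ)
    (ht : convHom t.1 = evalPairing H A)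
    (hx : (iH ⊗ₘ iA) ≫ μ[D] = exchange t ≫ (iA ⊗ₘ iH) ≫ μ[D]) [Epi ((iA ⊗ₘ iH) ≫ μ[D])] :
    Intertwines (η_ H A ≫ (iH ⊗ₘ iA)) (copComul Δ[D]) Δ[D] := by
  have e := (h.intertwines_right iH iA t ht hx).mul (h.intertwines_left iH iA t ht hx)
  apply Intertwines.of_epi ((iA ⊗ₘ iH) ≫ μ[D])
  rw [Category.assoc, Category.assoc, IsMonHom.mul_hom, IsMonHom.mul_hom,
    tensorHom_comp_tensorHom_assoc, tensorHom_comp_tensorHom_assoc]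
  exact e

attribute [local instance] ComonObj.instTensorUnit

lemma IsDualCop.exists_isConvInverse {H A D : C} [ExactPairing H A] [HopfObj H] [BimonObj A]
    [BimonObj D] (iH : H ⟶ D) (iA : A ⟶ D) [IsMonHom iH] [IsMonHom iA] (h : IsDualCop H A) :
    ∃ R', IsConvInverse (η_ H A ≫ (iH ⊗ₘ iA)) R' := by
  -- `R` is the image of the convolution unit `id_H`, so its inverse is the image of the antipode of
  -- `H`.
  let u := Units.map ((convMap (𝟙_ C) (iH ⊗ₘ iA)).comp (h.coevConv H)) (idUnit H)
  have hu : convHom u.1 = η_ H A ≫ (iH ⊗ₘ iA) := by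
    change (η_ H A ≫ 𝟙 H ▷ A) ≫ (iH ⊗ₘ iA) = _
    simp
  rw [← hu]
  exact ⟨convHom (u⁻¹).1, u.mul_inv, u.inv_mul⟩

theorem IsDualCop.isQuasitriangular {H A D : C} [ExactPairing H A] [HopfObj H] [BimonObj A]
    [BimonObj D] (iH : H ⟶ D) (iA : A ⟶ D) [IsMonHom iH] [IsComonHom iH] [IsMonHom iA]
    [IsComonHom iA] (h : IsDualCop H A) (t : (Conv (H ⊗ A) (𝟙_ C))ˣ)
    (ht : convHom t.1 = evalPairing H A)
    (hx : (iH ⊗ₘ iA) ≫ μ[D] = exchange t ≫ (iA ⊗ₘ iH) ≫ μ[D]) [Epi ((iA ⊗ₘ iH) ≫ μ[D])] :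
    IsQuasitriangular D (η_ H A ≫ (iH ⊗ₘ iA)) where
  invertible := h.exists_isConvInverse iH iA
  coassoc := copComul_coassoc D
  counit_left := copComul_counit_left D
  counit_right := copComul_counit_right D
  qt1 := h.qt_left iH iA
  qt2 := h.qt_right iH iA
  qt3 := by
    have e := h.intertwines iH iA t ht hx
    unfold Intertwines at e
    simp only [MonObj.tensorObj.mul_def, tensorμ] at e
    generalize η_ H A ≫ (iH ⊗ₘ iA) = R at *
    calc
      _ = (ρ_ D).inv ≫ (copComul Δ[D] ⊗ₘ R) ≫ _ := by
        generalize copComul Δ[D] ⊗ₘ R = k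
        monoidal
      _ = _ := e
      _ = _ := by
        generalize R ⊗ₘ Δ[D] = k
        monoidal

end RMatrix

/-! ### Convolution inverse of the pairing, and assembly in the symmetric case. -/

section PairingInverse

variable {C : Type u} [Category.{v} C] [MonoidalCategory C] [BraidedCategory C]

/-- A skew pairing turns convolution on the second factor into convolution on the product. -/
def IsSkewPairing.conv {H A : C} [BimonObj H] [BimonObj A] {p : H ⊗ A ⟶ 𝟙_ C}
    (h : IsSkewPairing p) : Conv A A →* Conv (H ⊗ A) (𝟙_ C) where
  toFun f := H ◁ convHom f ≫ p
  map_one' := by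
    change H ◁ (ε[A] ≫ η[A]) ≫ p = ε[H ⊗ A] ≫ 𝟙 _
    have e : H ◁ η[A] ≫ p = (ρ_ H).hom ≫ ε[H] := by rw [← h.one_right, Iso.hom_inv_id_assoc]
    have e' : ε[H ⊗ A] = (ε[H] ⊗ₘ ε[A]) ≫ (λ_ (𝟙_ C)).hom := rfl
    rw [whiskerLeft_comp, Category.assoc, e, e', Category.comp_id, MonoidalCategory.tensorHom_def']
    simp [unitors_equal]
  map_mul' f g := by
    change H ◁ (Δ[A] ≫ convHom f ▷ A ≫ A ◁ convHom g ≫ μ[A]) ≫ p =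
      Δ[H ⊗ A] ≫ (H ◁ convHom f ≫ p) ▷ (H ⊗ A) ≫ (𝟙_ C) ◁ (H ◁ convHom g ≫ p) ≫ (λ_ (𝟙_ C)).hom
    generalize convHom f = f, convHom g = g
    calc
      _ = H ◁ Δ[A] ≫ H ◁ f ▷ A ≫ H ◁ A ◁ g ≫ (H ◁ μ[A] ≫ p) := by simp
      _ = H ◁ Δ[A] ≫ (H ◁ (f ▷ A ≫ A ◁ g) ≫ Δ[H] ▷ (A ⊗ A)) ⊗≫
          H ◁ (β_ H A).hom ▷ A ⊗≫ (p ⊗ₘ p) ⊗≫ 𝟙 (𝟙_ C) := by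
        rw [h.mul_right]; monoidal
      _ = H ◁ Δ[A] ≫ Δ[H] ▷ (A ⊗ A) ⊗≫ H ◁ (H ◁ f ≫ (β_ H A).hom) ▷ A ⊗≫
          (H ⊗ A ⊗ H) ◁ g ⊗≫ (p ⊗ₘ p) ⊗≫ 𝟙 (𝟙_ C) := by
        rw [whisker_exchange]
        calc
          _ = H ◁ Δ[A] ≫ Δ[H] ▷ (A ⊗ A) ⊗≫ H ◁ H ◁ f ▷ A ⊗≫
              H ◁ ((H ⊗ A) ◁ g ≫ (β_ H A).hom ▷ A) ⊗≫ (p ⊗ₘ p) ⊗≫ 𝟙 (𝟙_ C) := by monoidal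
          _ = _ := by rw [whisker_exchange]; monoidal
      _ = (Δ[H] ▷ A ≫ (H ⊗ H) ◁ Δ[A]) ⊗≫ H ◁ (β_ H A).hom ▷ A ⊗≫ H ◁ f ▷ (H ⊗ A) ⊗≫
          ((H ⊗ A) ◁ (H ◁ g) ≫ p ▷ _) ≫ (𝟙_ C) ◁ p ⊗≫ 𝟙 (𝟙_ C) := by
        rw [BraidedCategory.braiding_naturality_right, ← whisker_exchange Δ[H],
          MonoidalCategory.tensorHom_def]; monoidal
      _ = _ := by
        rw [whisker_exchange, Comon.tensorObj_comul, tensorμ, MonoidalCategory.tensorHom_def]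
        monoidal

end PairingInverse

section CoevalMatrix

variable {C : Type u} [Category.{v} C] [MonoidalCategory C]

/-- Identifies `[b]` with the image of the coevaluation under the embeddings, the form in which the
axioms were proved. -/
lemma coevalMatrix_eq {H A : C} [ExactPairing H A] [MonObj H] [MonObj A] : coevalMatrix H A =
    η_ H A ≫ (((λ_ H).inv ≫ η[A] ▷ H) ⊗ₘ ((ρ_ A).inv ≫ A ◁ η[H])) := by
  calc
    _ = 𝟙 _ ⊗≫ (η[A] ▷ 𝟙_ C ≫ A ◁ η_ H A) ⊗≫ (A ⊗ H ⊗ A) ◁ η[H] ⊗≫ 𝟙 _ := by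
      rw [coevalMatrix, MonoidalCategory.tensorHom_def, MonoidalCategory.tensorHom_def]
      monoidal
    _ = _ := by
      rw [← whisker_exchange, MonoidalCategory.tensorHom_def]
      monoidal

end CoevalMatrix

section Main

variable {C : Type u} [Category.{v} C] [MonoidalCategory C] [SymmetricCategory C]

attribute [local instance] ComonObj.instTensorUnit

instance isComonHom_inl (A H : C) [BimonObj H] [ComonObj A] :
    IsComonHom ((ρ_ A).inv ≫ A ◁ η[H]) := by
  have : IsComonHom (ρ_ A).inv := isComonHom_symm_hom (ρ_ A)
  infer_instance

instance isComonHom_inr (A H : C) [ComonObj H] [BimonObj A] :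
    IsComonHom ((λ_ H).inv ≫ η[A] ▷ H) := by
  have : IsComonHom (λ_ H).inv := isComonHom_symm_hom (λ_ H)
  infer_instance

variable {H A : C} [ExactPairing H A]

theorem IsDualCop.isQuasitriangularHopf [HopfObj H] [HopfObj A] (h : IsDualCop H A)
    (t : (Conv (H ⊗ A) (𝟙_ C))ˣ) (ht : convHom t.1 = evalPairing H A) :
    IsQuasitriangularHopf (doubleCrossMul (evalPairing H A) (convHom (t⁻¹).1))
      η[A ⊗ H] Δ[A ⊗ H] ε[A ⊗ H] (coevalMatrix H A) := by
  have hp : IsSkewPairing (convHom t.1) := ht ▸ h.isSkewPairing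
  have hd := hp.isDistributiveLaw
  rw [← ht, doubleCrossMul_eq, coevalMatrix_eq]
  let _ : BimonObj (double H A) := doubleBimon hp
  let iA : A ⟶ double H A := (ρ_ A).inv ≫ A ◁ η[H]
  let iH : H ⟶ double H A := (λ_ H).inv ≫ η[A] ▷ H
  have : IsComonHom iA :=
    { hom_counit := (isComonHom_inl A H).hom_counit
      hom_comul := (isComonHom_inl A H).hom_comul }
  have : IsComonHom iH :=
    { hom_counit := (isComonHom_inr A H).hom_counit
      hom_comul := (isComonHom_inr A H).hom_comul }
  have : IsMonHom iA :=
    { mul_hom := hd.mul_inl.symm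
      one_hom := by
        change η[A] ≫ (ρ_ A).inv ≫ A ◁ η[H] = (λ_ (𝟙_ C)).inv ≫ (η[A] ⊗ₘ η[H])
        rw [MonoidalCategory.tensorHom_def, unitors_inv_equal]; simp }
  have : IsMonHom iH :=
    { mul_hom := hd.mul_inr.symm
      one_hom := by
        change η[H] ≫ (λ_ H).inv ≫ η[A] ▷ H = (λ_ (𝟙_ C)).inv ≫ (η[A] ⊗ₘ η[H])
        rw [MonoidalCategory.tensorHom_def']; simp }
  have e : (iA ⊗ₘ iH) ≫ μ[double H A] = 𝟙 (A ⊗ H) := inl_inr_crossMul hd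
  have e' : (iH ⊗ₘ iA) ≫ μ[double H A] = exchange t := inr_inl_crossMul _
  have hx : (iH ⊗ₘ iA) ≫ μ[double H A] = exchange t ≫ (iA ⊗ₘ iH) ≫ μ[double H A] := by
    rw [e, e']; exact (Category.comp_id _).symm
  have : Epi ((iA ⊗ₘ iH) ≫ μ[double H A]) := by
    rw [e]; exact inferInstanceAs (Epi (𝟙 (A ⊗ H)))
  -- By normal ordering the identity of the double is this product of units; its inverse is the
  -- antipode `a ⊗ h ↦ S(h) S(a)`.
  let w := tensorUnit (Units.map (convMap A iA) (idUnit A)) (Units.map (convMap H iH) (idUnit H))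
  have hw : convHom w.1 = 𝟙 (A ⊗ H) := by
    rw [convHom_tensorUnit]
    change ((𝟙 A ≫ iA) ⊗ₘ (𝟙 H ≫ iH)) ≫ _ = _
    rw [Category.id_comp, Category.id_comp, e]
  let K : HopfObj (double H A) :=
    { hopfOfUnit (D := double H A) w hw with toBimonObj := doubleBimon hp }
  refine ⟨K, rfl, rfl, rfl, rfl, ?_⟩
  exact h.isQuasitriangular iH iA t ht hx

theorem IsDualCop.main [HopfObj H] [HopfObj A] (h : IsDualCop H A) :
    IsDualOp H A ∧ IsSkewPairing (evalPairing H A) ∧ IsSymmetricPairing (evalPairing H A) ∧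
      ∃ τ' : H ⊗ A ⟶ 𝟙_ C, IsConvInverse (evalPairing H A) τ' ∧
        IsQuasitriangularHopf (doubleCrossMul (evalPairing H A) τ') η[A ⊗ H] Δ[A ⊗ H] ε[A ⊗ H]
          (coevalMatrix H A) := by
  -- The inverse of `τ` obtained in this way is `τ(id ⊗ S_A)`.
  let t := Units.map h.isSkewPairing.conv (idUnit A)
  have ht : convHom t.1 = evalPairing H A := by
    change H ◁ 𝟙 A ≫ _ = _
    simp
  refine ⟨h.isDualOp, h.isSkewPairing, isSymmetricPairing_evalPairing, convHom (t⁻¹).1, ?_,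
    h.isQuasitriangularHopf t ht⟩
  rw [← ht]
  exact ⟨t.mul_inv, t.inv_mul⟩

end Main

/-! ### Hopf structures on duals and co-opposites. -/

section DualHopf

variable {C : Type u} [Category.{v} C] [MonoidalCategory C] [SymmetricCategory C]

lemma isMate_tensorμ {X X' Y Y' Z Z' W W' : C} [ExactPairing X X'] [ExactPairing Y Y']
    [ExactPairing Z Z'] [ExactPairing W W'] :
    IsMate (tensorμ X Y Z W) (tensorμ W' Y' Z' X') := by
  have h := (isMate_associator (U := X) (U' := X') (V := Y) (V' := Y') (W := Z ⊗ W)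
    (W' := W' ⊗ Z')).comp <| (isMate_associator_inv.whiskerLeft (W := X) (W' := X')).comp <|
    ((isMate_braiding (U := Y) (U' := Y') (V := Z) (V' := Z')).whiskerRight (W := W)
      (W' := W')).whiskerLeft.comp <| isMate_associator.whiskerLeft.comp isMate_associator_inv
  have e : tensorμ W' Y' Z' X' = 𝟙 _ ⊗≫ (W' ◁ (β_ Y' Z').hom) ▷ X' ⊗≫ 𝟙 _ := by
    rw [tensorμ]; monoidal
  rw [e]
  convert h using 1
  · rw [tensorμ]
  · monoidal

variable {H A : C} [ExactPairing H A] [HopfObj H]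

/-- A dual of a Hopf monoid is a Hopf monoid, for the nested pairing of tensor squares. -/
@[reducible]
def hopfOfMates {m : A ⊗ A ⟶ A} {e : 𝟙_ C ⟶ A} {d : A ⟶ A ⊗ A} {c : A ⟶ 𝟙_ C} {s : A ⟶ A}
    (hm : IsMate Δ[H] m) (he : IsMate ε[H] e) (hd : IsMate μ[H] d) (hc : IsMate η[H] c)
    (hs : IsMate (HopfObj.antipode (X := H)) s) : HopfObj A where
  one := e
  mul := m
  counit := c
  comul := d
  antipode := s
  -- Nested duality reverses tensor factors, so each left-handed axiom of `A` is the transpose of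
  -- the right-handed dual axiom of `H`, and conversely.
  one_mul := by
    have h := hm.comp (he.whiskerLeft (W := H) (W' := A))
    rw [ComonObj.comul_counit] at h
    exact h.unique isMate_rightUnitor_inv
  mul_one := by
    have h := hm.comp (he.whiskerRight (W := H) (W' := A))
    rw [ComonObj.counit_comul] at h
    exact h.unique isMate_leftUnitor_inv
  mul_assoc := by
    have h₁ := hm.comp (hm.whiskerLeft (W := H) (W' := A))
    have h₂ := (hm.comp (hm.whiskerRight (W := H) (W' := A))).comp isMate_associator
    rw [Category.assoc, ← ComonObj.comul_assoc] at h₂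
    exact h₁.unique h₂
  counit_comul := by
    have h := (hc.whiskerLeft (W := H) (W' := A)).comp hd
    rw [MonObj.mul_one] at h
    exact h.unique isMate_rightUnitor
  comul_counit := by
    have h := (hc.whiskerRight (W := H) (W' := A)).comp hd
    rw [MonObj.one_mul] at h
    exact h.unique isMate_leftUnitor
  comul_assoc := by
    have h₁ := (isMate_associator_inv.comp (hd.whiskerRight (W := H) (W' := A))).comp hd
    have h₂ := (hd.whiskerLeft (W := H) (W' := A)).comp hd
    rw [Category.assoc, MonObj.mul_assoc, Iso.inv_hom_id_assoc] at h₁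
    rw [← reassoc_of% h₁.unique h₂, Iso.inv_hom_id, Category.comp_id]
  mul_comul := by
    have h₁ := hd.comp hm
    have h₂ := ((hm.tensor hm).comp isMate_tensorμ).comp (hd.tensor hd)
    rw [Category.assoc, ← BimonObj.mul_comul] at h₂
    exact h₁.unique h₂
  one_comul := by
    have h₁ := hd.comp he
    have h₂ := (he.tensor he).comp (isMate_leftUnitor (U := 𝟙_ C) (U' := 𝟙_ C))
    rw [BimonObj.mul_counit] at h₁
    rw [h₁.unique h₂, ← unitors_inv_equal]
    rfl
  mul_counit := by
    have h₁ := hc.comp hm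
    have h₂ := (isMate_leftUnitor_inv (U := 𝟙_ C) (U' := 𝟙_ C)).comp (hc.tensor hc)
    rw [BimonObj.one_comul] at h₁
    rw [h₁.unique h₂, ← unitors_equal]
    rfl
  one_counit := by
    have h := hc.comp he
    rw [BimonObj.one_counit] at h
    exact h.unique isMate_id
  antipode_left := by
    have h := (hm.comp (hs.whiskerLeft (W := H) (W' := A))).comp hd
    rw [Category.assoc, HopfObj.antipode_right] at h
    exact h.unique (he.comp hc)
  antipode_right := by
    have h := (hm.comp (hs.whiskerRight (W := H) (W' := A))).comp hd
    rw [Category.assoc, HopfObj.antipode_left] at h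
    exact h.unique (he.comp hc)

variable (H A) in
/-- The dual of a Hopf monoid, for the nested pairing of tensor squares. -/
@[reducible]
def dualHopf : HopfObj A :=
  hopfOfMates (isMate_transpose Δ[H]) (isMate_transpose ε[H]) (isMate_transpose μ[H])
    (isMate_transpose η[H]) (isMate_transpose (HopfObj.antipode (X := H)))

end DualHopf

section CopHopf

variable {C : Type u} [Category.{v} C] [MonoidalCategory C] [SymmetricCategory C]

/-- The co-opposite of a Hopf monoid with invertible antipode. -/
@[reducible]
noncomputable def copHopf (H : C) [HopfObj H] [IsIso (HopfObj.antipode (X := H))] : HopfObj H where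
  one := η[H]
  mul := μ[H]
  one_mul := MonObj.one_mul H
  mul_one := MonObj.mul_one H
  mul_assoc := MonObj.mul_assoc H
  counit := ε[H]
  comul := copComul Δ[H]
  counit_comul := copComul_counit_left H
  comul_counit := copComul_counit_right H
  comul_assoc := copComul_coassoc H
  mul_comul := by
    rw [IsMonHom.mul_hom (copComul Δ[H]), MonObj.tensorObj.mul_def]
  one_comul := IsMonHom.one_hom (copComul Δ[H])
  mul_counit := BimonObj.mul_counit H
  one_counit := BimonObj.one_counit H
  antipode := inv (HopfObj.antipode (X := H))
  antipode_left := by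
    -- Applying the invertible antipode, which reverses products, turns the claim for its inverse
    -- into the antipode axiom of `H`.
    rw [← cancel_mono (HopfObj.antipode (X := H))]
    have e : μ[H] ≫ HopfObj.antipode (X := H) = _ := HopfObj.mul_antipode H
    rw [copComul]
    simp only [Category.assoc]
    rw [e, ← tensorHom_id, tensorHom_comp_tensorHom_assoc, IsIso.inv_hom_id, Category.id_comp,
      BraidedCategory.braiding_naturality_assoc, SymmetricCategory.symmetry_assoc, tensorHom_id,
      HopfObj.antipode_left, HopfObj.one_antipode]
  antipode_right := by
    rw [← cancel_mono (HopfObj.antipode (X := H))]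
    have e : μ[H] ≫ HopfObj.antipode (X := H) = _ := HopfObj.mul_antipode H
    rw [copComul]
    simp only [Category.assoc]
    rw [e, ← id_tensorHom, tensorHom_comp_tensorHom_assoc, IsIso.inv_hom_id, Category.id_comp,
      BraidedCategory.braiding_naturality_assoc, SymmetricCategory.symmetry_assoc, id_tensorHom,
      HopfObj.antipode_right, HopfObj.one_antipode]

/-- The dual of the co-opposite of a Hopf monoid with invertible antipode. -/
@[reducible]
noncomputable def dualCopHopf (H A : C) [HopfObj H] [IsIso (HopfObj.antipode (X := H))]
    [ExactPairing H A] : HopfObj A :=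
  @dualHopf C _ _ _ H A _ (copHopf H)

lemma isDualCop_dualCopHopf (H A : C) [HopfObj H] [IsIso (HopfObj.antipode (X := H))]
    [ExactPairing H A] : letI := dualCopHopf H A; IsDualCop H A :=
  letI := dualCopHopf H A
  { mul := isMate_transpose (copComul Δ[H])
    one := isMate_transpose ε[H]
    comul := isMate_transpose μ[H]
    counit := isMate_transpose η[H] }

end CopHopf

/-! ### The fundamental theorem of Hopf modules. -/

section HopfModules

variable {C : Type u} [Category.{v} C] [MonoidalCategory C] [BraidedCategory C]

/-- Left Hopf modules over a bimonoid. -/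
structure IsHopfModule {H M : C} [BimonObj H] (a : H ⊗ M ⟶ M) (r : M ⟶ H ⊗ M) : Prop where
  act_mul : μ[H] ▷ M ≫ a = (α_ H H M).hom ≫ H ◁ a ≫ a
  act_one : η[H] ▷ M ≫ a = (λ_ M).hom
  coact_comul : r ≫ H ◁ r = r ≫ Δ[H] ▷ M ≫ (α_ H H M).hom
  coact_counit : r ≫ ε[H] ▷ M = (λ_ M).inv
  compat : a ≫ r = (Δ[H] ⊗ₘ r) ≫ tensorμ H H H M ≫ (μ[H] ⊗ₘ a)

variable {H M : C} [HopfObj H] {a : H ⊗ M ⟶ M} {r : M ⟶ H ⊗ M}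

/-- The projection of a Hopf module to its coinvariants. -/
def coinvProj (a : H ⊗ M ⟶ M) (r : M ⟶ H ⊗ M) : M ⟶ M :=
  r ≫ HopfObj.antipode (X := H) ▷ M ≫ a

/-- With `E(m) = S(m₋₁) m₀`, the expression `m₋₁ E(m₀)` collapses to `m` by coassociativity and the
antipode axiom. -/
lemma IsHopfModule.decompose_act (h : IsHopfModule a r) :
    r ≫ H ◁ coinvProj a r ≫ a = 𝟙 M := by
  calc
    _ = (r ≫ H ◁ r) ≫ H ◁ HopfObj.antipode (X := H) ▷ M ≫ (H ◁ a ≫ a) := by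
      simp [coinvProj]
    _ = r ≫ (Δ[H] ≫ H ◁ HopfObj.antipode (X := H) ≫ μ[H]) ▷ M ≫ a := by
      have e : H ◁ a ≫ a = (α_ H H M).inv ≫ μ[H] ▷ M ≫ a := by
        rw [h.act_mul, Iso.inv_hom_id_assoc]
      rw [h.coact_comul, e]; monoidal
    _ = (r ≫ ε[H] ▷ M) ≫ η[H] ▷ M ≫ a := by
      rw [HopfObj.antipode_right, comp_whiskerRight, Category.assoc, Category.assoc]
    _ = _ := by
      rw [h.coact_counit, h.act_one, Iso.inv_hom_id]

/-- As `S` reverses the coproduct, the diagonal action of `S(h₁)` on `h₂ ⊗ m` is `S(h₂) h₃ ⊗ S(h₁) m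
= 1 ⊗ S(h) m`. -/
lemma antipode_diagonal_act (a : H ⊗ M ⟶ M) :
    (Δ[H] ▷ M ≫ (α_ H H M).hom) ≫ ((HopfObj.antipode (X := H) ≫ Δ[H]) ▷ (H ⊗ M)) ≫
      tensorμ H H H M ≫ (μ[H] ⊗ₘ a) =
    HopfObj.antipode (X := H) ▷ M ≫ a ≫ (λ_ M).inv ≫ η[H] ▷ M := by
  set S := HopfObj.antipode (X := H)
  have hl : S ≫ Δ[H] = Δ[H] ≫ (β_ H H).hom ≫ (S ⊗ₘ S) := HopfObj.antipode_comul H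
  have hc : Δ[H] ≫ Δ[H] ▷ H = Δ[H] ≫ H ◁ Δ[H] ≫ (α_ H H H).inv := by
    rw [ComonObj.comul_assoc_assoc, Iso.hom_inv_id, Category.comp_id]
  have hh : Δ[H] ≫ S ▷ H ≫ μ[H] = ε[H] ≫ η[H] := HopfObj.antipode_left H
  have hb : H ◁ (ε[H] ≫ η[H]) ≫ (β_ H H).hom = H ◁ ε[H] ≫ (ρ_ H).hom ≫ (λ_ H).inv ≫
      η[H] ▷ H := by
    rw [whiskerLeft_comp, Category.assoc, BraidedCategory.braiding_naturality_right,
      braiding_tensorUnit_right, Category.assoc]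
  rw [hl, tensorμ]
  calc
    _ = (Δ[H] ≫ Δ[H] ▷ H) ▷ M ⊗≫ (𝟙 ((H ⊗ H) ⊗ H) ⊗≫ (β_ H H).hom ▷ H ⊗≫
        (S ▷ (H ⊗ H) ≫ H ◁ (S ▷ H ≫ (β_ H H).hom)) ⊗≫ μ[H] ▷ H) ▷ M ⊗≫ H ◁ a := by
      simp only [MonoidalCategory.tensorHom_def]; monoidal
    _ = (Δ[H] ≫ Δ[H] ▷ H) ▷ M ⊗≫ (𝟙 ((H ⊗ H) ⊗ H) ⊗≫ (β_ H (H ⊗ H)).hom ⊗≫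
        ((H ⊗ H) ◁ S ≫ (S ▷ H ≫ μ[H]) ▷ H)) ▷ M ⊗≫ H ◁ a := by
      rw [BraidedCategory.braiding_naturality_left, ← whisker_exchange,
        BraidedCategory.braiding_tensor_right_hom]
      monoidal
    _ = Δ[H] ▷ M ⊗≫ (H ◁ (Δ[H] ≫ S ▷ H ≫ μ[H]) ≫ (β_ H H).hom) ▷ M ⊗≫ H ◁ (S ▷ M ≫ a) := by
      rw [hc, whisker_exchange, BraidedCategory.braiding_naturality_right]
      simp only [comp_whiskerRight Δ[H]]
      rw [comp_whiskerRight, ← BraidedCategory.braiding_naturality_right_assoc]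
      monoidal
    _ = (Δ[H] ≫ H ◁ ε[H]) ▷ M ⊗≫ (η[H] ▷ (H ⊗ M) ≫ H ◁ (S ▷ M ≫ a)) := by
      rw [hh, hb]; monoidal
    _ = _ := by
      rw [ComonObj.comul_counit, ← whisker_exchange]; monoidal

/-- This is coinvariance of `E(m)`: the coaction of `S(m₋₁) m₀` is the diagonal action just
computed. -/
lemma IsHopfModule.coinvProj_coact (h : IsHopfModule a r) :
    coinvProj a r ≫ r = coinvProj a r ≫ (λ_ M).inv ≫ η[H] ▷ M := by
  calc
    _ = r ≫ HopfObj.antipode (X := H) ▷ M ≫ (Δ[H] ▷ M ≫ _ ◁ r) ≫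
        tensorμ H H H M ≫ (μ[H] ⊗ₘ a) := by
      rw [coinvProj, Category.assoc, Category.assoc, h.compat, MonoidalCategory.tensorHom_def]
    _ = (r ≫ H ◁ r) ≫ ((HopfObj.antipode (X := H) ≫ Δ[H]) ▷ (H ⊗ M)) ≫
      tensorμ H H H M ≫ (μ[H] ⊗ₘ a) := by
      rw [← whisker_exchange Δ[H], Category.assoc, Category.assoc, ← whisker_exchange_assoc]
      simp
    _ = r ≫ (Δ[H] ▷ M ≫ (α_ H H M).hom) ≫ ((HopfObj.antipode (X := H) ≫ Δ[H]) ▷ (H ⊗ M)) ≫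
      tensorμ H H H M ≫ (μ[H] ⊗ₘ a) := by
      rw [h.coact_comul]; simp only [Category.assoc]
    _ = _ := by
      rw [antipode_diagonal_act a, coinvProj]; simp only [Category.assoc]

lemma IsHopfModule.act_coact_coinvProj (h : IsHopfModule a r) :
    H ◁ coinvProj a r ≫ a ≫ r =
      H ◁ coinvProj a r ≫ Δ[H] ▷ M ≫ (α_ H H M).hom ≫ H ◁ a := by
  have hn : H ◁ η[H] ≫ (β_ H H).hom = (ρ_ H).hom ≫ (λ_ H).inv ≫ η[H] ▷ H := by
    rw [BraidedCategory.braiding_naturality_right, braiding_tensorUnit_right, Category.assoc]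
  calc
    _ = H ◁ (coinvProj a r ≫ r) ≫ Δ[H] ▷ (H ⊗ M) ≫ tensorμ H H H M ≫ (μ[H] ⊗ₘ a) := by
      rw [h.compat, MonoidalCategory.tensorHom_def', whiskerLeft_comp]; simp only [Category.assoc]
    _ = H ◁ coinvProj a r ⊗≫ (H ◁ η[H] ≫ Δ[H] ▷ H) ▷ M ⊗≫ H ◁ (β_ H H).hom ▷ M ⊗≫
        (μ[H] ⊗ₘ a) := by
      rw [h.coinvProj_coact, tensorμ]; monoidal
    _ = H ◁ coinvProj a r ⊗≫ Δ[H] ▷ M ⊗≫ H ◁ (H ◁ η[H] ≫ (β_ H H).hom) ▷ M ⊗≫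
        (μ[H] ⊗ₘ a) := by
      rw [whisker_exchange]; monoidal
    _ = H ◁ coinvProj a r ⊗≫ Δ[H] ▷ M ⊗≫ (H ◁ η[H] ≫ μ[H]) ▷ (H ⊗ M) ⊗≫ H ◁ a := by
      rw [hn, MonoidalCategory.tensorHom_def]; monoidal
    _ = _ := by
      rw [MonObj.mul_one]; monoidal

lemma IsHopfModule.act_coinvProj (h : IsHopfModule a r) :
    H ◁ coinvProj a r ≫ a ≫ coinvProj a r = H ◁ coinvProj a r ≫ ε[H] ▷ M ≫ (λ_ M).hom := by
  have e := h.act_coact_coinvProj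
  calc
    _ = (H ◁ coinvProj a r ≫ a ≫ r) ≫ HopfObj.antipode (X := H) ▷ M ≫ a := by
      conv_lhs => arg 2; arg 2; rw [coinvProj]
      simp only [Category.assoc]
    _ = H ◁ coinvProj a r ≫ Δ[H] ▷ M ≫ (α_ H H M).hom ≫
        (H ◁ a ≫ HopfObj.antipode (X := H) ▷ M) ≫ a := by
      rw [e]; simp only [Category.assoc]
    _ = H ◁ coinvProj a r ⊗≫ (Δ[H] ≫ HopfObj.antipode (X := H) ▷ H) ▷ M ≫
        ((α_ H H M).hom ≫ H ◁ a ≫ a) := by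
      rw [whisker_exchange]; monoidal
    _ = H ◁ coinvProj a r ≫ (Δ[H] ≫ HopfObj.antipode (X := H) ▷ H ≫ μ[H]) ▷ M ≫ a := by
      rw [← h.act_mul]; monoidal
    _ = _ := by
      rw [HopfObj.antipode_left, comp_whiskerRight, Category.assoc, h.act_one]

/-- Uses `E(h E(m)) = ε(h) E(m)`. Together with `decompose_act` it expresses that `M` is `H`
tensored with its coinvariants, without requiring the idempotent `E` to split. -/
lemma IsHopfModule.act_decompose (h : IsHopfModule a r) :
    H ◁ coinvProj a r ≫ a ≫ r ≫ H ◁ coinvProj a r = H ◁ coinvProj a r := by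
  have e := h.act_coact_coinvProj
  calc
    _ = (H ◁ coinvProj a r ≫ a ≫ r) ≫ H ◁ coinvProj a r := by simp only [Category.assoc]
    _ = (H ◁ coinvProj a r ≫ Δ[H] ▷ M) ≫ (α_ H H M).hom ≫ H ◁ (a ≫ coinvProj a r) := by
      rw [e]; simp only [Category.assoc, whiskerLeft_comp]
    _ = Δ[H] ▷ M ≫ (α_ H H M).hom ≫ H ◁ (H ◁ coinvProj a r ≫ a ≫ coinvProj a r) := by
      rw [whisker_exchange]; simp
    _ = Δ[H] ▷ M ≫ ((H ⊗ H) ◁ coinvProj a r ≫ (H ◁ ε[H]) ▷ M) ⊗≫ 𝟙 _ := by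
      rw [h.act_coinvProj]; monoidal
    _ = (Δ[H] ≫ H ◁ ε[H]) ▷ M ⊗≫ H ◁ coinvProj a r := by
      rw [whisker_exchange]; monoidal
    _ = _ := by
      rw [ComonObj.comul_counit]; monoidal

end HopfModules

/-! ### The dual as a Hopf module, and invertibility of the antipode. -/

section DualModule

variable {C : Type u} [Category.{v} C] [MonoidalCategory C]

section

variable (H A : C) [ExactPairing H A]

/-- The transpose of a pairing. -/
def curry {Z : C} (g : Z ⊗ H ⟶ 𝟙_ C) : Z ⟶ A :=
  𝟙 Z ⊗≫ Z ◁ η_ H A ⊗≫ g ▷ A ⊗≫ 𝟙 A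

lemma curry_evaluation {Z : C} (g : Z ⊗ H ⟶ 𝟙_ C) : curry H A g ▷ H ≫ ε_ H A = g := by
  calc
    _ = 𝟙 _ ⊗≫ Z ◁ η_ H A ▷ H ⊗≫ (g ▷ (A ⊗ H) ≫ (𝟙_ C) ◁ ε_ H A) ⊗≫ 𝟙 _ := by
      rw [curry]; monoidal
    _ = 𝟙 _ ⊗≫ Z ◁ (η_ H A ▷ H ⊗≫ H ◁ ε_ H A) ⊗≫ g := by
      rw [← whisker_exchange]; monoidal
    _ = _ := by
      rw [ExactPairing.evaluation_coevaluation'']; monoidal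

/-- The regular right action `(f k)(x) = f(k x)` on the dual. -/
def dualTrans [MonObj H] : A ⊗ H ⟶ A := curry H A ((α_ A H H).hom ≫ A ◁ μ[H] ≫ ε_ H A)

lemma dualTrans_evaluation [MonObj H] : dualTrans H A ▷ H ≫ ε_ H A =
    (α_ A H H).hom ≫ A ◁ μ[H] ≫ ε_ H A :=
  curry_evaluation H A _

lemma dualTrans_mul [MonObj H] : dualTrans H A ▷ H ≫ dualTrans H A =
    (α_ A H H).hom ≫ A ◁ μ[H] ≫ dualTrans H A := by
  have e := dualTrans_evaluation H A
  apply ext_evaluation (U := H)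
  calc
    _ = (dualTrans H A ▷ H) ▷ H ≫ dualTrans H A ▷ H ≫ ε_ H A := by simp
    _ = 𝟙 _ ⊗≫ (dualTrans H A ▷ (H ⊗ H) ≫ A ◁ μ[H]) ≫ ε_ H A := by
      rw [e]; monoidal
    _ = 𝟙 _ ⊗≫ (A ⊗ H) ◁ μ[H] ≫ dualTrans H A ▷ H ≫ ε_ H A := by
      rw [← whisker_exchange]; monoidal
    _ = 𝟙 _ ⊗≫ A ◁ ((α_ H H H).hom ≫ H ◁ μ[H] ≫ μ[H]) ≫ ε_ H A := by
      rw [e]; monoidal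
    _ = ((α_ A H H).hom ≫ A ◁ μ[H]) ▷ H ≫ (α_ A H H).hom ≫ A ◁ μ[H] ≫ ε_ H A := by
      rw [← MonObj.mul_assoc]; monoidal
    _ = _ := by
      rw [← e]; simp

lemma dualTrans_one [MonObj H] : A ◁ η[H] ≫ dualTrans H A = (ρ_ A).hom := by
  apply ext_evaluation (U := H)
  calc
    _ = (A ◁ η[H]) ▷ H ≫ dualTrans H A ▷ H ≫ ε_ H A := by simp
    _ = 𝟙 _ ⊗≫ A ◁ (η[H] ▷ H ≫ μ[H]) ≫ ε_ H A := by
      rw [dualTrans_evaluation]; monoidal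
    _ = _ := by
      rw [MonObj.one_mul]; monoidal

/-- The regular coaction `f ↦ f₋₁ ⊗ f₀` on the dual, where `f₋₁ f₀(x) = f(x₁) x₂`. -/
def dualCoact [ComonObj H] : A ⟶ H ⊗ A :=
  𝟙 A ⊗≫ A ◁ η_ H A ⊗≫ A ◁ Δ[H] ▷ A ⊗≫ ε_ H A ▷ (H ⊗ A) ⊗≫ 𝟙 (H ⊗ A)

lemma dualCoact_evaluation [ComonObj H] : dualCoact H A ▷ H ⊗≫ H ◁ ε_ H A ⊗≫ 𝟙 H =
    A ◁ Δ[H] ⊗≫ ε_ H A ▷ H ⊗≫ 𝟙 H := by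
  calc
    _ = 𝟙 _ ⊗≫ A ◁ η_ H A ▷ H ⊗≫ A ◁ Δ[H] ▷ (A ⊗ H) ⊗≫
        (ε_ H A ▷ (H ⊗ (A ⊗ H)) ≫ (𝟙_ C) ◁ (H ◁ ε_ H A)) ⊗≫ 𝟙 H := by
      rw [dualCoact]; monoidal
    _ = 𝟙 _ ⊗≫ A ◁ η_ H A ▷ H ⊗≫ A ◁ (Δ[H] ▷ (A ⊗ H) ≫ (H ⊗ H) ◁ ε_ H A) ⊗≫
        ε_ H A ▷ H ⊗≫ 𝟙 H := by
      rw [← whisker_exchange]; monoidal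
    _ = 𝟙 _ ⊗≫ A ◁ (η_ H A ▷ H ⊗≫ H ◁ ε_ H A) ⊗≫ A ◁ Δ[H] ⊗≫ ε_ H A ▷ H ⊗≫ 𝟙 H := by
      rw [← whisker_exchange]; monoidal
    _ = _ := by
      rw [ExactPairing.evaluation_coevaluation'']; monoidal

lemma dualCoact_comul [ComonObj H] : dualCoact H A ≫ H ◁ dualCoact H A =
    dualCoact H A ≫ Δ[H] ▷ A ≫ (α_ H H A).hom := by
  have e := dualCoact_evaluation H A
  rw [← cancel_mono (α_ H H A).inv]
  apply ext_coevaluation_right (H := H)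
  calc
    _ = dualCoact H A ▷ H ⊗≫ H ◁ (dualCoact H A ▷ H ⊗≫ H ◁ ε_ H A ⊗≫ 𝟙 H) ⊗≫ 𝟙 (H ⊗ H) := by
      monoidal
    _ = 𝟙 _ ⊗≫ (dualCoact H A ▷ H ≫ (H ⊗ A) ◁ Δ[H]) ⊗≫ H ◁ ε_ H A ▷ H ⊗≫ 𝟙 (H ⊗ H) := by
      rw [e]; monoidal
    _ = 𝟙 _ ⊗≫ A ◁ Δ[H] ⊗≫ (dualCoact H A ▷ H ⊗≫ H ◁ ε_ H A ⊗≫ 𝟙 H) ▷ H ⊗≫ 𝟙 (H ⊗ H) := by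
      rw [← whisker_exchange]; monoidal
    _ = 𝟙 _ ⊗≫ A ◁ (Δ[H] ≫ Δ[H] ▷ H ≫ (α_ H H H).hom) ⊗≫ ε_ H A ▷ (H ⊗ H) ⊗≫ 𝟙 (H ⊗ H) := by
      rw [e]; monoidal
    _ = 𝟙 _ ⊗≫ A ◁ Δ[H] ⊗≫ ((A ⊗ H) ◁ Δ[H] ≫ ε_ H A ▷ (H ⊗ H)) ⊗≫ 𝟙 (H ⊗ H) := by
      rw [← ComonObj.comul_assoc]; monoidal
    _ = (A ◁ Δ[H] ⊗≫ ε_ H A ▷ H ⊗≫ 𝟙 H) ≫ Δ[H] := by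
      rw [whisker_exchange]; monoidal
    _ = dualCoact H A ▷ H ⊗≫ (H ◁ ε_ H A ≫ Δ[H] ▷ (𝟙_ C)) ⊗≫ 𝟙 (H ⊗ H) := by
      rw [← e]; monoidal
    _ = _ := by
      rw [whisker_exchange]; monoidal

lemma dualCoact_counit [ComonObj H] : dualCoact H A ≫ ε[H] ▷ A = (λ_ A).inv := by
  apply ext_coevaluation_right (H := H)
  calc
    _ = dualCoact H A ▷ H ⊗≫ (ε[H] ▷ (A ⊗ H) ≫ (𝟙_ C) ◁ ε_ H A) ⊗≫ 𝟙 (𝟙_ C) := by monoidal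
    _ = (dualCoact H A ▷ H ⊗≫ H ◁ ε_ H A ⊗≫ 𝟙 H) ≫ ε[H] := by
      rw [← whisker_exchange]; monoidal
    _ = 𝟙 _ ⊗≫ A ◁ Δ[H] ⊗≫ (ε_ H A ▷ H ≫ _ ◁ ε[H]) ⊗≫ 𝟙 (𝟙_ C) := by
      rw [dualCoact_evaluation]; monoidal
    _ = 𝟙 _ ⊗≫ A ◁ (Δ[H] ≫ H ◁ ε[H]) ⊗≫ ε_ H A ⊗≫ 𝟙 (𝟙_ C) := by
      rw [← whisker_exchange]; monoidal
    _ = _ := by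
      rw [ComonObj.comul_counit]; monoidal

end

end DualModule

section DualHopfModule

variable {C : Type u} [Category.{v} C] [MonoidalCategory C] [SymmetricCategory C]
  (H A : C) [ExactPairing H A]

/-- The action `(k f)(x) = f(k x)` of the opposite of a monoid on its dual. -/
def dualActOp [MonObj H] : H ⊗ A ⟶ A := (β_ H A).hom ≫ dualTrans H A

lemma dualActOp_evaluation [MonObj H] : dualActOp H A ▷ H ≫ ε_ H A =
    (β_ H A).hom ▷ H ⊗≫ A ◁ μ[H] ⊗≫ ε_ H A := by
  rw [dualActOp, comp_whiskerRight, Category.assoc, dualTrans_evaluation]; monoidal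

lemma dualActOp_mul [MonObj H] : ((β_ H H).hom ≫ μ[H]) ▷ A ≫ dualActOp H A =
    (α_ H H A).hom ≫ H ◁ dualActOp H A ≫ dualActOp H A := by
  calc
    _ = (β_ H H).hom ▷ A ≫ (β_ (H ⊗ H) A).hom ≫ A ◁ μ[H] ≫ dualTrans H A := by
      rw [dualActOp, comp_whiskerRight, Category.assoc,
        BraidedCategory.braiding_naturality_left_assoc]
    _ = (β_ H H).hom ▷ A ≫ (β_ (H ⊗ H) A).hom ≫ (α_ A H H).inv ≫ dualTrans H A ▷ H ≫
        dualTrans H A := by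
      rw [dualTrans_mul, Iso.inv_hom_id_assoc]
    _ = (α_ H H A).hom ≫ H ◁ (β_ H A).hom ≫ (β_ H (A ⊗ H)).hom ≫ dualTrans H A ▷ H ≫
        dualTrans H A := by
      rw [BraidedCategory.braiding_naturality_left_assoc,
        BraidedCategory.braiding_tensor_right_hom, BraidedCategory.braiding_tensor_left_hom]
      monoidal
    _ = _ := by
      rw [dualActOp, whiskerLeft_comp, Category.assoc,
        ← BraidedCategory.braiding_naturality_right_assoc]

lemma dualActOp_one [MonObj H] : η[H] ▷ A ≫ dualActOp H A = (λ_ A).hom := by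
  rw [dualActOp, BraidedCategory.braiding_naturality_left_assoc, dualTrans_one,
    braiding_tensorUnit_left, Category.assoc, Iso.inv_hom_id, Category.comp_id]

/-- Compatibility of action and coaction before the antipode is inserted: `f₋₁ ⊗ h f₀ = h₂ (h₁ f)₋₁
⊗ (h₁ f)₀`. -/
lemma dualActOp_coact [BimonObj H] :
    H ◁ dualCoact H A ⊗≫ (β_ H H).hom ▷ A ⊗≫ H ◁ dualActOp H A =
      copComul Δ[H] ▷ A ⊗≫ H ◁ (dualActOp H A ≫ dualCoact H A) ⊗≫ μ[H] ▷ A := by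
  have e := dualCoact_evaluation H A
  have e' := dualActOp_evaluation H A
  apply ext_coevaluation_right (H := H)
  have hb : H ◁ (A ◁ μ[H] ≫ ε_ H A) = (β_ H (A ⊗ H ⊗ H)).hom ≫
      (A ◁ μ[H] ≫ ε_ H A) ▷ H ≫ (λ_ H).hom ≫ (ρ_ H).inv := by
    rw [← BraidedCategory.braiding_naturality_right_assoc, braiding_tensorUnit_right]; simp
  have hp : (β_ H H).hom ▷ A ≫ (β_ (H ⊗ H) A).hom ≫ A ◁ (β_ H H).hom = (β_ (H ⊗ H) A).hom := by
    rw [BraidedCategory.braiding_naturality_left_assoc, ← whiskerLeft_comp,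
      SymmetricCategory.symmetry, whiskerLeft_id, Category.comp_id]
  -- Evaluated at `x`, both sides equal `f((hx)₁) (hx)₂`; the second uses multiplicativity of the
  -- coproduct.
  refine Eq.trans (b := (β_ H A).hom ▷ H ⊗≫ A ◁ (μ[H] ≫ Δ[H]) ⊗≫ ε_ H A ▷ H ⊗≫ 𝟙 H) ?_ ?_
  · calc
      _ = 𝟙 _ ⊗≫ H ◁ dualCoact H A ▷ H ⊗≫ (β_ H H).hom ▷ (A ⊗ H) ⊗≫
          H ◁ (dualActOp H A ▷ H ≫ ε_ H A) ⊗≫ 𝟙 H := by monoidal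
      _ = 𝟙 _ ⊗≫ (H ◁ dualCoact H A ≫ (β_ H (H ⊗ A)).hom) ▷ H ⊗≫ (H ⊗ A) ◁ μ[H] ⊗≫
          H ◁ ε_ H A ⊗≫ 𝟙 H := by
        rw [e', BraidedCategory.braiding_tensor_right_hom]; monoidal
      _ = 𝟙 _ ⊗≫ (β_ H A).hom ▷ H ⊗≫ (dualCoact H A ▷ (H ⊗ H) ≫ (H ⊗ A) ◁ μ[H]) ⊗≫
          H ◁ ε_ H A ⊗≫ 𝟙 H := by
        rw [BraidedCategory.braiding_naturality_right]; monoidal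
      _ = 𝟙 _ ⊗≫ (β_ H A).hom ▷ H ⊗≫ A ◁ μ[H] ⊗≫
          (dualCoact H A ▷ H ⊗≫ H ◁ ε_ H A ⊗≫ 𝟙 H) := by
        rw [← whisker_exchange]; monoidal
      _ = _ := by
        rw [e]; monoidal
  · symm
    calc
      _ = copComul Δ[H] ▷ A ▷ H ⊗≫ H ◁ dualActOp H A ▷ H ⊗≫
          H ◁ (dualCoact H A ▷ H) ⊗≫ (μ[H] ▷ (A ⊗ H) ≫ H ◁ ε_ H A) ⊗≫ 𝟙 H := by monoidal
      _ = copComul Δ[H] ▷ A ▷ H ⊗≫ H ◁ dualActOp H A ▷ H ⊗≫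
          H ◁ (dualCoact H A ▷ H ⊗≫ H ◁ ε_ H A ⊗≫ 𝟙 H) ⊗≫ μ[H] := by
        rw [← whisker_exchange]; monoidal
      _ = copComul Δ[H] ▷ A ▷ H ⊗≫ H ◁ (dualActOp H A ▷ H ≫ A ◁ Δ[H]) ⊗≫
          H ◁ ε_ H A ▷ H ⊗≫ μ[H] := by
        rw [e]; monoidal
      _ = copComul Δ[H] ▷ A ▷ H ⊗≫ (H ⊗ H ⊗ A) ◁ Δ[H] ⊗≫
          H ◁ (dualActOp H A ▷ H ≫ ε_ H A) ▷ H ⊗≫ μ[H] := by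
        rw [← whisker_exchange]; monoidal
      _ = copComul Δ[H] ▷ A ▷ H ⊗≫ (H ⊗ H ⊗ A) ◁ Δ[H] ⊗≫ H ◁ (β_ H A).hom ▷ (H ⊗ H) ⊗≫
          (H ◁ (A ◁ μ[H] ≫ ε_ H A)) ▷ H ⊗≫ μ[H] := by
        rw [e']; monoidal
      _ = (Δ[H] ▷ A ▷ H ≫ ((H ⊗ H) ⊗ A) ◁ Δ[H]) ⊗≫
          ((β_ H H).hom ▷ A ≫ (β_ (H ⊗ H) A).hom ≫ A ◁ (β_ H H).hom) ▷ (H ⊗ H) ⊗≫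
          A ◁ H ◁ (β_ H H).hom ▷ H ⊗≫ (A ◁ μ[H] ≫ ε_ H A) ▷ (H ⊗ H) ⊗≫ μ[H] := by
        calc
          _ = Δ[H] ▷ A ▷ H ⊗≫ (((β_ H H).hom ▷ A) ▷ H ≫ ((H ⊗ H) ⊗ A) ◁ Δ[H]) ⊗≫
              H ◁ (β_ H A).hom ▷ (H ⊗ H) ⊗≫ ((β_ H A).hom ▷ (H ⊗ H) ⊗≫
              A ◁ (β_ H H).hom ▷ H ⊗≫ A ◁ H ◁ (β_ H H).hom) ▷ H ⊗≫
              (A ◁ μ[H] ≫ ε_ H A) ▷ (H ⊗ H) ⊗≫ μ[H] := by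
            rw [hb, copComul]
            simp only [BraidedCategory.braiding_tensor_right_hom]
            monoidal
          _ = _ := by
            rw [← whisker_exchange, BraidedCategory.braiding_tensor_left_hom]
            monoidal
      _ = (H ⊗ A) ◁ Δ[H] ⊗≫ (Δ[H] ▷ A ≫ (β_ (H ⊗ H) A).hom) ▷ (H ⊗ H) ⊗≫
          A ◁ H ◁ (β_ H H).hom ▷ H ⊗≫ (A ◁ μ[H]) ▷ (H ⊗ H) ⊗≫
          (ε_ H A ▷ (H ⊗ H) ≫ (𝟙_ C) ◁ μ[H]) ⊗≫ 𝟙 H := by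
        rw [hp, ← whisker_exchange]; monoidal
      _ = ((H ⊗ A) ◁ Δ[H] ≫ (β_ H A).hom ▷ (H ⊗ H)) ⊗≫ (A ◁ Δ[H]) ▷ (H ⊗ H) ⊗≫
          A ◁ H ◁ (β_ H H).hom ▷ H ⊗≫ (A ◁ μ[H]) ▷ (H ⊗ H) ⊗≫
          (A ⊗ H) ◁ μ[H] ⊗≫ ε_ H A ▷ H ⊗≫ 𝟙 H := by
        rw [BraidedCategory.braiding_naturality_left, ← whisker_exchange]; monoidal
      _ = _ := by
        rw [whisker_exchange, BimonObj.mul_comul, MonoidalCategory.tensorHom_def',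
          MonoidalCategory.tensorHom_def, tensorμ]
        monoidal

/-- The action `(h f)(x) = f(S(h) x)` of a Hopf monoid on its dual. -/
def dualAct [HopfObj H] : H ⊗ A ⟶ A := HopfObj.antipode (X := H) ▷ A ≫ dualActOp H A

/-- For the compatibility, `dualActOp_coact` is applied at `S(h₂)`: the factor `h₁ S(h₂)` that
arises is a counit, and `S(h₃)` remains to act on the functional. -/
lemma isHopfModule_dual [HopfObj H] : IsHopfModule (dualAct H A) (dualCoact H A) where
  act_mul := by
    have e : μ[H] ≫ HopfObj.antipode (X := H) = _ := HopfObj.mul_antipode H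
    rw [dualAct, ← comp_whiskerRight_assoc, e, comp_whiskerRight, Category.assoc, dualActOp_mul]
    rw [MonoidalCategory.tensorHom_def', comp_whiskerRight, Category.assoc]
    calc
      _ = (α_ H H A).hom ≫ H ◁ HopfObj.antipode (X := H) ▷ A ≫
          (HopfObj.antipode (X := H) ▷ (H ⊗ A) ≫ H ◁ dualActOp H A) ≫ dualActOp H A := by
        monoidal
      _ = _ := by
        rw [← whisker_exchange]; monoidal
  act_one := by
    rw [dualAct, ← comp_whiskerRight_assoc, HopfObj.one_antipode, dualActOp_one]
  coact_comul := dualCoact_comul H A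
  coact_counit := dualCoact_counit H A
  compat := by
    set S := HopfObj.antipode (X := H) with hS
    have e := dualActOp_coact H A
    have hl : S ≫ Δ[H] = Δ[H] ≫ (β_ H H).hom ≫ (S ⊗ₘ S) := HopfObj.antipode_comul H
    have hl' : S ≫ copComul Δ[H] = Δ[H] ≫ S ▷ H ≫ H ◁ S := by
      rw [copComul, reassoc_of% hl, BraidedCategory.braiding_naturality,
        SymmetricCategory.symmetry_assoc, MonoidalCategory.tensorHom_def]
    have hh : Δ[H] ≫ H ◁ S ≫ μ[H] = ε[H] ≫ η[H] := HopfObj.antipode_right H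
    symm
    calc
      _ = Δ[H] ▷ A ⊗≫ (H ⊗ H) ◁ dualCoact H A ⊗≫ H ◁ (β_ H H).hom ▷ A ⊗≫
          (H ⊗ H) ◁ S ▷ A ⊗≫ (μ[H] ▷ (H ⊗ A) ≫ H ◁ dualActOp H A) := by
        calc
          _ = Δ[H] ▷ A ⊗≫ (H ⊗ H) ◁ dualCoact H A ⊗≫ H ◁ (β_ H H).hom ▷ A ⊗≫
              (μ[H] ▷ (H ⊗ A) ≫ H ◁ S ▷ A) ≫ H ◁ dualActOp H A := by
            rw [tensorμ, MonoidalCategory.tensorHom_def, MonoidalCategory.tensorHom_def, dualAct]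
            monoidal
          _ = _ := by
            rw [← whisker_exchange, Category.assoc]; monoidal
      _ = Δ[H] ▷ A ⊗≫ (H ⊗ H) ◁ dualCoact H A ⊗≫ H ◁ ((β_ H H).hom ≫ H ◁ S) ▷ A ⊗≫
          H ◁ H ◁ dualActOp H A ⊗≫ μ[H] ▷ A := by
        rw [← whisker_exchange]; monoidal
      _ = Δ[H] ▷ A ⊗≫ H ◁ (H ◁ dualCoact H A ≫ S ▷ (H ⊗ A)) ⊗≫ H ◁ (β_ H H).hom ▷ A ⊗≫
          H ◁ H ◁ dualActOp H A ⊗≫ μ[H] ▷ A := by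
        rw [← BraidedCategory.braiding_naturality_left]; monoidal
      _ = Δ[H] ▷ A ⊗≫ H ◁ S ▷ A ⊗≫
          H ◁ (H ◁ dualCoact H A ⊗≫ (β_ H H).hom ▷ A ⊗≫ H ◁ dualActOp H A) ⊗≫ μ[H] ▷ A := by
        rw [whisker_exchange]; monoidal
      _ = Δ[H] ▷ A ⊗≫ H ◁ (S ≫ copComul Δ[H]) ▷ A ⊗≫ H ◁ H ◁ (dualActOp H A ≫ dualCoact H A) ⊗≫
          ((α_ H H H).hom ≫ H ◁ μ[H] ≫ μ[H]) ▷ A := by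
        rw [e]; monoidal
      _ = (Δ[H] ≫ H ◁ Δ[H] ≫ (α_ H H H).inv) ▷ A ⊗≫ (H ◁ S ▷ (H ⊗ A)) ⊗≫ (H ⊗ H) ◁ S ▷ A ⊗≫
          ((H ⊗ H) ◁ (dualActOp H A ≫ dualCoact H A) ≫ μ[H] ▷ (H ⊗ A)) ⊗≫ μ[H] ▷ A := by
        rw [← MonObj.mul_assoc, hl']; monoidal
      _ = (Δ[H] ≫ H ◁ Δ[H] ≫ (α_ H H H).inv) ▷ A ⊗≫ (H ◁ S ▷ (H ⊗ A)) ⊗≫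
          ((H ⊗ H) ◁ (S ▷ A) ≫ μ[H] ▷ (H ⊗ A)) ⊗≫
          H ◁ (dualActOp H A ≫ dualCoact H A) ⊗≫ μ[H] ▷ A := by
        rw [whisker_exchange]; monoidal
      _ = (Δ[H] ≫ (Δ[H] ≫ H ◁ S ≫ μ[H]) ▷ H) ▷ A ⊗≫ H ◁ (S ▷ A ≫ dualActOp H A ≫
          dualCoact H A) ⊗≫ μ[H] ▷ A := by
        rw [whisker_exchange, ComonObj.comul_assoc_assoc, Iso.hom_inv_id, Category.comp_id]
        monoidal
      _ = (Δ[H] ≫ ε[H] ▷ H) ▷ A ⊗≫ (η[H] ▷ (H ⊗ A) ≫ H ◁ (S ▷ A ≫ dualActOp H A ≫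
          dualCoact H A)) ⊗≫ μ[H] ▷ A := by
        rw [hh]; monoidal
      _ = 𝟙 _ ⊗≫ (S ▷ A ≫ dualActOp H A ≫ dualCoact H A) ⊗≫ (η[H] ▷ H ≫ μ[H]) ▷ A := by
        rw [← whisker_exchange, ComonObj.counit_comul]; monoidal
      _ = _ := by
        rw [MonObj.one_mul, dualAct]; monoidal

lemma counit_evaluation_one [BimonObj H] :
    (transpose ε[H] : 𝟙_ C ⟶ A) ≫ (ρ_ A).inv ≫ A ◁ η[H] ≫ ε_ H A = 𝟙 (𝟙_ C) := by
  have h : (transpose ε[H] : 𝟙_ C ⟶ A) ▷ H ≫ ε_ H A = _ ◁ ε[H] ≫ ε_ (𝟙_ C) (𝟙_ C) :=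
    isMate_transpose ε[H]
  rw [rightUnitor_inv_naturality_assoc, ← whisker_exchange_assoc, h, ← whiskerLeft_comp_assoc,
    BimonObj.one_counit, evaluation_unit]
  simp

/-- The action on the dual sees `h` only through `S(h)`, while `act_decompose` recovers `h ⊗ λ` from
`h λ` for coinvariant `λ`. So `S(h)` determines `h ⊗ λ`, and `decompose_act` applied to the counit
supplies elements that allow `λ` to be removed. -/
theorem exists_antipode_comp_eq_id (H A : C) [ExactPairing H A] [HopfObj H] :
    ∃ r : H ⟶ H, HopfObj.antipode (X := H) ≫ r = 𝟙 H := by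
  set S := HopfObj.antipode (X := H) with hS
  have hM := isHopfModule_dual H A
  set a := dualAct H A with ha
  set d := dualCoact H A
  set E := coinvProj a d
  have hE : H ◁ E ≫ a ≫ d ≫ H ◁ E = H ◁ E := hM.act_decompose
  have hd : d ≫ H ◁ E ≫ a = 𝟙 A := hM.decompose_act
  have hc := counit_evaluation_one H A
  set e : 𝟙_ C ⟶ A := transpose ε[H]
  set c : A ⟶ 𝟙_ C := (ρ_ A).inv ≫ A ◁ η[H] ≫ ε_ H A
  -- Decompose the counit of `H` as `∑ kᵢ λᵢ` with `λᵢ` coinvariant. Given `y`, let it act on `λᵢ`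
  -- by `dualActOp`, decompose the result by `d` and `E`, let `kᵢ` act on the coinvariant part, and
  -- evaluate at the unit. For `y = S(x)` this gives `x ε(1) = x`.
  refine ⟨𝟙 H ⊗≫ H ◁ (e ≫ d ≫ H ◁ E) ⊗≫ (β_ H H).hom ▷ A ⊗≫
    H ◁ (dualActOp H A ≫ d ≫ H ◁ E) ⊗≫ (β_ H H).hom ▷ A ⊗≫ H ◁ (a ≫ c) ⊗≫ 𝟙 H, ?_⟩
  calc
    _ = 𝟙 H ⊗≫ (S ▷ (𝟙_ C) ≫ H ◁ (e ≫ d ≫ H ◁ E)) ⊗≫ (β_ H H).hom ▷ A ⊗≫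
        H ◁ (dualActOp H A ≫ d ≫ H ◁ E) ⊗≫ (β_ H H).hom ▷ A ⊗≫ H ◁ (a ≫ c) ⊗≫ 𝟙 H := by
      monoidal
    _ = 𝟙 H ⊗≫ H ◁ (e ≫ d ≫ H ◁ E) ⊗≫ (S ▷ H ≫ (β_ H H).hom) ▷ A ⊗≫
        H ◁ (dualActOp H A ≫ d ≫ H ◁ E) ⊗≫ (β_ H H).hom ▷ A ⊗≫ H ◁ (a ≫ c) ⊗≫ 𝟙 H := by
      rw [← whisker_exchange]; monoidal
    _ = 𝟙 H ⊗≫ H ◁ (e ≫ d) ⊗≫ ((H ⊗ H) ◁ E ≫ (β_ H H).hom ▷ A) ⊗≫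
        H ◁ ((S ▷ A ≫ dualActOp H A) ≫ d ≫ H ◁ E) ⊗≫ (β_ H H).hom ▷ A ⊗≫ H ◁ (a ≫ c) ⊗≫
        𝟙 H := by
      rw [BraidedCategory.braiding_naturality_left]; monoidal
    _ = 𝟙 H ⊗≫ H ◁ (e ≫ d) ⊗≫ (β_ H H).hom ▷ A ⊗≫ H ◁ (H ◁ E ≫ a ≫ d ≫ H ◁ E) ⊗≫
        (β_ H H).hom ▷ A ⊗≫ H ◁ (a ≫ c) ⊗≫ 𝟙 H := by
      rw [whisker_exchange, ha, dualAct]; monoidal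
    _ = 𝟙 H ⊗≫ H ◁ (e ≫ d) ⊗≫ ((β_ H H).hom ▷ A ≫ (H ⊗ H) ◁ E) ⊗≫
        (β_ H H).hom ▷ A ⊗≫ H ◁ (a ≫ c) ⊗≫ 𝟙 H := by
      rw [hE]; monoidal
    _ = 𝟙 H ⊗≫ H ◁ (e ≫ d ≫ H ◁ E) ⊗≫ ((β_ H H).hom ≫ (β_ H H).hom) ▷ A ⊗≫ H ◁ (a ≫ c) ⊗≫
        𝟙 H := by
      rw [← whisker_exchange]; monoidal
    _ = 𝟙 H ⊗≫ H ◁ (e ≫ (d ≫ H ◁ E ≫ a) ≫ c) ⊗≫ 𝟙 H := by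
      rw [SymmetricCategory.symmetry]; monoidal
    _ = _ := by
      rw [hd, Category.id_comp, hc]; monoidal

/-- The antipode of the dual is the transpose of `S`; its one-sided inverse transposes back to an
inverse of `S` on the opposite side. -/
theorem isIso_antipode (H A : C) [ExactPairing H A] [HopfObj H] : IsIso (HopfObj.antipode (X := H)) := by
  obtain ⟨r, hr⟩ := exists_antipode_comp_eq_id H A
  let _ : HopfObj A := dualHopf H A
  -- The braiding makes `H` a left dual of `A`, so the preceding theorem also applies to `A`.
  let _ : ExactPairing A H := BraidedCategory.exactPairing_swap H A
  obtain ⟨s, hs⟩ := exists_antipode_comp_eq_id A H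
  obtain ⟨r', hr'⟩ := exists_isMate (U := H) (V := H) s
  have h : r' ≫ HopfObj.antipode (X := H) = 𝟙 H := by
    have hm := hr'.comp (isMate_transpose (HopfObj.antipode (X := H)) (V' := A) (U' := A))
    rw [show transpose (HopfObj.antipode (X := H)) ≫ s = 𝟙 A from hs] at hm
    exact hm.unique_left isMate_id
  have e : r = r' := by
    rw [← Category.id_comp r, ← h, Category.assoc, hr, Category.comp_id]
  exact ⟨r, hr, e ▸ h⟩

end DualHopfModule

/-! ### Trivial double braidings and the symmetric subcategory generated by `H` and `A`. -/

section DoubleBraiding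

variable {C : Type u} [Category.{v} C] [MonoidalCategory C] [BraidedCategory C]

/-- The double braiding of `X` and `Y` is trivial. -/
def Centralizes (X Y : C) : Prop := (β_ X Y).hom ≫ (β_ Y X).hom = 𝟙 (X ⊗ Y)

lemma Centralizes.symm {X Y : C} (h : Centralizes X Y) : Centralizes Y X := by
  have e : (β_ Y X).hom = (β_ X Y).inv := by
    rw [← cancel_epi (β_ X Y).hom, Iso.hom_inv_id]; exact h
  rw [Centralizes, e, Iso.inv_hom_id]

lemma centralizes_tensorUnit (X : C) : Centralizes X (𝟙_ C) := by
  rw [Centralizes, braiding_tensorUnit_right, braiding_tensorUnit_left]; simp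

lemma Centralizes.tensor {X Y Z : C} (h : Centralizes X Y) (h' : Centralizes X Z) :
    Centralizes X (Y ⊗ Z) := by
  unfold Centralizes at *
  rw [BraidedCategory.braiding_tensor_right_hom, BraidedCategory.braiding_tensor_left_hom]
  calc
    _ = 𝟙 _ ⊗≫ (β_ X Y).hom ▷ Z ⊗≫ Y ◁ ((β_ X Z).hom ≫ (β_ Z X).hom) ⊗≫ (β_ Y X).hom ▷ Z ⊗≫
        𝟙 _ := by monoidal
    _ = 𝟙 _ ⊗≫ ((β_ X Y).hom ≫ (β_ Y X).hom) ▷ Z ⊗≫ 𝟙 _ := by rw [h']; monoidal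
    _ = _ := by rw [h]; monoidal

lemma braiding_coevaluation (X X' Y : C) [ExactPairing X X'] :
    Y ◁ η_ X X' ⊗≫ (β_ X Y).inv ▷ X' ⊗≫ 𝟙 (X ⊗ Y ⊗ X') =
      𝟙 _ ⊗≫ η_ X X' ▷ Y ⊗≫ X ◁ (β_ X' Y).hom ⊗≫ 𝟙 (X ⊗ Y ⊗ X') := by
  have h : Y ◁ η_ X X' ≫ (β_ (X ⊗ X') Y).inv = _ :=
    BraidedCategory.braiding_inv_naturality_right Y (η_ X X')
  have e : X ◁ (β_ X' Y).inv ≫ X ◁ (β_ X' Y).hom = 𝟙 _ := by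
    rw [← whiskerLeft_comp, Iso.inv_hom_id, whiskerLeft_id]
  rw [braiding_inv_tensorUnit_left, BraidedCategory.braiding_tensor_left_inv] at h
  calc
    _ = Y ◁ η_ X X' ⊗≫ (β_ X Y).inv ▷ X' ⊗≫ (X ◁ (β_ X' Y).inv ≫ X ◁ (β_ X' Y).hom) ⊗≫
        𝟙 _ := by rw [e]; monoidal
    _ = (Y ◁ η_ X X' ≫ (α_ Y X X').inv ≫ (β_ X Y).inv ▷ X' ≫ (α_ X Y X').hom ≫
        X ◁ (β_ X' Y).inv ≫ (α_ X X' Y).inv) ⊗≫ X ◁ (β_ X' Y).hom ⊗≫ 𝟙 _ := by monoidal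
    _ = _ := by rw [h]; monoidal

/-- By naturality the double braiding of `X' ⊗ X` with `Y` is invisible to the evaluation. Its part
on `X` is trivial by hypothesis, so its part `m` on `X'` is invisible too, and a zigzag then removes
`m`. -/
lemma Centralizes.dual {X X' Y : C} [ExactPairing X X'] (h : Centralizes X Y) :
    Centralizes X' Y := by
  unfold Centralizes
  set m := (β_ X' Y).hom ≫ (β_ Y X').hom with hm
  have e : (β_ Y X).hom = (β_ X Y).inv := by
    rw [← cancel_epi (β_ X Y).hom, Iso.hom_inv_id]; exact h
  have h₁ : (X' ◁ (β_ X Y).hom ⊗≫ m ▷ X ⊗≫ X' ◁ (β_ X Y).inv) ⊗≫ ε_ X X' ▷ Y ⊗≫ 𝟙 Y =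
      𝟙 _ ⊗≫ ε_ X X' ▷ Y ⊗≫ 𝟙 Y := by
    have h₂ : ε_ X X' ▷ Y ≫ (β_ (𝟙_ C) Y).hom ≫ (β_ Y (𝟙_ C)).hom = ε_ X X' ▷ Y := by
      rw [(centralizes_tensorUnit Y).symm, Category.comp_id]
    rw [BraidedCategory.braiding_naturality_left_assoc,
      BraidedCategory.braiding_naturality_right, BraidedCategory.braiding_tensor_left_hom,
      BraidedCategory.braiding_tensor_right_hom, e] at h₂
    calc
      _ = 𝟙 _ ⊗≫ (((α_ X' X Y).hom ≫ X' ◁ (β_ X Y).hom ≫ (α_ X' Y X).inv ≫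
          (β_ X' Y).hom ▷ X ≫ (α_ Y X' X).hom) ≫ ((α_ Y X' X).inv ≫ (β_ Y X').hom ▷ X ≫
          (α_ X' Y X).hom ≫ X' ◁ (β_ X Y).inv ≫ (α_ X' X Y).inv) ≫ ε_ X X' ▷ Y) ⊗≫ 𝟙 Y := by
        rw [hm]; monoidal
      _ = _ := by
        simp only [Category.assoc] at h₂ ⊢
        rw [h₂]
  have h₃ : m ▷ X ⊗≫ X' ◁ (β_ X Y).inv ⊗≫ ε_ X X' ▷ Y ⊗≫ 𝟙 Y =
      𝟙 _ ⊗≫ X' ◁ (β_ X Y).inv ⊗≫ ε_ X X' ▷ Y ⊗≫ 𝟙 Y := by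
    have e' : X' ◁ (β_ X Y).inv ≫ X' ◁ (β_ X Y).hom = 𝟙 _ := by
      rw [← whiskerLeft_comp, Iso.inv_hom_id, whiskerLeft_id]
    calc
      _ = 𝟙 _ ⊗≫ (X' ◁ (β_ X Y).inv ≫ X' ◁ (β_ X Y).hom) ⊗≫ m ▷ X ⊗≫ X' ◁ (β_ X Y).inv ⊗≫
          ε_ X X' ▷ Y ⊗≫ 𝟙 Y := by rw [e']; monoidal
      _ = 𝟙 _ ⊗≫ X' ◁ (β_ X Y).inv ⊗≫ ((X' ◁ (β_ X Y).hom ⊗≫ m ▷ X ⊗≫ X' ◁ (β_ X Y).inv) ⊗≫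
          ε_ X X' ▷ Y ⊗≫ 𝟙 Y) := by monoidal
      _ = _ := by rw [h₁]; monoidal
  -- The braiding of `X'` with `Y` is rewritten through the evaluation and the inverse braiding of
  -- `X`, the form in which `h₃` absorbs `m`.
  have h₄ : 𝟙 (X' ⊗ Y) ⊗≫ X' ◁ (Y ◁ η_ X X' ⊗≫ (β_ X Y).inv ▷ X' ⊗≫ 𝟙 (X ⊗ Y ⊗ X')) ⊗≫
      ε_ X X' ▷ (Y ⊗ X') ⊗≫ 𝟙 (Y ⊗ X') = (β_ X' Y).hom := by
    calc
      _ = 𝟙 (X' ⊗ Y) ⊗≫ X' ◁ η_ X X' ▷ Y ⊗≫ ((X' ⊗ X) ◁ (β_ X' Y).hom ≫ ε_ X X' ▷ (Y ⊗ X')) ⊗≫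
          𝟙 (Y ⊗ X') := by
        rw [braiding_coevaluation]; monoidal
      _ = 𝟙 (X' ⊗ Y) ⊗≫ (X' ◁ η_ X X' ⊗≫ ε_ X X' ▷ X') ▷ Y ⊗≫ (β_ X' Y).hom := by
        rw [whisker_exchange]; monoidal
      _ = _ := by
        rw [ExactPairing.coevaluation_evaluation'']; monoidal
  rw [← cancel_mono (β_ X' Y).hom, Category.id_comp]
  calc
    _ = 𝟙 _ ⊗≫ (m ▷ (𝟙_ C) ≫ (X' ⊗ Y) ◁ η_ X X') ⊗≫ X' ◁ (β_ X Y).inv ▷ X' ⊗≫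
        ε_ X X' ▷ (Y ⊗ X') ⊗≫ 𝟙 (Y ⊗ X') := by
      conv_lhs => rw [← h₄]
      monoidal
    _ = 𝟙 _ ⊗≫ (X' ⊗ Y) ◁ η_ X X' ⊗≫ (m ▷ X ⊗≫ X' ◁ (β_ X Y).inv ⊗≫ ε_ X X' ▷ Y ⊗≫ 𝟙 Y) ▷ X' ⊗≫
        𝟙 (Y ⊗ X') := by
      rw [← whisker_exchange]; monoidal
    _ = 𝟙 (X' ⊗ Y) ⊗≫ X' ◁ (Y ◁ η_ X X' ⊗≫ (β_ X Y).inv ▷ X' ⊗≫ 𝟙 (X ⊗ Y ⊗ X')) ⊗≫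
        ε_ X X' ▷ (Y ⊗ X') ⊗≫ 𝟙 (Y ⊗ X') := by
      rw [h₃]; monoidal
    _ = _ := h₄

/-- The objects generated by `H` and `A` under tensor products. -/
inductive tensorClosure (H A : C) : ObjectProperty C
  | fst : tensorClosure H A H
  | snd : tensorClosure H A A
  | unit : tensorClosure H A (𝟙_ C)
  | tensor (X Y : C) (hX : tensorClosure H A X) (hY : tensorClosure H A Y) :
    tensorClosure H A (X ⊗ Y)

instance (H A : C) : (tensorClosure H A).IsMonoidal where
  prop_unit := .unit
  prop_tensor := .tensor

lemma tensorClosure.centralizes {H A : C} [ExactPairing H A] (hH : Centralizes H H) {X Y : C}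
    (hX : tensorClosure H A X) (hY : tensorClosure H A Y) : Centralizes X Y := by
  have key {Z : C} (h₁ : Centralizes Z H) (h₂ : Centralizes Z A) {W : C}
      (hW : tensorClosure H A W) : Centralizes Z W := by
    induction hW with
    | fst => exact h₁
    | snd => exact h₂
    | unit => exact centralizes_tensorUnit Z
    | tensor _ _ _ _ h h' => exact h.tensor h'
  have hA : Centralizes H A := hH.dual.symm
  -- The induction `key` is used three times: on `X` against each generator, and then on `Y`.
  exact key (key hH hA hX).symm (key hA.symm hA.dual hX).symm hY

end DoubleBraiding

/-! ### Transport between `C` and its monoidal full subcategory. -/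

section Transport

variable {C : Type u} [Category.{v} C] [MonoidalCategory C] [BraidedCategory C]
  {P : ObjectProperty C} [P.IsMonoidal]

/-- A monoidal full subcategory is symmetric if its double braidings are trivial. -/
@[reducible]
def symmetricSubcategory (h : ∀ X Y : C, P X → P Y → Centralizes X Y) :
    SymmetricCategory P.FullSubcategory where
  symmetry X Y := ObjectProperty.hom_ext _ (h X.obj Y.obj X.property Y.property)

/-- Hopf monoids of `C` lift to monoidal full subcategories. -/
@[reducible]
def liftHopf (X : P.FullSubcategory) [HopfObj X.obj] : HopfObj X where
  one := ObjectProperty.homMk η[X.obj]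
  mul := ObjectProperty.homMk μ[X.obj]
  counit := ObjectProperty.homMk ε[X.obj]
  comul := ObjectProperty.homMk Δ[X.obj]
  antipode := ObjectProperty.homMk (HopfObj.antipode (X := X.obj))
  one_mul := ObjectProperty.hom_ext _ (MonObj.one_mul X.obj)
  mul_one := ObjectProperty.hom_ext _ (MonObj.mul_one X.obj)
  mul_assoc := ObjectProperty.hom_ext _ (MonObj.mul_assoc X.obj)
  counit_comul := ObjectProperty.hom_ext _ (ComonObj.counit_comul X.obj)
  comul_counit := ObjectProperty.hom_ext _ (ComonObj.comul_counit X.obj)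
  comul_assoc := ObjectProperty.hom_ext _ (ComonObj.comul_assoc X.obj)
  mul_comul := ObjectProperty.hom_ext _ (BimonObj.mul_comul X.obj)
  one_comul := ObjectProperty.hom_ext _ (BimonObj.one_comul X.obj)
  mul_counit := ObjectProperty.hom_ext _ (BimonObj.mul_counit X.obj)
  one_counit := ObjectProperty.hom_ext _ (BimonObj.one_counit X.obj)
  antipode_left := ObjectProperty.hom_ext _ (HopfObj.antipode_left X.obj)
  antipode_right := ObjectProperty.hom_ext _ (HopfObj.antipode_right X.obj)

/-- Hopf monoids of a monoidal full subcategory are Hopf monoids. -/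
@[reducible]
def hopfObj (X : P.FullSubcategory) [HopfObj X] : HopfObj X.obj where
  one := η[X].hom
  mul := μ[X].hom
  counit := ε[X].hom
  comul := Δ[X].hom
  antipode := (HopfObj.antipode (X := X)).hom
  one_mul := congrArg (fun f => f.hom) (MonObj.one_mul X)
  mul_one := congrArg (fun f => f.hom) (MonObj.mul_one X)
  mul_assoc := congrArg (fun f => f.hom) (MonObj.mul_assoc X)
  counit_comul := congrArg (fun f => f.hom) (ComonObj.counit_comul X)
  comul_counit := congrArg (fun f => f.hom) (ComonObj.comul_counit X)
  comul_assoc := congrArg (fun f => f.hom) (ComonObj.comul_assoc X)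
  mul_comul := congrArg (fun f => f.hom) (BimonObj.mul_comul X)
  one_comul := congrArg (fun f => f.hom) (BimonObj.one_comul X)
  mul_counit := congrArg (fun f => f.hom) (BimonObj.mul_counit X)
  one_counit := congrArg (fun f => f.hom) (BimonObj.one_counit X)
  antipode_left := congrArg (fun f => f.hom) (HopfObj.antipode_left X)
  antipode_right := congrArg (fun f => f.hom) (HopfObj.antipode_right X)

/-- Exact pairings of `C` lift to monoidal full subcategories. -/
@[reducible]
def liftExactPairing (X Y : P.FullSubcategory) [ExactPairing X.obj Y.obj] : ExactPairing X Y where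
  coevaluation' := ObjectProperty.homMk (η_ X.obj Y.obj)
  evaluation' := ObjectProperty.homMk (ε_ X.obj Y.obj)
  coevaluation_evaluation' :=
    ObjectProperty.hom_ext _ (ExactPairing.coevaluation_evaluation X.obj Y.obj)
  evaluation_coevaluation' :=
    ObjectProperty.hom_ext _ (ExactPairing.evaluation_coevaluation X.obj Y.obj)

end Transport

section Transport

variable {C : Type u} [Category.{v} C] [MonoidalCategory C] [BraidedCategory C]
  {P : ObjectProperty C} [P.IsMonoidal]

/-- Exact pairings of a monoidal full subcategory are exact pairings. -/
@[reducible]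
def exactPairingObj (X Y : P.FullSubcategory) [ExactPairing X Y] : ExactPairing X.obj Y.obj where
  coevaluation' := (η_ X Y).hom
  evaluation' := (ε_ X Y).hom
  coevaluation_evaluation' :=
    congrArg (fun f => f.hom) (ExactPairing.coevaluation_evaluation X Y)
  evaluation_coevaluation' :=
    congrArg (fun f => f.hom) (ExactPairing.evaluation_coevaluation X Y)

section

attribute [local instance] hopfObj exactPairingObj

/-- The monoidal and braided structure of the full subcategory is that of `C`, so each axiom, here
and in the lemmas that follow, is the underlying equation of morphisms. -/
lemma isDualOp_hom (H A : P.FullSubcategory) [HopfObj H] [HopfObj A] [ExactPairing H A]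
    (h : IsDualOp H A) : IsDualOp H.obj A.obj where
  mul_eq := congrArg (fun f => f.hom) h.mul_eq
  one_eq := congrArg (fun f => f.hom) h.one_eq
  comul_eq := congrArg (fun f => f.hom) h.comul_eq
  counit_eq := congrArg (fun f => f.hom) h.counit_eq

lemma isSkewPairing_hom (H A : P.FullSubcategory) [HopfObj H] [HopfObj A]
    (p : H ⊗ A ⟶ 𝟙_ P.FullSubcategory) (h : IsSkewPairing p) :
    IsSkewPairing (H := H.obj) (A := A.obj) p.hom where
  mul_left := congrArg (fun f => f.hom) h.mul_left
  mul_right := congrArg (fun f => f.hom) h.mul_right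
  one_left := congrArg (fun f => f.hom) h.one_left
  one_right := congrArg (fun f => f.hom) h.one_right

end

lemma isSymmetricPairing_hom {V W : P.FullSubcategory} {p : V ⊗ W ⟶ 𝟙_ P.FullSubcategory}
    (h : IsSymmetricPairing p) : IsSymmetricPairing (V := V.obj) (W := W.obj) p.hom := by
  obtain ⟨h₁, h₂⟩ := h
  constructor <;> unfold IsSymmetricAt at *
  · exact congrArg (fun f => f.hom) h₁
  · exact congrArg (fun f => f.hom) h₂

attribute [local instance] ComonObj.instTensorUnit in
lemma isQuasitriangular_hom (D : P.FullSubcategory) (K : HopfObj D)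
    (R : 𝟙_ P.FullSubcategory ⟶ D ⊗ D) (h : IsQuasitriangular D R) :
    letI := hopfObj D
    IsQuasitriangular D.obj R.hom :=
  letI := hopfObj D
  { invertible := by
      obtain ⟨R', h₁, h₂⟩ := h.invertible
      exact ⟨R'.hom, congrArg (fun f => f.hom) h₁, congrArg (fun f => f.hom) h₂⟩
    coassoc := congrArg (fun f => f.hom) h.coassoc
    counit_left := congrArg (fun f => f.hom) h.counit_left
    counit_right := congrArg (fun f => f.hom) h.counit_right
    qt1 := congrArg (fun f => f.hom) h.qt1
    qt2 := congrArg (fun f => f.hom) h.qt2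
    qt3 := congrArg (fun f => f.hom) h.qt3 }

lemma isQuasitriangularHopf_hom {D : P.FullSubcategory} {m : D ⊗ D ⟶ D}
    {e : 𝟙_ P.FullSubcategory ⟶ D} {d : D ⟶ D ⊗ D} {c : D ⟶ 𝟙_ P.FullSubcategory}
    {R : 𝟙_ P.FullSubcategory ⟶ D ⊗ D} (h : IsQuasitriangularHopf m e d c R) :
    IsQuasitriangularHopf (D := D.obj) m.hom e.hom d.hom c.hom R.hom := by
  obtain ⟨K, rfl, rfl, rfl, rfl, h⟩ := h
  exact ⟨hopfObj D, rfl, rfl, rfl, rfl, isQuasitriangular_hom D K R h⟩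

/-- The Drinfeld double in a symmetric category. -/
theorem exists_drinfeldDouble {C : Type u} [Category.{v} C] [MonoidalCategory C]
    [SymmetricCategory C] (H A : C) [HopfObj H] [ExactPairing H A] :
    ∃ _ : HopfObj A, IsDualOp H A ∧ IsSkewPairing (evalPairing H A) ∧
      IsSymmetricPairing (evalPairing H A) ∧
      ∃ τ' : H ⊗ A ⟶ 𝟙_ C, IsConvInverse (evalPairing H A) τ' ∧
        IsQuasitriangularHopf (doubleCrossMul (evalPairing H A) τ')
          η[A ⊗ H] Δ[A ⊗ H] ε[A ⊗ H] (coevalMatrix H A) := by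
  -- Needed because the antipode of `A` is the transpose of the inverse of the antipode of `H`.
  have := isIso_antipode H A
  let _ := dualCopHopf H A
  exact ⟨dualCopHopf H A, (isDualCop_dualCopHopf H A).main⟩

end Transport

end BraidedDouble

theorem theorem3p2 {C : Type u} [Category.{v} C] [MonoidalCategory C] [BraidedCategory C]
    (H A : C) [HopfObj H] [ExactPairing H A]
    (hH : (β_ H H).hom = (β_ H H).inv) :
    ∃ _ : HopfObj A, BraidedDouble.IsDualOp H A ∧
      BraidedDouble.IsSkewPairing (BraidedDouble.evalPairing H A) ∧
      BraidedDouble.IsSymmetricPairing (BraidedDouble.evalPairing H A) ∧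
      ∃ τ' : H ⊗ A ⟶ 𝟙_ C,
        BraidedDouble.IsConvInverse (BraidedDouble.evalPairing H A) τ' ∧
        BraidedDouble.IsQuasitriangularHopf
          (BraidedDouble.doubleCrossMul (BraidedDouble.evalPairing H A) τ')
          η[A ⊗ H] Δ[A ⊗ H] ε[A ⊗ H]
          (BraidedDouble.coevalMatrix H A) := by
  have hc : BraidedDouble.Centralizes H H := by
    unfold BraidedDouble.Centralizes
    nth_rewrite 1 [hH]
    exact (β_ H H).inv_hom_id
  -- Only tensor products of `H`, `A` and the unit occur in the statement, and on these the braiding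
  -- is symmetric.
  let P := BraidedDouble.tensorClosure H A
  let H' : P.FullSubcategory := ⟨H, .fst⟩
  let A' : P.FullSubcategory := ⟨A, .snd⟩
  let _ : SymmetricCategory P.FullSubcategory :=
    BraidedDouble.symmetricSubcategory fun _ _ hX hY => hX.centralizes hc hY
  let _ : HopfObj H'.obj := ‹HopfObj H›
  let _ : ExactPairing H'.obj A'.obj := ‹ExactPairing H A›
  let _ : HopfObj H' := BraidedDouble.liftHopf H'
  let _ : ExactPairing H' A' := BraidedDouble.liftExactPairing H' A'
  obtain ⟨K, h₁, h₂, h₃, τ', ⟨h₄, h₅⟩, h₆⟩ := BraidedDouble.exists_drinfeldDouble H' A'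
  refine ⟨BraidedDouble.hopfObj A', BraidedDouble.isDualOp_hom H' A' h₁, BraidedDouble.isSkewPairing_hom H' A' _ h₂,
    BraidedDouble.isSymmetricPairing_hom h₃, τ'.hom, ⟨congrArg (fun f => f.hom) h₄,
      congrArg (fun f => f.hom) h₅⟩, BraidedDouble.isQuasitriangularHopf_hom h₆⟩
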